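/- Let $\mathcal D=\{D_1,\dots,D_n\}$ ($n\ge 1$) be independent discrete probability distributions, where $D_i$ takes the value $q_{i,j}\in\mathbb R^d\cup\{\bot\}$ ($d\ge 1$) with probability $p_{i,j}\ge 0$ for $j=1,\dots,z$, and $\sum_{j=1}^z p_{i,j}=1$; the value $\bot$ means that the $i$-th point is absent. A realization $X\sim\mathcal D$ is the finite set of those points of $\mathbb R^d$ that are drawn, $X$ being obtained from $(j_1,\dots,j_n)\in[z]^n$ with probability $\prod_{i=1}^n p_{i,j_i}$. Let $K\colon\mathbb R^d\times\mathbb R^d\to\mathbb R$ be a kernel with feature map $\varphi\colon\mathbb R^d\to\mathcal H$ into a real Hilbert space $\mathcal H$, that is, $K(x,y)=\langle\varphi(x),\varphi(y)\rangle$ for all $x,y$. For $c\in\mathcal H$ and a finite set $P\subset\mathcal H$ put $m(c,P)=\max_{p\in P}\|c-p\|$, with $m(c,\emptyset)=0$. The probabilistic support vector data description problem is to minimize $c\mapsto\mathbb E_X[m(c,\varphi(X))]$ over $c\in\mathcal H$. Model of computation: a program is a fixed finite while-program for a real RAM (exact real arithmetic $+,-,\cdot,/,\sqrt{\ }$ and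 comparisons of reals, $+,-,\cdot$ and comparisons of natural numbers, indirect addressing, no rounding of reals to integers, and independent coins whose bias is a computed real number, all at unit cost). It can read $n$, $z$, $\varepsilon$ and the $p_{i,j}$, can test whether $q_{i,j}=\bot$, and has no other access to the locations, to $K$ or to $\mathcal H$ than evaluations $K(q_{i,j},q_{k,l})$, each of which is charged $d$ time steps. **Theorem.** There are a constant $C>0$ and one such program with the following property. For all $d,n\ge 1$ and $z$, every $0<\varepsilon<1/9$, and all $\mathcal D$, $K$, $\varphi$, $\mathcal H$ as above, the minimum $\min_{c\in\mathcal H}\mathbb E_X[m(c,\varphi(X))]$ is attained, every run of the program halts after at most $$C\cdot d\,n\left(\frac{z}{\varepsilon^3}\log\frac1\varepsilon+\frac1{\varepsilon^8}\log^2\frac1\varepsilon\right)$$ time steps, and it returns a finite list of locations and real coefficients $(q_w,\gamma_w)_w$ which implicitly represents a center $\tilde c=\sum_w\gamma_w\varphi(q_w)\in\mathcal H$, such that with probability at least $1/8$ over the coins of the program $$\mathbb E_X[m(\tilde c,\varphi(X))]\le(1+\varepsilon)\min_{c\in\mathcal H}\mathbb E_X[m(c,\varphi(X))].$$ -/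

import Mathlib

open scoped NNReal ENNReal

noncomputable section

namespace PSVDD

/-! ### Probabilistic inputs and the probabilistic SVDD cost -/

/-- `n` independent discrete distributions, each over `z` locations in `ℝ^d ∪ {⊥}`.
`loc i j = none` stands for the location `⊥` (the `i`-th point is absent), and `prob i j` is the
probability of the `j`-th location of the `i`-th distribution. -/
structure ProbInput (d n z : ℕ) where
  loc : Fin n → Fin z → Option (EuclideanSpace ℝ (Fin d))
  prob : Fin n → Fin z → ℝ
  prob_nonneg : ∀ i j, 0 ≤ prob i j
  prob_sum : ∀ i, ∑ j, prob i j = 1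

open Classical in
/-- The set of points realized by the choice `j = (j_1, …, j_n)` of locations; absent points are
dropped. -/
def ProbInput.realization {d n z : ℕ} (D : ProbInput d n z) (j : Fin n → Fin z) :
    Finset (EuclideanSpace ℝ (Fin d)) :=
  Finset.eraseNone (Finset.univ.image fun i => D.loc i (j i))

/-- The probability of the choice `j`, by independence. -/
def ProbInput.weight {d n z : ℕ} (D : ProbInput d n z) (j : Fin n → Fin z) : ℝ :=
  ∏ i, D.prob i (j i)

/-- `m(c, P) = max_{p ∈ P} ‖c - p‖`, with `m(c, ∅) = 0`. -/
def maxDist {H : Type*} [NormedAddCommGroup H] (c : H) (P : Finset H) : ℝ :=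
  ((P.sup fun p => ‖c - p‖₊ : ℝ≥0) : ℝ)

open Classical in
/-- The expected SVDD cost `E_X[m(c, φ(X))]` of a center `c` in the feature space. -/
def expectedCost {H : Type*} [NormedAddCommGroup H] {d n z : ℕ} (D : ProbInput d n z)
    (φ : EuclideanSpace ℝ (Fin d) → H) (c : H) : ℝ :=
  ∑ j : Fin n → Fin z, D.weight j * maxDist c ((D.realization j).image φ)

/-- `φ` is a feature map of the kernel `K`. -/
def IsFeatureMap {H : Type*} [NormedAddCommGroup H] [InnerProductSpace ℝ H] {d : ℕ}
    (K : EuclideanSpace ℝ (Fin d) → EuclideanSpace ℝ (Fin d) → ℝ)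
    (φ : EuclideanSpace ℝ (Fin d) → H) : Prop :=
  ∀ x y, K x y = inner ℝ (φ x) (φ y)

/-! ### What an algorithm can see of the input

Locations are only referred to by their indices. The algorithm can read `n`, `z`, `ε` and the
probabilities, can test whether a location is `⊥`, and can ask for the kernel value of two
locations. It sees neither the coordinates of the locations nor the feature space. -/

structure Oracle where
  n : ℕ
  z : ℕ
  eps : ℝ
  /-- the probabilities `p_{i,j}` (indices from `0`; value `0` out of range) -/
  prob : ℕ → ℕ → ℝ
  /-- whether `(i, j)` is in range and the location `q_{i,j}` is not `⊥` -/
  present : ℕ → ℕ → Prop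
  /-- `ker i j k l = K(q_{i,j}, q_{k,l})`, or `0` if one of the two is absent -/
  ker : ℕ → ℕ → ℕ → ℕ → ℝ
  /-- the number of time steps charged for one kernel evaluation -/
  kerCost : ℕ

/-- The location with the indices `i, j`; `none` if it is `⊥` or the indices are out of range. -/
def ProbInput.loc? {d n z : ℕ} (D : ProbInput d n z) (i j : ℕ) :
    Option (EuclideanSpace ℝ (Fin d)) :=
  if h : i < n ∧ j < z then D.loc ⟨i, h.1⟩ ⟨j, h.2⟩ else none

/-- The oracle of an input `D` in `ℝ^d` with kernel `K` and error parameter `ε`. A kernel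
evaluation is charged `d` time steps. -/
def ProbInput.oracle {d n z : ℕ} (D : ProbInput d n z)
    (K : EuclideanSpace ℝ (Fin d) → EuclideanSpace ℝ (Fin d) → ℝ) (ε : ℝ) : Oracle where
  n := n
  z := z
  eps := ε
  prob i j := if h : i < n ∧ j < z then D.prob ⟨i, h.1⟩ ⟨j, h.2⟩ else 0
  present i j := (D.loc? i j).isSome
  ker i j k l :=
    match D.loc? i j, D.loc? k l with
    | some x, some y => K x y
    | _, _ => 0
  kerCost := d

/-! ### Randomized while programs over a real RAM

The memory consists of arrays of natural numbers (for indices and counters) and arrays of real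
numbers, all initially zero. There is no operation that rounds a real number to a natural number.
Programs are finite objects that do not depend on the input. -/

/-- The contents of the memory: cell `i` of array `a`. -/
structure Mem where
  nat : ℕ → ℕ → ℕ
  real : ℕ → ℕ → ℝ

/-- Index expressions. -/
inductive NExp where
  | const (k : ℕ)
  | n
  | z
  | get (a : ℕ) (i : NExp)
  | add (s t : NExp)
  | sub (s t : NExp)
  | mul (s t : NExp)

/-- Real expressions. -/
inductive RExp where
  | const (q : ℚ)
  | eps
  | cast (s : NExp)
  | get (a : ℕ) (i : NExp)
  | prob (i j : NExp)
  | ker (i j k l : NExp)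
  | add (s t : RExp)
  | sub (s t : RExp)
  | mul (s t : RExp)
  | div (s t : RExp)
  | sqrt (s : RExp)

/-- Tests. -/
inductive BExp where
  | nle (s t : NExp)
  | rle (s t : RExp)
  | present (i j : NExp)
  | not (b : BExp)
  | and (b c : BExp)

/-- Commands. `toss a i r` puts `1` into cell `i` of the natural-number array `a` with probability
`r` (clamped to `[0, 1]`) and `0` otherwise, with fresh randomness. -/
inductive Cmd where
  | skip
  | nset (a : ℕ) (i e : NExp)
  | rset (a : ℕ) (i : NExp) (e : RExp)
  | toss (a : ℕ) (i : NExp) (r : RExp)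
  | seq (p q : Cmd)
  | ite (b : BExp) (p q : Cmd)
  | while (b : BExp) (p : Cmd)

namespace NExp

def eval (O : Oracle) (m : Mem) : NExp → ℕ
  | const k => k
  | n => O.n
  | z => O.z
  | get a i => m.nat a (i.eval O m)
  | add s t => s.eval O m + t.eval O m
  | sub s t => s.eval O m - t.eval O m
  | mul s t => s.eval O m * t.eval O m

/-- Each memory access and each arithmetic operation takes one time step. -/
def cost : NExp → ℕ
  | const _ => 1
  | n => 1
  | z => 1
  | get _ i => i.cost + 1
  | add s t => s.cost + t.cost + 1
  | sub s t => s.cost + t.cost + 1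
  | mul s t => s.cost + t.cost + 1

end NExp

namespace RExp

def eval (O : Oracle) (m : Mem) : RExp → ℝ
  | const q => q
  | eps => O.eps
  | cast s => (s.eval O m : ℝ)
  | get a i => m.real a (i.eval O m)
  | prob i j => O.prob (i.eval O m) (j.eval O m)
  | ker i j k l => O.ker (i.eval O m) (j.eval O m) (k.eval O m) (l.eval O m)
  | add s t => s.eval O m + t.eval O m
  | sub s t => s.eval O m - t.eval O m
  | mul s t => s.eval O m * t.eval O m
  | div s t => s.eval O m / t.eval O m
  | sqrt s => Real.sqrt (s.eval O m)

/-- One time step for each access and operation, except for kernel evaluations. -/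
def cost (O : Oracle) : RExp → ℕ
  | const _ => 1
  | eps => 1
  | cast s => s.cost + 1
  | get _ i => i.cost + 1
  | prob i j => i.cost + j.cost + 1
  | ker i j k l => i.cost + j.cost + k.cost + l.cost + O.kerCost
  | add s t => s.cost O + t.cost O + 1
  | sub s t => s.cost O + t.cost O + 1
  | mul s t => s.cost O + t.cost O + 1
  | div s t => s.cost O + t.cost O + 1
  | sqrt s => s.cost O + 1

end RExp

namespace BExp

def holds (O : Oracle) (m : Mem) : BExp → Prop
  | nle s t => s.eval O m ≤ t.eval O m
  | rle s t => s.eval O m ≤ t.eval O m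
  | present i j => O.present (i.eval O m) (j.eval O m)
  | not b => ¬ b.holds O m
  | and b c => b.holds O m ∧ c.holds O m

def cost (O : Oracle) : BExp → ℕ
  | nle s t => s.cost + t.cost + 1
  | rle s t => s.cost O + t.cost O + 1
  | present i j => i.cost + j.cost + 1
  | not b => b.cost O + 1
  | and b c => b.cost O + c.cost O + 1

end BExp

def Mem.setNat (m : Mem) (a i v : ℕ) : Mem :=
  { m with nat := Function.update m.nat a (Function.update (m.nat a) i v) }

def Mem.setReal (m : Mem) (a i : ℕ) (v : ℝ) : Mem :=
  { m with real := Function.update m.real a (Function.update (m.real a) i v) }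

/-- The value `1` with probability `r`, clamped to `[0, 1]`, and the value `0` otherwise. -/
def coin (r : ℝ) : PMF Bool :=
  PMF.ofFintype
    (fun b => if b then ENNReal.ofReal (max 0 (min 1 r)) else ENNReal.ofReal (1 - max 0 (min 1 r)))
    (by
      have h0 : (0 : ℝ) ≤ max 0 (min 1 r) := le_max_left _ _
      have h1 : max 0 (min 1 r) ≤ (1 : ℝ) := max_le zero_le_one (min_le_left _ _)
      simp only [Fintype.sum_bool, if_true, Bool.false_eq_true, if_false]
      rw [← ENNReal.ofReal_add h0 (sub_nonneg.2 h1)]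
      simp)

/-- A configuration: the commands that remain to be executed, the memory, and the number of time
steps used so far. -/
structure Config where
  todo : List Cmd
  mem : Mem
  clock : ℕ

def Config.halted (c : Config) : Prop := c.todo = []

open Classical in
/-- One step of the machine, as a probability distribution on the successor configurations. -/
def step (O : Oracle) : Config → PMF Config
  | ⟨[], m, τ⟩ => PMF.pure ⟨[], m, τ⟩
  | ⟨.skip :: k, m, τ⟩ => PMF.pure ⟨k, m, τ + 1⟩
  | ⟨.nset a i e :: k, m, τ⟩ =>
      PMF.pure ⟨k, m.setNat a (i.eval O m) (e.eval O m), τ + (i.cost + e.cost + 1)⟩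
  | ⟨.rset a i e :: k, m, τ⟩ =>
      PMF.pure ⟨k, m.setReal a (i.eval O m) (e.eval O m), τ + (i.cost + e.cost O + 1)⟩
  | ⟨.toss a i r :: k, m, τ⟩ =>
      (coin (r.eval O m)).map fun b =>
        ⟨k, m.setNat a (i.eval O m) (if b then 1 else 0), τ + (i.cost + r.cost O + 1)⟩
  | ⟨.seq p q :: k, m, τ⟩ => PMF.pure ⟨p :: q :: k, m, τ + 1⟩
  | ⟨.ite b p q :: k, m, τ⟩ =>
      PMF.pure ⟨if b.holds O m then p :: k else q :: k, m, τ + (b.cost O + 1)⟩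
  | ⟨.while b p :: k, m, τ⟩ =>
      PMF.pure ⟨if b.holds O m then p :: .while b p :: k else k, m, τ + (b.cost O + 1)⟩

/-- The distribution of the configuration after `t` machine steps. -/
def runFrom (O : Oracle) : ℕ → Config → PMF Config
  | 0, c => PMF.pure c
  | t + 1, c => (step O c).bind (runFrom O t)

/-- The distribution of the configuration of `p` after `t` machine steps, started with zero
memory. -/
def run (O : Oracle) (p : Cmd) (t : ℕ) : PMF Config :=
  runFrom O t ⟨[p], ⟨fun _ _ => 0, fun _ _ => 0⟩, 0⟩

/-- The implicit center stored in the memory: cell `0` of the natural-number array `0` is the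
length `ℓ` of a list, whose `w`-th entry consists of the indices of a location, in the
natural-number arrays `1` and `2`, and a coefficient, in the real array `0`. It represents
`∑_{w < ℓ} γ_w φ(q_w)`, where entries without a location in `ℝ^d` are ignored. -/
def center {H : Type*} [NormedAddCommGroup H] [InnerProductSpace ℝ H] {d n z : ℕ}
    (D : ProbInput d n z) (φ : EuclideanSpace ℝ (Fin d) → H) (m : Mem) : H :=
  ∑ w ∈ Finset.range (m.nat 0 0),
    match D.loc? (m.nat 1 w) (m.nat 2 w) with
    | some q => m.real 0 w • φ q
    | none => 0

/-- The time bound `d n (z / ε^3 · log (1/ε) + 1 / ε^8 · log^2 (1/ε))`. -/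
def timeBound (d n z : ℕ) (ε : ℝ) : ℝ :=
  d * n * (z / ε ^ 3 * Real.log (1 / ε) + 1 / ε ^ 8 * Real.log (1 / ε) ^ 2)

end PSVDD

end

namespace PSVDD

/-! ### Reasoning about programs -/

/-! Empty realizations cost nothing, so the expected cost is `D.hitProb`, the probability of a
nonempty realization, times the conditional cost `D.condCost`. If `D.hitProb = 0`, every center is
optimal; otherwise it suffices to approximate the conditional problem. Let `y` be an optimal center
and `F` its conditional cost.

For a fixed realization the distance to the farthest point is a convex function of the center, with
the unit vector pointing away from that point as a subgradient. The program is stochastic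
subgradient descent in the feature space: each step draws a nonempty realization, moves a length `η`
towards its farthest point, and the output is the average of `T` iterates, with `T` of order `1/ε²`.
The iterates are combinations of drawn points, so all distances come from kernel values.

The descent needs a start within `O(F)` of `y` and a step length of order `F/k`, where `k = ⌈1/ε⌉`,
although `F` is unknown. The start is one point of a random nonempty realization, within `8F` of `y`
with probability at least `7/8` by Markov. For the scale, draw another realization, let `τ` be its
farthest distance from the start `c`, and add to `τ` the probability-weighted sum of all excesses of
distances over `τ`, divided by `D.hitProb`. This is always at least the cost of `c`
(`condCost_le_excessSum`). It is at most `10` times that cost if `τ` is not below the median and not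
above `8` times the mean (`excessSum_le_condCost`), which happens with probability at least `3/8`
(`quarter_le_of_goodScale`). As `c` costs between `F` and `9F`, the result lies in `[F, 90F]`. The
descent then succeeds with probability at least `7/8` (`DescentBound.of_condCost_pos`).

Probabilities are treated by a calculus of expectations. `ValTriple` carries through the program a
value, a lower bound for the probability of success; coin tosses average it, and a loop invariant
may speak of it. The usual supermartingale argument becomes the inequality `DescentBound.step`. A
value that is at most `0` records failure, after which only the running time matters. Subroutines
are kept apart by `Agree`: each one writes only to arrays from a certain number on.

A draw costs `O(nz + d(T² + nT))` and the scale `O(dnzT)`, so the total is `O(dn(zT + T³))`, which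
is below the claimed bound. -/

theorem runFrom_halted (O : Oracle) (t : ℕ) (m : Mem) (τ : ℕ) :
    runFrom O t ⟨[], m, τ⟩ = PMF.pure ⟨[], m, τ⟩ := by
  induction t with
  | zero => rfl
  | succ t ih => simp [runFrom, step, ih]

theorem runFrom_add (O : Oracle) (s t : ℕ) (c : Config) :
    runFrom O (s + t) c = (runFrom O s c).bind (runFrom O t) := by
  induction s generalizing c with
  | zero => simp [runFrom]
  | succ s ih =>
    rw [Nat.succ_add]
    simp only [runFrom, PMF.bind_bind]
    congr 1
    funext c'
    exact ih c'

theorem pmf_bind_eq_self {α : Type*} (p : PMF α) (f : α → PMF α)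
    (h : ∀ a ∈ p.support, f a = PMF.pure a) : p.bind f = p := by
  conv_rhs => rw [← PMF.bind_pure p]
  ext b
  simp only [PMF.bind_apply]
  refine tsum_congr fun a => ?_
  by_cases ha : p a = 0
  · simp [ha]
  · rw [h a ((PMF.mem_support_iff _ _).2 ha)]

theorem runFrom_of_halted {O : Oracle} {s : ℕ} {c : Config}
    (h : ∀ c' ∈ (runFrom O s c).support, c'.halted) (t : ℕ) :
    runFrom O (s + t) c = runFrom O s c := by
  rw [runFrom_add]
  refine pmf_bind_eq_self _ _ fun c' hc' => ?_
  obtain ⟨k, m, τ⟩ := c'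
  have : k = [] := h _ hc'
  subst this
  exact runFrom_halted O t m τ

/-- The probability of reaching a memory in `E` within `B` machine steps. -/
noncomputable def hitProb (O : Oracle) (E : Mem → Prop) (B : ℕ) (c : Config) : ℝ :=
  ((runFrom O B c).toOuterMeasure {c' | E c'.mem}).toReal

theorem toOuterMeasure_le_one {α : Type*} (p : PMF α) (s : Set α) : p.toOuterMeasure s ≤ 1 := by
  rw [PMF.toOuterMeasure_apply, ← p.tsum_coe]
  exact ENNReal.tsum_le_tsum fun a => Set.indicator_le_self _ _ _

/-- Executing the commands `k` from the memory `m` always ends after at most `B` time steps, and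
ends in a memory satisfying `E` with probability at least `e`. -/
def Achieves (O : Oracle) (E : Mem → Prop) (k : List Cmd) (m : Mem) (B : ℕ) (e : ℝ) : Prop :=
  ∀ τ, (∀ c ∈ (runFrom O B ⟨k, m, τ⟩).support, c.halted ∧ c.clock ≤ τ + B) ∧
    e ≤ hitProb O E B ⟨k, m, τ⟩

namespace Achieves

variable {O : Oracle} {E : Mem → Prop} {k : List Cmd} {m : Mem} {B : ℕ} {e : ℝ}

theorem mono_prob (h : Achieves O E k m B e) {e' : ℝ} (he : e' ≤ e) : Achieves O E k m B e' :=
  fun τ => ⟨(h τ).1, he.trans (h τ).2⟩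

theorem mono (h : Achieves O E k m B e) {B' : ℕ} (hB : B ≤ B') : Achieves O E k m B' e := by
  intro τ
  obtain ⟨j, rfl⟩ := Nat.exists_eq_add_of_le hB
  have hr := runFrom_of_halted (fun c' hc' => ((h τ).1 c' hc').1) j
  refine ⟨fun c hc => ?_, ?_⟩
  · rw [hr] at hc
    exact ⟨((h τ).1 c hc).1, ((h τ).1 c hc).2.trans (by omega)⟩
  · rw [hitProb, hr]
    exact (h τ).2

theorem nil_true (h : E m) : Achieves O E [] m 0 1 := by
  intro τ
  rw [hitProb, runFrom_halted]
  refine ⟨fun c hc => ?_, ?_⟩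
  · rw [PMF.support_pure, Set.mem_singleton_iff] at hc
    subst hc
    exact ⟨rfl, le_rfl⟩
  · rw [PMF.toOuterMeasure_pure_apply, if_pos (by exact h)]
    simp

theorem nil_zero : Achieves O E [] m 0 0 := by
  intro τ
  refine ⟨fun c hc => ?_, ENNReal.toReal_nonneg⟩
  rw [runFrom_halted, PMF.support_pure, Set.mem_singleton_iff] at hc
  subst hc
  exact ⟨rfl, le_rfl⟩

/-- Every command is charged at least one time step, so one number `B` can bound both time and
machine steps. The surplus machine steps are spent in halted configurations, which do not change. -/
theorem of_step {k' : List Cmd} {m' : Mem} {b : ℕ} (hb : 1 ≤ b)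
    (hs : ∀ τ, step O ⟨k, m, τ⟩ = PMF.pure ⟨k', m', τ + b⟩) (h : Achieves O E k' m' B e) :
    Achieves O E k m (B + b) e := by
  intro τ
  have hr : runFrom O (B + b) ⟨k, m, τ⟩ = runFrom O B ⟨k', m', τ + b⟩ := by
    rw [show B + b = (B + (b - 1)) + 1 by omega, runFrom, hs, PMF.pure_bind]
    exact runFrom_of_halted (fun c' hc' => ((h (τ + b)).1 c' hc').1) _
  refine ⟨fun c hc => ?_, ?_⟩
  · rw [hr] at hc
    exact ⟨((h _).1 c hc).1, ((h _).1 c hc).2.trans (by omega)⟩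
  · rw [hitProb, hr]
    exact (h _).2

/-- The only rule in which values are averaged: condition on the outcome of the coin. -/
theorem toss {a : ℕ} {i : NExp} {r : RExp} {e₁ e₀ : ℝ}
    (h0 : 0 ≤ r.eval O m) (h1 : r.eval O m ≤ 1)
    (ht : Achieves O E k (m.setNat a (i.eval O m) 1) B e₁)
    (hf : Achieves O E k (m.setNat a (i.eval O m) 0) B e₀) :
    Achieves O E (.toss a i r :: k) m (B + (i.cost + r.cost O + 1))
      (r.eval O m * e₁ + (1 - r.eval O m) * e₀) := by
  intro τ
  set b := i.cost + r.cost O + 1 with hb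
  have hr : runFrom O (B + b) ⟨.toss a i r :: k, m, τ⟩ = (coin (r.eval O m)).bind fun x =>
      runFrom O B ⟨k, m.setNat a (i.eval O m) (if x then 1 else 0), τ + b⟩ := by
    rw [show B + b = (B + (b - 1)) + 1 by omega, runFrom, step, PMF.bind_map]
    congr 1
    funext x
    cases x
    · exact runFrom_of_halted (fun c' hc' => ((hf (τ + b)).1 c' hc').1) _
    · exact runFrom_of_halted (fun c' hc' => ((ht (τ + b)).1 c' hc').1) _
  refine ⟨fun c hc => ?_, ?_⟩
  · rw [hr, PMF.mem_support_bind_iff] at hc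
    obtain ⟨x, -, hc⟩ := hc
    cases x
    · exact ⟨((hf _).1 c hc).1, ((hf _).1 c hc).2.trans (by omega)⟩
    · exact ⟨((ht _).1 c hc).1, ((ht _).1 c hc).2.trans (by omega)⟩
  · rw [hitProb, hr, PMF.toOuterMeasure_bind_apply, tsum_bool]
    have hc : max 0 (min 1 (r.eval O m)) = r.eval O m := by
      rw [min_eq_right h1, max_eq_right h0]
    have hl : ∀ (q : PMF Config) (s : Set Config), q.toOuterMeasure s ≠ ⊤ := fun q s =>
      ne_top_of_le_ne_top ENNReal.one_ne_top (toOuterMeasure_le_one q s)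
    rw [ENNReal.toReal_add (ENNReal.mul_ne_top (PMF.apply_ne_top _ _) (hl _ _))
      (ENNReal.mul_ne_top (PMF.apply_ne_top _ _) (hl _ _)), ENNReal.toReal_mul,
      ENNReal.toReal_mul]
    have c1 : (coin (r.eval O m) true).toReal = r.eval O m := by
      simp only [coin, PMF.ofFintype_apply, if_true, hc]
      exact ENNReal.toReal_ofReal h0
    have c0 : (coin (r.eval O m) false).toReal = 1 - r.eval O m := by
      simp only [coin, PMF.ofFintype_apply, Bool.false_eq_true, if_false, hc]
      exact ENNReal.toReal_ofReal (by linarith)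
    rw [c1, c0, add_comm]
    exact add_le_add (mul_le_mul_of_nonneg_left (hf _).2 (by linarith))
      (mul_le_mul_of_nonneg_left (ht _).2 h0)

theorem skip (h : Achieves O E k m B e) : Achieves O E (.skip :: k) m (B + 1) e :=
  of_step le_rfl (fun _ => rfl) h

theorem nset {a : ℕ} {i x : NExp} (h : Achieves O E k (m.setNat a (i.eval O m) (x.eval O m)) B e) :
    Achieves O E (.nset a i x :: k) m (B + (i.cost + x.cost + 1)) e :=
  of_step (by omega) (fun _ => rfl) h

theorem rset {a : ℕ} {i : NExp} {x : RExp}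
    (h : Achieves O E k (m.setReal a (i.eval O m) (x.eval O m)) B e) :
    Achieves O E (.rset a i x :: k) m (B + (i.cost + x.cost O + 1)) e :=
  of_step (by omega) (fun _ => rfl) h

theorem seq {p q : Cmd} (h : Achieves O E (p :: q :: k) m B e) :
    Achieves O E (.seq p q :: k) m (B + 1) e :=
  of_step le_rfl (fun _ => rfl) h

theorem ite {b : BExp} {p q : Cmd} (ht : b.holds O m → Achieves O E (p :: k) m B e)
    (hf : ¬ b.holds O m → Achieves O E (q :: k) m B e) :
    Achieves O E (.ite b p q :: k) m (B + (b.cost O + 1)) e := by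
  by_cases hb : b.holds O m
  · exact of_step (by omega) (fun _ => by simp only [step, if_pos hb]) (ht hb)
  · exact of_step (by omega) (fun _ => by simp only [step, if_neg hb]) (hf hb)

theorem while_true {b : BExp} {p : Cmd} (hb : b.holds O m)
    (h : Achieves O E (p :: .while b p :: k) m B e) :
    Achieves O E (.while b p :: k) m (B + (b.cost O + 1)) e :=
  of_step (by omega) (fun _ => by simp only [step, if_pos hb]) h

theorem while_false {b : BExp} {p : Cmd} (hb : ¬ b.holds O m) (h : Achieves O E k m B e) :
    Achieves O E (.while b p :: k) m (B + (b.cost O + 1)) e :=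
  of_step (by omega) (fun _ => by simp only [step, if_neg hb]) h

end Achieves

/-- The command `p`, started in `m`, ends within `b` time steps in a memory satisfying `Q`. -/
def Triple (O : Oracle) (E : Mem → Prop) (p : Cmd) (m : Mem) (b : ℕ) (Q : Mem → Prop) : Prop :=
  ∀ (k : List Cmd) (B : ℕ) (e : ℝ), (∀ m', Q m' → Achieves O E k m' B e) →
    Achieves O E (p :: k) m (B + b) e

namespace Triple

variable {O : Oracle} {E : Mem → Prop} {m : Mem} {b : ℕ} {Q R : Mem → Prop} {p q : Cmd}

theorem mono (h : Triple O E p m b R) (hQ : ∀ m', R m' → Q m') {b' : ℕ} (hb : b ≤ b') :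
    Triple O E p m b' Q :=
  fun k B e hk => (h k B e fun m' hm' => hk m' (hQ m' hm')).mono (by omega)

theorem skip (h : Q m) : Triple O E .skip m 1 Q :=
  fun _ _ _ hk => (hk m h).skip

theorem nset {a : ℕ} {i x : NExp} (h : Q (m.setNat a (i.eval O m) (x.eval O m))) :
    Triple O E (.nset a i x) m (i.cost + x.cost + 1) Q :=
  fun _ _ _ hk => (hk _ h).nset

theorem rset {a : ℕ} {i : NExp} {x : RExp} (h : Q (m.setReal a (i.eval O m) (x.eval O m))) :
    Triple O E (.rset a i x) m (i.cost + x.cost O + 1) Q :=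
  fun _ _ _ hk => (hk _ h).rset

theorem seq {b₁ b₂ : ℕ} (hp : Triple O E p m b₁ R) (hq : ∀ m', R m' → Triple O E q m' b₂ Q) :
    Triple O E (.seq p q) m (b₁ + b₂ + 1) Q :=
  fun k B e hk => (Achieves.seq (hp (q :: k) (B + b₂) e fun m' hm' => hq m' hm' k B e hk)).mono
    (by omega)

theorem ite {c : BExp} (ht : c.holds O m → Triple O E p m b Q)
    (hf : ¬ c.holds O m → Triple O E q m b Q) :
    Triple O E (.ite c p q) m (b + (c.cost O + 1)) Q :=
  fun k B e hk => (Achieves.ite (fun hc => ht hc k B e hk) fun hc => hf hc k B e hk).mono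
    (by omega)

end Triple

/-- `for x := 0 to s - 1 do p`, with the counter in cell `0` of the array `x`. -/
def Cmd.forLoop (x : ℕ) (s : NExp) (p : Cmd) : Cmd :=
  .seq (.nset x (.const 0) (.const 0))
    (.while (.not (.nle s (.get x (.const 0))))
      (.seq p (.nset x (.const 0) (.add (.get x (.const 0)) (.const 1)))))

/-- The command `p`, started in `m` with the value `e`, ends within `b` time steps; if every memory
and value in `Q` allow to continue, then so do `m` and `e`. -/
def ValTriple (O : Oracle) (E : Mem → Prop) (p : Cmd) (m : Mem) (e : ℝ) (b : ℕ)
    (Q : Mem → ℝ → Prop) : Prop :=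
  ∀ (k : List Cmd) (B : ℕ), (∀ m' e', Q m' e' → Achieves O E k m' B e') →
    Achieves O E (p :: k) m (B + b) e

namespace ValTriple

variable {O : Oracle} {E : Mem → Prop} {m : Mem} {e : ℝ} {b : ℕ} {Q R : Mem → ℝ → Prop} {p q : Cmd}

theorem of_triple {Q : Mem → Prop} (h : Triple O E p m b Q) :
    ValTriple O E p m e b fun m' e' => Q m' ∧ e' = e :=
  fun k B hk => h k B e fun m' hm' => hk m' e ⟨hm', rfl⟩

theorem mono (h : ValTriple O E p m e b R) (hQ : ∀ m' e', R m' e' → Q m' e') {b' : ℕ}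
    (hb : b ≤ b') : ValTriple O E p m e b' Q :=
  fun k B hk => (h k B fun m' e' hm' => hk m' e' (hQ m' e' hm')).mono (by omega)

theorem mono_val {e' : ℝ} (h : ValTriple O E p m e b Q) (he : e' ≤ e) :
    ValTriple O E p m e' b Q :=
  fun k B hk => (h k B hk).mono_prob he

theorem seq {b₁ b₂ : ℕ} (hp : ValTriple O E p m e b₁ R)
    (hq : ∀ m' e', R m' e' → ValTriple O E q m' e' b₂ Q) :
    ValTriple O E (.seq p q) m e (b₁ + b₂ + 1) Q :=
  fun k B hk => (Achieves.seq (hp (q :: k) (B + b₂) fun m' e' hm' => hq m' e' hm' k B hk)).mono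
    (by omega)

theorem triple_seq {b₁ b₂ : ℕ} {R : Mem → Prop} (hp : Triple O E p m b₁ R)
    (hq : ∀ m', R m' → ValTriple O E q m' e b₂ Q) :
    ValTriple O E (.seq p q) m e (b₁ + b₂ + 1) Q :=
  seq (of_triple hp) fun m' _ h => h.2 ▸ hq m' h.1

theorem ite {c : BExp} (ht : c.holds O m → ValTriple O E p m e b Q)
    (hf : ¬ c.holds O m → ValTriple O E q m e b Q) :
    ValTriple O E (.ite c p q) m e (b + (c.cost O + 1)) Q :=
  fun k B hk => (Achieves.ite (fun hc => ht hc k B hk) fun hc => hf hc k B hk).mono (by omega)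

theorem toss {a : ℕ} {i : NExp} {r : RExp} {e₁ e₀ : ℝ} (h0 : 0 ≤ r.eval O m)
    (h1 : r.eval O m ≤ 1) (he : e ≤ r.eval O m * e₁ + (1 - r.eval O m) * e₀)
    (ht : Q (m.setNat a (i.eval O m) 1) e₁) (hf : Q (m.setNat a (i.eval O m) 0) e₀) :
    ValTriple O E (.toss a i r) m e (i.cost + r.cost O + 1) Q :=
  fun _ _ hk => (Achieves.toss h0 h1 (hk _ _ ht) (hk _ _ hf)).mono_prob he

/-- Induction on the number `j` of remaining rounds. The invariant relates memory and value, so the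
value may change from round to round. Besides the body, a round pays `s.cost + 12` for the test, the
sequencing and the increment. -/
theorem forLoop {x N : ℕ} {s : NExp} (I : ℕ → Mem → ℝ → Prop) (h0 : I 0 (m.setNat x 0 0) e)
    (hx : ∀ i m e, I i m e → m.nat x 0 = i ∧ s.eval O m = N)
    (hp : ∀ i m e, i < N → I i m e → ValTriple O E p m e b fun m' e' =>
      m'.nat x 0 = i ∧ I (i + 1) (m'.setNat x 0 (i + 1)) e') :
    ValTriple O E (.forLoop x s p) m e (N * (b + s.cost + 12) + s.cost + 12) (I N) := by
  intro k B hk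
  have key : ∀ j i m e, i + j = N → I i m e → Achieves O E
      (.while (.not (.nle s (.get x (.const 0))))
      (.seq p (.nset x (.const 0) (.add (.get x (.const 0)) (.const 1)))) :: k) m
      (B + (j * (b + s.cost + 12) + s.cost + 6)) e := by
    intro j
    induction j with
    | zero =>
      intro i m e hi hI
      obtain rfl : i = N := by omega
      refine Achieves.mono (Achieves.while_false ?_ (hk m e hI)) ?_
      · simp [BExp.holds, NExp.eval, hx i m e hI]
      · simp [BExp.cost, NExp.cost]
    | succ j ih =>
      intro i m e hi hI
      refine Achieves.mono (Achieves.while_true (B := B + (j * (b + s.cost + 12) + s.cost + 6)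
        + 6 + b + 1) ?_ ?_) ?_
      · simp only [BExp.holds, NExp.eval, hx i m e hI]
        omega
      · refine Achieves.seq (hp i m e (by omega) hI _ _ fun m' e' hm' => ?_)
        refine Achieves.mono (Achieves.nset (ih (i + 1) _ e' (by omega) ?_)) ?_
        · simp only [NExp.eval, hm'.1]
          exact hm'.2
        · simp only [NExp.cost]
          omega
      · simp only [BExp.cost, NExp.cost]
        ring_nf
        omega
  refine Achieves.mono (Achieves.seq (Achieves.nset (key N 0 _ e (by omega) h0))) ?_
  simp only [NExp.cost]
  omega

end ValTriple

theorem Triple.forLoop {O : Oracle} {E : Mem → Prop} {x : ℕ} {s : NExp} {p : Cmd} {m : Mem} {b N : ℕ}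
    (I : ℕ → Mem → Prop) (h0 : I 0 (m.setNat x 0 0))
    (hx : ∀ i m, I i m → m.nat x 0 = i ∧ s.eval O m = N)
    (hp : ∀ i m, i < N → I i m →
      Triple O E p m b fun m' => m'.nat x 0 = i ∧ I (i + 1) (m'.setNat x 0 (i + 1))) :
    Triple O E (.forLoop x s p) m (N * (b + s.cost + 12) + s.cost + 12) (I N) := fun k B e hk =>
  ValTriple.forLoop (fun i m e' => I i m ∧ e' = e) ⟨h0, rfl⟩ (fun i m _ h => hx i m h.1)
    (fun i m _ hi h => (ValTriple.of_triple (hp i m hi h.1)).mono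
      (fun _ _ h' => ⟨h'.1.1, h'.1.2, h'.2.trans h.2⟩) le_rfl) k B fun m' _ h => h.2 ▸ hk m' h.1

/-! ### Memory updates and the frame relation -/

@[simp] theorem Mem.setNat_nat (m : Mem) (a i v : ℕ) :
    (m.setNat a i v).nat = Function.update m.nat a (Function.update (m.nat a) i v) := rfl

@[simp] theorem Mem.setNat_real (m : Mem) (a i v : ℕ) : (m.setNat a i v).real = m.real := rfl

@[simp] theorem Mem.setReal_real (m : Mem) (a i : ℕ) (v : ℝ) :
    (m.setReal a i v).real = Function.update m.real a (Function.update (m.real a) i v) := rfl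

@[simp] theorem Mem.setReal_nat (m : Mem) (a i : ℕ) (v : ℝ) : (m.setReal a i v).nat = m.nat := rfl

/-- `m'` and `m` agree on the arrays with numbers below `l`. -/
def Agree (l : ℕ) (m m' : Mem) : Prop :=
  ∀ a < l, m'.nat a = m.nat a ∧ m'.real a = m.real a

namespace Agree

variable {l : ℕ} {m m' m'' : Mem}

theorem refl (l : ℕ) (m : Mem) : Agree l m m := fun _ _ => ⟨rfl, rfl⟩

theorem trans (h : Agree l m m') (h' : Agree l m' m'') : Agree l m m'' := fun a ha =>
  ⟨(h' a ha).1.trans (h a ha).1, (h' a ha).2.trans (h a ha).2⟩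

theorem mono {l' : ℕ} (h : Agree l m m') (hl : l' ≤ l) : Agree l' m m' :=
  fun a ha => h a (ha.trans_le hl)

theorem setNat (h : Agree l m m') {a : ℕ} (ha : l ≤ a) (i v : ℕ) : Agree l m (m'.setNat a i v) := by
  intro c hc
  simp [Function.update_of_ne (show c ≠ a by omega), h c hc]

theorem setReal (h : Agree l m m') {a : ℕ} (ha : l ≤ a) (i : ℕ) (v : ℝ) :
    Agree l m (m'.setReal a i v) := by
  intro c hc
  simp [Function.update_of_ne (show c ≠ a by omega), h c hc]

end Agree

/-! ### Expectations over independent rows -/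

/-- The expectation of `e` when the rows below `i` of `J` are drawn independently, row `i'` taking
the value `j < z` with probability `P i' j`. -/
def rowSum (z : ℕ) (P : ℕ → ℕ → ℝ) : ℕ → ((ℕ → ℕ) → ℝ) → (ℕ → ℕ) → ℝ
  | 0, e, J => e J
  | i + 1, e, J => ∑ j ∈ Finset.range z, P i j * rowSum z P i e (Function.update J i j)

section RowSum

variable {z : ℕ} {P : ℕ → ℕ → ℝ}

theorem rowSum_congr {i : ℕ} {e f : (ℕ → ℕ) → ℝ} {J : ℕ → ℕ}
    (h : ∀ J', (∀ k, i ≤ k → J' k = J k) → e J' = f J') :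
    rowSum z P i e J = rowSum z P i f J := by
  induction i generalizing J with
  | zero => exact h J fun _ _ => rfl
  | succ i ih =>
    refine Finset.sum_congr rfl fun j _ => ?_
    rw [ih fun J' hJ' => h J' fun k hk => ?_]
    rw [hJ' k (by omega), Function.update_of_ne (by omega)]

theorem rowSum_le (hP : ∀ i j, 0 ≤ P i j) {i : ℕ} {e f : (ℕ → ℕ) → ℝ} {J : ℕ → ℕ}
    (h : ∀ J', (∀ k, i ≤ k → J' k = J k) → e J' ≤ f J') :
    rowSum z P i e J ≤ rowSum z P i f J := by
  induction i generalizing J with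
  | zero => exact h J fun _ _ => rfl
  | succ i ih =>
    refine Finset.sum_le_sum fun j _ => mul_le_mul_of_nonneg_left ?_ (hP i j)
    refine ih fun J' hJ' => h J' fun k hk => ?_
    rw [hJ' k (by omega), Function.update_of_ne (by omega)]

theorem rowSum_add (i : ℕ) (e f : (ℕ → ℕ) → ℝ) (J : ℕ → ℕ) :
    rowSum z P i (fun J => e J + f J) J = rowSum z P i e J + rowSum z P i f J := by
  induction i generalizing J with
  | zero => rfl
  | succ i ih => simp only [rowSum, ih, mul_add, Finset.sum_add_distrib]

theorem rowSum_mul (i : ℕ) (a : ℝ) (e : (ℕ → ℕ) → ℝ) (J : ℕ → ℕ) :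
    rowSum z P i (fun J => a * e J) J = a * rowSum z P i e J := by
  induction i generalizing J with
  | zero => rfl
  | succ i ih => simp only [rowSum, ih, Finset.mul_sum, mul_left_comm]

theorem rowSum_const {n : ℕ} (h1 : ∀ i < n, ∑ j ∈ Finset.range z, P i j = 1) {i : ℕ} (hi : i ≤ n)
    (a : ℝ) (J : ℕ → ℕ) : rowSum z P i (fun _ => a) J = a := by
  induction i generalizing J with
  | zero => rfl
  | succ i ih => simp only [rowSum, ih (by omega), ← Finset.sum_mul, h1 i (by omega), one_mul]

theorem rowSum_base {i : ℕ} {e : (ℕ → ℕ) → ℝ}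
    (he : ∀ J J', (∀ k < i, J k = J' k) → e J = e J') (J J' : ℕ → ℕ) :
    rowSum z P i e J = rowSum z P i e J' := by
  -- When only the rows below `l` are still to be drawn, `e` reads the rows from `l` to `i - 1`
  -- directly, so agreement is needed exactly there.
  suffices h : ∀ l, l ≤ i → ∀ J J', (∀ k < i, l ≤ k → J k = J' k) →
      rowSum z P l e J = rowSum z P l e J' from h i le_rfl J J' fun k hk hk' => by omega
  intro l
  induction l with
  | zero => exact fun _ J J' h => he J J' fun k hk => h k hk (Nat.zero_le k)
  | succ l ih =>
    intro hl J J' h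
    refine Finset.sum_congr rfl fun j _ => ?_
    rw [ih (by omega) _ (Function.update J' l j) fun k hk hk' => ?_]
    rcases eq_or_ne k l with rfl | hkl
    · simp
    · rw [Function.update_of_ne hkl, Function.update_of_ne hkl]
      exact h k hk (by omega)

/-- The rows below `n` of `J` are replaced by `g`. -/
def extend {n z : ℕ} (g : Fin n → Fin z) (J : ℕ → ℕ) (i : ℕ) : ℕ :=
  if h : i < n then g ⟨i, h⟩ else J i

/-- `rowSum` draws the top row first, which corresponds to splitting off the last coordinate with
`Fin.snoc`. -/
theorem rowSum_eq_sum (n : ℕ) (e : (ℕ → ℕ) → ℝ) (J : ℕ → ℕ) :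
    rowSum z P n e J = ∑ g : Fin n → Fin z, (∏ i : Fin n, P i (g i)) * e (extend g J) := by
  induction n generalizing J with
  | zero =>
    simp only [rowSum, Finset.univ_unique, Finset.sum_singleton, Finset.univ_eq_empty,
      Finset.prod_empty, one_mul]
    congr 1
  | succ n ih =>
    rw [← (Fin.snocEquiv fun _ : Fin (n + 1) => Fin z).sum_comp, Fintype.sum_prod_type, rowSum,
      Finset.sum_range]
    refine Finset.sum_congr rfl fun j _ => ?_
    rw [ih, Finset.mul_sum]
    refine Finset.sum_congr rfl fun g _ => ?_
    rw [Fin.prod_univ_castSucc]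
    simp only [Fin.snocEquiv_apply, Fin.snoc_castSucc, Fin.snoc_last, Fin.val_castSucc,
      Fin.val_last]
    rw [← mul_assoc, mul_comm (P n j)]
    congr 2
    funext i
    rcases lt_trichotomy i n with h | rfl | h
    · have : (⟨i, by omega⟩ : Fin (n + 1)) = Fin.castSucc ⟨i, h⟩ := rfl
      simp only [extend, dif_pos h, dif_pos (show i < n + 1 by omega)]
      rw [this, Fin.snocEquiv_apply, Fin.snoc_castSucc]
    · have : (⟨i, by omega⟩ : Fin (i + 1)) = Fin.last i := rfl
      simp only [extend, lt_irrefl, dif_neg, not_false_eq_true, dif_pos (show i < i + 1 by omega)]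
      rw [this, Fin.snocEquiv_apply, Fin.snoc_last, Function.update_self]
    · simp only [extend, dif_neg (show ¬ i < n by omega), dif_neg (show ¬ i < n + 1 by omega)]
      rw [Function.update_of_ne (by omega)]

end RowSum

/-! ### Conditioning on a hit -/

open Classical in
/-- The probability that one of the rows below `i` is present. -/
noncomputable def hit (z : ℕ) (P : ℕ → ℕ → ℝ) (pres : ℕ → ℕ → Prop) : ℕ → ℝ
  | 0 => 0
  | i + 1 => ∑ j ∈ Finset.range z, P i j * (if pres i j then 1 else hit z P pres i)

open Classical in
/-- The weight of the value `j` of row `i`, when the rows above `i` are drawn already, `s = 1` means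
that one of them is present, and the draw is conditioned on some row being present. -/
noncomputable def rowWeight (z : ℕ) (P : ℕ → ℕ → ℝ) (pres : ℕ → ℕ → Prop) (s i j : ℕ) : ℝ :=
  if pres i j then P i j else if 1 ≤ s then P i j else P i j * hit z P pres i

open Classical in
/-- The expectation of `e` when the rows below `i` are drawn with the weights `rowWeight`. -/
noncomputable def hitSum (z : ℕ) (P : ℕ → ℕ → ℝ) (pres : ℕ → ℕ → Prop) :
    ℕ → ℕ → ((ℕ → ℕ) → ℝ) → (ℕ → ℕ) → ℝ
  | 0, _, e, J => e J
  | i + 1, s, e, J => ∑ j ∈ Finset.range z,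
      rowWeight z P pres s i j / (∑ j' ∈ Finset.range z, rowWeight z P pres s i j') *
        hitSum z P pres i (if pres i j then 1 else s) e (Function.update J i j)

section Hit

variable {z n : ℕ} {P : ℕ → ℕ → ℝ} {pres : ℕ → ℕ → Prop}

theorem hit_nonneg (hP : ∀ i j, 0 ≤ P i j) (i : ℕ) : 0 ≤ hit z P pres i := by
  induction i with
  | zero => exact le_rfl
  | succ i ih =>
    refine Finset.sum_nonneg fun j _ => mul_nonneg (hP i j) ?_
    split_ifs
    exacts [zero_le_one, ih]

theorem rowWeight_nonneg (hP : ∀ i j, 0 ≤ P i j) (s i j : ℕ) : 0 ≤ rowWeight z P pres s i j := by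
  unfold rowWeight
  split_ifs
  exacts [hP i j, hP i j, mul_nonneg (hP i j) (hit_nonneg hP i)]

theorem sum_rowWeight_zero (i : ℕ) :
    ∑ j ∈ Finset.range z, rowWeight z P pres 0 i j = hit z P pres (i + 1) := by
  refine Finset.sum_congr rfl fun j _ => ?_
  simp only [rowWeight]
  split_ifs <;> simp_all

/-- Once some row is present the condition is fulfilled, and the remaining rows are independent with
their original probabilities. -/
theorem hitSum_one (h1 : ∀ i < n, ∑ j ∈ Finset.range z, P i j = 1) {i : ℕ} (hi : i ≤ n)
    (e : (ℕ → ℕ) → ℝ) (J : ℕ → ℕ) : hitSum z P pres i 1 e J = rowSum z P i e J := by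
  induction i generalizing J with
  | zero => rfl
  | succ i ih =>
    have hw : ∀ j, rowWeight z P pres 1 i j = P i j := fun j => by simp [rowWeight]
    simp only [hitSum, rowSum, hw, h1 i (by omega), div_one, ite_self, ih (by omega)]

-- The chain rule for conditional probabilities, which makes sequential sampling correct. As long as
-- no present row was seen, an absent value of row `i` is weighted by the probability that the rows
-- below still produce a point, and these weights sum to `hit z P pres (i + 1)`.
open Classical in
theorem hit_mul_hitSum (hP : ∀ i j, 0 ≤ P i j) (h1 : ∀ i < n, ∑ j ∈ Finset.range z, P i j = 1)
    {i : ℕ} (hi : i ≤ n) (e : (ℕ → ℕ) → ℝ) (J : ℕ → ℕ) :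
    hit z P pres i * hitSum z P pres i 0 e J =
      rowSum z P i (fun J' => if ∃ k < i, pres k (J' k) then e J' else 0) J := by
  induction i generalizing J with
  | zero => simp [hit, rowSum]
  | succ i ih =>
    have key : ∀ j, P i j * rowSum z P i (fun J' => if ∃ k < i + 1, pres k (J' k) then e J' else 0)
        (Function.update J i j) = rowWeight z P pres 0 i j *
          hitSum z P pres i (if pres i j then 1 else 0) e (Function.update J i j) := by
      intro j
      by_cases hp : pres i j
      · simp only [rowWeight, if_pos hp, hitSum_one h1 (Nat.le_of_succ_le hi)]
        congr 1
        refine rowSum_congr fun J' hJ' => if_pos ⟨i, by omega, ?_⟩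
        rw [hJ' i le_rfl, Function.update_self]
        exact hp
      · simp only [rowWeight, if_neg hp, if_neg (show ¬ 1 ≤ 0 by omega), mul_assoc]
        rw [ih (Nat.le_of_succ_le hi)]
        congr 1
        refine rowSum_congr fun J' hJ' => ?_
        have hpi : ¬ pres i (J' i) := by rwa [hJ' i le_rfl, Function.update_self]
        refine if_congr ⟨?_, fun ⟨k, hk, h⟩ => ⟨k, by omega, h⟩⟩ rfl rfl
        rintro ⟨k, hk, h⟩
        rcases Nat.lt_succ_iff_lt_or_eq.1 hk with h' | rfl
        exacts [⟨k, h', h⟩, absurd h hpi]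
    simp only [rowSum, key, hitSum, sum_rowWeight_zero, Finset.mul_sum]
    refine Finset.sum_congr rfl fun j hj => ?_
    -- If the total weight vanishes, so does each single weight, and the division by zero is
    -- harmless.
    by_cases h0 : hit z P pres (i + 1) = 0
    · have : rowWeight z P pres 0 i j = 0 := by
        rw [← sum_rowWeight_zero] at h0
        exact (Finset.sum_eq_zero_iff_of_nonneg fun j _ => rowWeight_nonneg hP 0 i j).1 h0 j hj
      simp [this]
    · rw [← mul_assoc, mul_div_cancel₀ _ h0]

open Classical in
theorem rowSum_exists (h1 : ∀ i < n, ∑ j ∈ Finset.range z, P i j = 1) {i : ℕ} (hi : i ≤ n)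
    (J : ℕ → ℕ) :
    rowSum z P i (fun J' => if ∃ k < i, pres k (J' k) then 1 else 0) J = hit z P pres i := by
  induction i generalizing J with
  | zero => simp [hit, rowSum]
  | succ i ih =>
    refine Finset.sum_congr rfl fun j _ => ?_
    congr 1
    split_ifs with hp
    · refine Eq.trans ?_ (rowSum_const h1 (Nat.le_of_succ_le hi) 1 (Function.update J i j))
      refine rowSum_congr fun J' hJ' => if_pos ⟨i, by omega, ?_⟩
      rw [hJ' i le_rfl, Function.update_self]
      exact hp
    · rw [← ih (Nat.le_of_succ_le hi) (Function.update J i j)]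
      refine rowSum_congr fun J' hJ' => ?_
      have hpi : ¬ pres i (J' i) := by rwa [hJ' i le_rfl, Function.update_self]
      refine if_congr ⟨?_, fun ⟨k, hk, h⟩ => ⟨k, by omega, h⟩⟩ rfl rfl
      rintro ⟨k, hk, h⟩
      rcases Nat.lt_succ_iff_lt_or_eq.1 hk with h' | rfl
      exacts [⟨k, h', h⟩, absurd h hpi]

end Hit

/-! ### The farthest point of a realization -/

section Far

variable {H : Type*} [NormedAddCommGroup H] {z n : ℕ} {P : ℕ → ℕ → ℝ} {pres : ℕ → ℕ → Prop}
  {v : ℕ → ℕ → H}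

open Classical in
/-- The largest distance from `c` to a present point in the rows below `i`. -/
noncomputable def farDist (pres : ℕ → ℕ → Prop) (v : ℕ → ℕ → H) (c : H) : ℕ → (ℕ → ℕ) → ℝ
  | 0, _ => 0
  | i + 1, J => if pres i (J i) then max (farDist pres v c i J) ‖c - v i (J i)‖
      else farDist pres v c i J

theorem farDist_le_iff {c : H} {i : ℕ} {J : ℕ → ℕ} {a : ℝ} :
    farDist pres v c i J ≤ a ↔ 0 ≤ a ∧ ∀ k < i, pres k (J k) → ‖c - v k (J k)‖ ≤ a := by
  induction i with
  | zero => simp [farDist]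
  | succ i ih =>
    simp only [farDist, Nat.forall_lt_succ_right]
    split_ifs with h
    · rw [max_le_iff, ih]
      tauto
    · rw [ih]
      tauto

theorem farDist_congr {c : H} {i : ℕ} {J J' : ℕ → ℕ} (h : ∀ k < i, J k = J' k) :
    farDist pres v c i J = farDist pres v c i J' := by
  induction i with
  | zero => rfl
  | succ i ih => rw [farDist, farDist, ih fun k hk => h k (by omega), h i (by omega)]

open Classical in
/-- The excess over `τ` of the distance from `c` to the point `v i j`. -/
noncomputable def excess (pres : ℕ → ℕ → Prop) (v : ℕ → ℕ → H) (c : H) (τ : ℝ) (i j : ℕ) : ℝ :=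
  if pres i j then if τ ≤ ‖c - v i j‖ then ‖c - v i j‖ - τ else 0 else 0

theorem excess_nonneg (c : H) (τ : ℝ) (i j : ℕ) : 0 ≤ excess pres v c τ i j := by
  unfold excess
  split_ifs with _ h
  exacts [sub_nonneg.2 h, le_rfl, le_rfl]

theorem farDist_le_add_excess (c : H) {τ : ℝ} (hτ : 0 ≤ τ) (i : ℕ) (J : ℕ → ℕ) :
    farDist pres v c i J ≤ τ + ∑ k ∈ Finset.range i, excess pres v c τ k (J k) := by
  rw [farDist_le_iff]
  have h0 : ∀ k ∈ Finset.range i, 0 ≤ excess pres v c τ k (J k) := fun k _ => excess_nonneg c τ k _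
  refine ⟨add_nonneg hτ (Finset.sum_nonneg h0), fun k hk hp => ?_⟩
  have h := Finset.single_le_sum h0 (Finset.mem_range.2 hk)
  have : ‖c - v k (J k)‖ ≤ τ + excess pres v c τ k (J k) := by
    unfold excess
    rw [if_pos hp]
    split_ifs <;> linarith
  linarith

theorem rowSum_excess (h1 : ∀ i < n, ∑ j ∈ Finset.range z, P i j = 1) (c : H) (τ : ℝ) {i : ℕ}
    (hi : i ≤ n) (J : ℕ → ℕ) :
    rowSum z P i (fun J' => ∑ k ∈ Finset.range i, excess pres v c τ k (J' k)) J =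
      ∑ k ∈ Finset.range i, ∑ j ∈ Finset.range z, P k j * excess pres v c τ k j := by
  induction i generalizing J with
  | zero => simp [rowSum]
  | succ i ih =>
    have : ∀ j, rowSum z P i (fun J' => ∑ k ∈ Finset.range (i + 1), excess pres v c τ k (J' k))
        (Function.update J i j) = (∑ k ∈ Finset.range i, ∑ j ∈ Finset.range z,
          P k j * excess pres v c τ k j) + excess pres v c τ i j := by
      intro j
      simp only [Finset.sum_range_succ]
      rw [rowSum_add, ih (Nat.le_of_succ_le hi)]
      congr 1
      rw [← rowSum_const h1 (Nat.le_of_succ_le hi) (excess pres v c τ i j) (Function.update J i j)]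
      refine rowSum_congr fun J' hJ' => ?_
      rw [hJ' i le_rfl, Function.update_self]
    simp only [rowSum, this, mul_add, Finset.sum_add_distrib, ← Finset.sum_mul, h1 i hi, one_mul]
    rw [Finset.sum_range_succ]

-- A converse to the union bound behind `farDist_le_add_excess`. Add the rows one at a time: with
-- probability at least `1/2` the earlier rows do not exceed `τ`, and independently of them the new
-- row then contributes its full excess to the maximum. In the other case the maximum does not
-- decrease.
open Classical in
theorem half_sum_excess_le (hP : ∀ i j, 0 ≤ P i j) (h1 : ∀ i < n, ∑ j ∈ Finset.range z, P i j = 1)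
    (c : H) {τ : ℝ} (J₀ : ℕ → ℕ)
    (hm : 1 / 2 ≤ rowSum z P n (fun J => if farDist pres v c n J ≤ τ then 1 else 0) J₀)
    {i : ℕ} (hi : i ≤ n) (J : ℕ → ℕ) :
    1 / 2 * ∑ k ∈ Finset.range i, ∑ j ∈ Finset.range z, P k j * excess pres v c τ k j ≤
      rowSum z P i (fun J => max 0 (farDist pres v c i J - τ)) J := by
  have hbase : ∀ i J J', rowSum z P i (fun J => if farDist pres v c i J ≤ τ then (1 : ℝ) else 0) J
      = rowSum z P i (fun J => if farDist pres v c i J ≤ τ then 1 else 0) J' := fun i J J' =>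
    rowSum_base (fun J J' h => by rw [farDist_congr h]) J J'
  have hle : ∀ i (J : ℕ → ℕ), farDist pres v c i J ≤ farDist pres v c (i + 1) J := by
    intro i J
    simp only [farDist]
    split_ifs
    exacts [le_max_left _ _, le_rfl]
  -- The assumption on all `n` rows passes to each prefix, because leaving out rows can only
  -- decrease `farDist`.
  have hmi : ∀ j, ∀ i, i + j = n → ∀ J,
      1 / 2 ≤ rowSum z P i (fun J => if farDist pres v c i J ≤ τ then 1 else 0) J := by
    intro j
    induction j with
    | zero =>
      rintro i rfl J
      exact hm.trans_eq (hbase _ _ _)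
    | succ j ih =>
      intro i hij J
      refine (ih (i + 1) (by omega) J).trans ?_
      have : rowSum z P i (fun J => if farDist pres v c i J ≤ τ then 1 else 0) J =
          ∑ j ∈ Finset.range z, P i j *
            rowSum z P i (fun J => if farDist pres v c i J ≤ τ then 1 else 0)
              (Function.update J i j) := by
        simp only [hbase i (Function.update J i _) J, ← Finset.sum_mul, h1 i (by omega), one_mul]
      rw [this, rowSum]
      refine Finset.sum_le_sum fun j _ => mul_le_mul_of_nonneg_left ?_ (hP i j)
      refine rowSum_le hP fun J' _ => ?_
      have := hle i J'
      split_ifs <;> linarith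
  induction i generalizing J with
  | zero => simp [rowSum]
  | succ i ih =>
    have hstep : ∀ j, 1 / 2 * (∑ k ∈ Finset.range i, ∑ j ∈ Finset.range z,
          P k j * excess pres v c τ k j) + 1 / 2 * excess pres v c τ i j ≤
        rowSum z P i (fun J => max 0 (farDist pres v c (i + 1) J - τ)) (Function.update J i j) := by
      intro j
      calc _ ≤ rowSum z P i (fun J => max 0 (farDist pres v c i J - τ)) (Function.update J i j)
            + excess pres v c τ i j *
              rowSum z P i (fun J => if farDist pres v c i J ≤ τ then 1 else 0)
                (Function.update J i j) := by
            have h2 := ih (Nat.le_of_succ_le hi) (Function.update J i j)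
            have h3 := mul_le_mul_of_nonneg_left
              (hmi (n - i) i (by omega) (Function.update J i j)) (excess_nonneg (pres := pres)
                (v := v) c τ i j)
            linarith
        _ ≤ _ := by
            rw [← rowSum_mul, ← rowSum_add]
            refine rowSum_le hP fun J' hJ' => ?_
            have hj : J' i = j := by rw [hJ' i le_rfl, Function.update_self]
            simp only [farDist, hj, excess]
            split_ifs with h4 h5 h6 <;> simp only [mul_one, mul_zero, add_zero, le_refl]
            · rw [max_eq_left (by linarith), zero_add]
              exact (sub_le_sub_right (le_max_right _ _) _).trans (le_max_right _ _)
            all_goals exact max_le_max le_rfl (sub_le_sub_right (le_max_left _ _) _)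
    calc _ = ∑ j ∈ Finset.range z, P i j * (1 / 2 * (∑ k ∈ Finset.range i, ∑ j ∈ Finset.range z,
          P k j * excess pres v c τ k j) + 1 / 2 * excess pres v c τ i j) := by
          simp only [mul_add, Finset.sum_add_distrib, ← Finset.sum_mul, h1 i hi, one_mul,
            Finset.sum_range_succ, mul_left_comm _ (1 / 2 : ℝ), ← Finset.mul_sum]
      _ ≤ _ := Finset.sum_le_sum fun j _ => mul_le_mul_of_nonneg_left (hstep j) (hP i j)

end Far

/-! ### The conditional cost of a center -/

theorem maxDist_le_iff {H : Type*} [NormedAddCommGroup H] {c : H} {s : Finset H} {a : ℝ} :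
    maxDist c s ≤ a ↔ 0 ≤ a ∧ ∀ p ∈ s, ‖c - p‖ ≤ a := by
  constructor
  · intro h
    have h0 : 0 ≤ a := (NNReal.coe_nonneg _).trans h
    refine ⟨h0, fun p hp => le_trans ?_ h⟩
    have := Finset.le_sup (f := fun p => ‖c - p‖₊) hp
    exact_mod_cast this
  · rintro ⟨h0, h⟩
    lift a to ℝ≥0 using h0
    refine NNReal.coe_le_coe.2 (Finset.sup_le fun p hp => ?_)
    exact_mod_cast h p hp

theorem maxDist_nonneg {H : Type*} [NormedAddCommGroup H] (c : H) (s : Finset H) :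
    0 ≤ maxDist c s := NNReal.coe_nonneg _

namespace ProbInput

variable {d n z : ℕ} (D : ProbInput d n z) {H : Type*} [NormedAddCommGroup H]
  (φ : EuclideanSpace ℝ (Fin d) → H)

/-- The image of the location with the indices `i, j`; the value is `0` if it is absent. -/
def point (i j : ℕ) : H :=
  match D.loc? i j with
  | some q => φ q
  | none => 0

/-- Whether the location with the indices `i, j` is a point. -/
def present? (i j : ℕ) : Prop := (D.loc? i j).isSome

/-- The probability with the indices `i, j`, or `0` out of range. -/
def prob? (i j : ℕ) : ℝ := if h : i < n ∧ j < z then D.prob ⟨i, h.1⟩ ⟨j, h.2⟩ else 0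

/-- The probability that the realization is not empty. -/
noncomputable def hitProb : ℝ := hit z D.prob? D.present? n

/-- The distance from `c` to the farthest point of a realization. -/
noncomputable def far (c : H) (g : Fin n → Fin z) : ℝ :=
  open Classical in maxDist c ((D.realization g).image φ)

/-- Whether the realization has a point. -/
def Nonempty (g : Fin n → Fin z) : Prop := ∃ i : Fin n, D.present? i (g i)

open Classical in
/-- The probability of a choice, conditioned on the realization being nonempty. -/
noncomputable def condWeight (g : Fin n → Fin z) : ℝ :=
  if D.Nonempty g then D.weight g / D.hitProb else 0

/-- The expected cost of a center, conditioned on the realization being nonempty. -/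
noncomputable def condCost (c : H) : ℝ := ∑ g, D.condWeight g * D.far φ c g

theorem prob?_nonneg (i j : ℕ) : 0 ≤ D.prob? i j := by
  unfold prob?
  split_ifs
  exacts [D.prob_nonneg _ _, le_rfl]

theorem prob?_sum (i : ℕ) (hi : i < n) : ∑ j ∈ Finset.range z, D.prob? i j = 1 := by
  rw [Finset.sum_range, ← D.prob_sum ⟨i, hi⟩]
  exact Finset.sum_congr rfl fun j _ => dif_pos ⟨hi, j.2⟩

theorem loc?_fin (i : Fin n) (j : Fin z) : D.loc? i j = D.loc i j := dif_pos ⟨i.2, j.2⟩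

theorem weight_eq (g : Fin n → Fin z) : D.weight g = ∏ i : Fin n, D.prob? i (g i) :=
  Finset.prod_congr rfl fun i _ => (dif_pos ⟨i.2, (g i).2⟩ : D.prob? i (g i) = _).symm

theorem weight_nonneg (g : Fin n → Fin z) : 0 ≤ D.weight g :=
  Finset.prod_nonneg fun i _ => D.prob_nonneg i _

theorem point_eq {i j : ℕ} {q : EuclideanSpace ℝ (Fin d)} (h : D.loc? i j = some q) :
    D.point φ i j = φ q := by
  simp only [point, h]

theorem mem_image_realization {g : Fin n → Fin z} {p : H} :
    p ∈ (open Classical in (D.realization g).image φ) ↔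
      ∃ i : Fin n, D.present? i (g i) ∧ D.point φ i (g i) = p := by
  classical
  simp only [Finset.mem_image, realization, Finset.mem_eraseNone, Finset.mem_univ, true_and]
  constructor
  · rintro ⟨q, ⟨i, hi⟩, rfl⟩
    rw [← D.loc?_fin] at hi
    exact ⟨i, by simp [present?, hi], D.point_eq φ hi⟩
  · rintro ⟨i, hi, rfl⟩
    obtain ⟨q, hq⟩ := Option.isSome_iff_exists.1 hi
    exact ⟨q, ⟨i, by rw [← D.loc?_fin, hq]⟩, (D.point_eq φ hq).symm⟩

theorem far_le_iff {c : H} {g : Fin n → Fin z} {a : ℝ} :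
    D.far φ c g ≤ a ↔
      0 ≤ a ∧ ∀ i : Fin n, D.present? i (g i) → ‖c - D.point φ i (g i)‖ ≤ a := by
  rw [far, maxDist_le_iff]
  refine and_congr_right fun _ => ⟨fun h i hi => ?_, fun h p hp => ?_⟩
  · exact h _ ((D.mem_image_realization φ).2 ⟨i, hi, rfl⟩)
  · obtain ⟨i, hi, rfl⟩ := (D.mem_image_realization φ).1 hp
    exact h i hi

theorem far_nonneg (c : H) (g : Fin n → Fin z) : 0 ≤ D.far φ c g := maxDist_nonneg _ _

theorem norm_sub_le_far (c : H) (g : Fin n → Fin z) (i : Fin n) (hi : D.present? i (g i)) :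
    ‖c - D.point φ i (g i)‖ ≤ D.far φ c g := ((D.far_le_iff φ).1 le_rfl).2 i hi

theorem farDist_eq_far (c : H) {g : Fin n → Fin z} {J : ℕ → ℕ} (h : ∀ i : Fin n, J i = g i) :
    farDist D.present? (D.point φ) c n J = D.far φ c g := by
  refine eq_of_forall_ge_iff fun a => ?_
  rw [farDist_le_iff, D.far_le_iff]
  refine and_congr_right fun _ => ⟨fun H i hi => ?_, fun H k hk hi => ?_⟩
  · have := H i i.2
    rw [h i] at this
    exact this hi
  · have := H ⟨k, hk⟩
    rw [← h ⟨k, hk⟩] at this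
    exact this hi

theorem extend_fin (g : Fin n → Fin z) (J : ℕ → ℕ) (i : Fin n) : extend g J i = g i :=
  dif_pos i.2

theorem expectedCost_eq (c : H) : expectedCost D φ c = ∑ g, D.weight g * D.far φ c g := rfl

theorem far_eq_zero (c : H) {g : Fin n → Fin z} (hg : ¬ D.Nonempty g) : D.far φ c g = 0 :=
  le_antisymm ((D.far_le_iff φ).2 ⟨le_rfl, fun i hi => absurd ⟨i, hi⟩ hg⟩) (D.far_nonneg φ c g)

theorem exists_extend (g : Fin n → Fin z) (J : ℕ → ℕ) :
    (∃ k < n, D.present? k (extend g J k)) ↔ D.Nonempty g := by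
  constructor
  · rintro ⟨k, hk, h⟩
    exact ⟨⟨k, hk⟩, by rwa [← extend_fin g J ⟨k, hk⟩]⟩
  · rintro ⟨i, hi⟩
    exact ⟨i, i.2, by rwa [extend_fin g J i]⟩

open Classical in
theorem sum_weight_nonempty :
    ∑ g, (if D.Nonempty g then D.weight g else 0) = D.hitProb := by
  rw [hitProb, ← rowSum_exists D.prob?_sum le_rfl 0, rowSum_eq_sum]
  refine Finset.sum_congr rfl fun g _ => ?_
  simp only [D.exists_extend, ← D.weight_eq]
  split_ifs <;> simp

theorem sum_weight : ∑ g, D.weight g = 1 := by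
  have := rowSum_const D.prob?_sum le_rfl (1 : ℝ) 0
  rw [rowSum_eq_sum] at this
  simpa only [mul_one, ← D.weight_eq] using this

theorem hitProb_nonneg : 0 ≤ D.hitProb := hit_nonneg D.prob?_nonneg n

theorem hitProb_le_one : D.hitProb ≤ 1 := by
  classical
  rw [← D.sum_weight_nonempty, ← D.sum_weight]
  refine Finset.sum_le_sum fun g _ => ?_
  split_ifs
  exacts [le_rfl, D.weight_nonneg g]

theorem condWeight_nonneg (g : Fin n → Fin z) : 0 ≤ D.condWeight g := by
  unfold condWeight
  split_ifs
  exacts [div_nonneg (D.weight_nonneg g) D.hitProb_nonneg, le_rfl]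

theorem sum_condWeight (h : 0 < D.hitProb) : ∑ g, D.condWeight g = 1 := by
  classical
  rw [← div_self h.ne']
  nth_rw 1 [← D.sum_weight_nonempty]
  rw [Finset.sum_div]
  refine Finset.sum_congr rfl fun g _ => ?_
  unfold condWeight
  split_ifs <;> simp

open Classical in
theorem hitProb_mul_condWeight (g : Fin n → Fin z) :
    D.hitProb * D.condWeight g = if D.Nonempty g then D.weight g else 0 := by
  unfold condWeight
  split_ifs with hg
  · rcases D.hitProb_nonneg.eq_or_lt with h | h
    · rw [← h, zero_mul]
      have h0 := D.sum_weight_nonempty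
      rw [← h, Finset.sum_eq_zero_iff_of_nonneg] at h0
      · have := h0 g (Finset.mem_univ g)
        rw [if_pos hg] at this
        exact this.symm
      · intro g _
        split_ifs
        exacts [D.weight_nonneg g, le_rfl]
    · rw [mul_div_cancel₀ _ h.ne']
  · exact mul_zero _

theorem expectedCost_eq_mul (c : H) : expectedCost D φ c = D.hitProb * D.condCost φ c := by
  classical
  rw [expectedCost_eq, condCost, Finset.mul_sum]
  refine Finset.sum_congr rfl fun g _ => ?_
  rw [← mul_assoc, D.hitProb_mul_condWeight]
  split_ifs with hg
  · rfl
  · rw [D.far_eq_zero φ c hg, mul_zero, zero_mul]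

/-- Identifies the law of the row-by-row sampler with `condWeight`. -/
theorem hitSum_eq (h : 0 < D.hitProb) (e : (ℕ → ℕ) → ℝ) (J : ℕ → ℕ) :
    hitSum z D.prob? D.present? n 0 e J = ∑ g, D.condWeight g * e (extend g J) := by
  classical
  rw [← mul_right_inj' h.ne', hitProb, hit_mul_hitSum D.prob?_nonneg D.prob?_sum le_rfl,
    rowSum_eq_sum, Finset.mul_sum]
  refine Finset.sum_congr rfl fun g _ => ?_
  rw [← mul_assoc, ← hitProb, D.hitProb_mul_condWeight, ← D.weight_eq]
  simp only [D.exists_extend]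
  split_ifs <;> simp

/-- The sum of the excesses of all locations over `τ`, weighted by their probabilities. -/
noncomputable def excessSum (c : H) (τ : ℝ) : ℝ :=
  ∑ k ∈ Finset.range n, ∑ j ∈ Finset.range z,
    D.prob? k j * excess D.present? (D.point φ) c τ k j

/-- The maximum is at most `τ` plus the sum of the excesses of the drawn points, and conditioning
raises a probability by a factor of at most `1 / D.hitProb`. -/
theorem condCost_le_excessSum (h : 0 < D.hitProb) (c : H) {τ : ℝ} (hτ : 0 ≤ τ) :
    D.condCost φ c ≤ τ + D.excessSum φ c τ / D.hitProb := by
  classical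
  have hw : ∀ g, D.condWeight g ≤ D.weight g / D.hitProb := by
    intro g
    unfold condWeight
    split_ifs
    exacts [le_rfl, div_nonneg (D.weight_nonneg g) h.le]
  have hs : ∑ g, D.weight g * ∑ k ∈ Finset.range n,
      excess D.present? (D.point φ) c τ k (extend g 0 k) = D.excessSum φ c τ := by
    rw [excessSum, ← rowSum_excess D.prob?_sum c τ le_rfl 0, rowSum_eq_sum]
    simp only [D.weight_eq]
  calc D.condCost φ c ≤ ∑ g, (D.condWeight g * τ + D.weight g / D.hitProb *
        ∑ k ∈ Finset.range n, excess D.present? (D.point φ) c τ k (extend g 0 k)) := by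
        refine Finset.sum_le_sum fun g _ => ?_
        rw [← D.farDist_eq_far φ c (extend_fin g 0)]
        refine (mul_le_mul_of_nonneg_left (farDist_le_add_excess c hτ n _)
          (D.condWeight_nonneg g)).trans ?_
        rw [mul_add]
        exact add_le_add le_rfl (mul_le_mul_of_nonneg_right (hw g)
          (Finset.sum_nonneg fun k _ => excess_nonneg c τ k _))
    _ = τ + D.excessSum φ c τ / D.hitProb := by
        rw [Finset.sum_add_distrib, ← Finset.sum_mul, D.sum_condWeight h, one_mul, ← hs,
          Finset.sum_div]
        simp only [div_mul_eq_mul_div]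

-- If `τ` is at least a conditional median, then by `half_sum_excess_le` half of the excess sum is
-- at most the unconditional expectation of `max 0 (far - τ)`, hence at most `D.hitProb * D.condCost
-- φ c`. Together with `condCost_le_excessSum` this makes an easily computed quantity a
-- constant-factor estimate of the cost.
open Classical in
theorem excessSum_le_condCost (h : 0 < D.hitProb) (c : H) {τ : ℝ} (hτ : 0 ≤ τ)
    (hm : ∑ g, D.condWeight g * (if τ < D.far φ c g then 1 else 0) ≤ 1 / 2) :
    D.excessSum φ c τ / D.hitProb ≤ 2 * D.condCost φ c := by
  have h1 : 1 / 2 ≤ rowSum z D.prob? n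
      (fun J => if farDist D.present? (D.point φ) c n J ≤ τ then 1 else 0) 0 := by
    rw [rowSum_eq_sum]
    simp only [D.farDist_eq_far φ c (extend_fin _ 0), ← D.weight_eq]
    -- An empty realization has farthest distance `0 ≤ τ`, so exceeding `τ` has unconditional
    -- probability `D.hitProb` times the conditional one.
    have hc : ∑ g, D.weight g * (if D.far φ c g ≤ τ then 1 else 0) =
        1 - D.hitProb * ∑ g, D.condWeight g * (if τ < D.far φ c g then 1 else 0) := by
      refine eq_sub_of_add_eq (Eq.trans ?_ D.sum_weight)
      rw [Finset.mul_sum, ← Finset.sum_add_distrib]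
      refine Finset.sum_congr rfl fun g _ => ?_
      rw [← mul_assoc, D.hitProb_mul_condWeight]
      by_cases hg : D.Nonempty g
      · by_cases hf : D.far φ c g ≤ τ
        · simp [hf, not_lt.2 hf]
        · simp [hf, not_le.1 hf, hg]
      · simp [hg, D.far_eq_zero φ c hg, hτ]
    rw [hc]
    have h0 : 0 ≤ ∑ g, D.condWeight g * (if τ < D.far φ c g then (1 : ℝ) else 0) :=
      Finset.sum_nonneg fun g _ => mul_nonneg (D.condWeight_nonneg g) (by split_ifs <;> norm_num)
    have := mul_le_mul_of_nonneg_right D.hitProb_le_one h0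
    linarith
  have h2 := half_sum_excess_le D.prob?_nonneg D.prob?_sum c 0 h1 le_rfl 0
  have h3 : rowSum z D.prob? n
      (fun J => max 0 (farDist D.present? (D.point φ) c n J - τ)) 0 ≤
      D.hitProb * D.condCost φ c := by
    rw [← D.expectedCost_eq_mul, expectedCost_eq, rowSum_eq_sum]
    refine Finset.sum_le_sum fun g _ => ?_
    rw [← D.weight_eq, D.farDist_eq_far φ c (extend_fin g 0)]
    refine mul_le_mul_of_nonneg_left (max_le (D.far_nonneg φ c g) (by linarith))
      (D.weight_nonneg g)
  rw [div_le_iff₀ h]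
  rw [← excessSum] at h2
  linarith

theorem condCost_nonneg (c : H) : 0 ≤ D.condCost φ c :=
  Finset.sum_nonneg fun g _ => mul_nonneg (D.condWeight_nonneg g) (D.far_nonneg φ c g)

theorem far_le_add (c c' : H) (g : Fin n → Fin z) :
    D.far φ c' g ≤ D.far φ c g + ‖c' - c‖ := by
  rw [far_le_iff]
  refine ⟨add_nonneg (D.far_nonneg φ c g) (norm_nonneg _), fun i hi => ?_⟩
  have h1 := D.norm_sub_le_far φ c g i hi
  have h2 := norm_sub_le_norm_sub_add_norm_sub c' c (D.point φ i (g i))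
  linarith

theorem condCost_le_add (h : 0 < D.hitProb) (c c' : H) :
    D.condCost φ c' ≤ D.condCost φ c + ‖c' - c‖ := by
  have : D.condCost φ c + ‖c' - c‖ = ∑ g, D.condWeight g * (D.far φ c g + ‖c' - c‖) := by
    simp only [mul_add, Finset.sum_add_distrib, ← Finset.sum_mul, D.sum_condWeight h, one_mul]
    rfl
  rw [this]
  exact Finset.sum_le_sum fun g _ =>
    mul_le_mul_of_nonneg_left (D.far_le_add φ c c' g) (D.condWeight_nonneg g)

theorem expectedCost_le_add (c c' : H) :
    expectedCost D φ c' ≤ expectedCost D φ c + ‖c' - c‖ := by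
  have : expectedCost D φ c + ‖c' - c‖ = ∑ g, D.weight g * (D.far φ c g + ‖c' - c‖) := by
    simp only [mul_add, Finset.sum_add_distrib, ← Finset.sum_mul, D.sum_weight, one_mul]
    rfl
  rw [this, D.expectedCost_eq]
  exact Finset.sum_le_sum fun g _ =>
    mul_le_mul_of_nonneg_left (D.far_le_add φ c c' g) (D.weight_nonneg g)

theorem continuous_expectedCost : Continuous (expectedCost D φ) := by
  refine LipschitzWith.continuous (K := 1) (LipschitzWith.of_dist_le_mul fun c c' => ?_)
  rw [Real.dist_eq, NNReal.coe_one, one_mul, dist_eq_norm, abs_sub_le_iff]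
  have h1 := D.expectedCost_le_add φ c c'
  have h2 := D.expectedCost_le_add φ c' c
  rw [norm_sub_rev] at h1
  constructor <;> linarith

end ProbInput

/-! ### Two facts about weighted sums -/

-- Markov's inequality. Mean zero is treated apart: there every term of positive weight vanishes.
open Classical in
theorem sum_ite_le_of_mean {ι : Type*} [Fintype ι] {w X : ι → ℝ} (hw : ∀ i, 0 ≤ w i)
    (h1 : ∑ i, w i = 1) (hX : ∀ i, 0 ≤ X i) {μ : ℝ} (hμ : ∑ i, w i * X i ≤ μ) :
    7 / 8 ≤ ∑ i, w i * (if X i ≤ 8 * μ then 1 else 0) := by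
  have h0 : ∀ i ∈ Finset.univ, 0 ≤ w i * X i := fun i _ => mul_nonneg (hw i) (hX i)
  rcases (Finset.sum_nonneg h0).trans hμ |>.eq_or_lt with h | h
  · have hz := (Finset.sum_eq_zero_iff_of_nonneg h0).1
      (le_antisymm (hμ.trans_eq h.symm) (Finset.sum_nonneg h0))
    refine le_trans (by norm_num) (h1.symm.trans_le (Finset.sum_le_sum fun i hi => ?_))
    rcases mul_eq_zero.1 (hz i hi) with h' | h'
    · simp [h']
    · simp [h', ← h]
  · have : ∑ i, w i * (1 - X i / (8 * μ)) ≤ ∑ i, w i * (if X i ≤ 8 * μ then 1 else 0) := by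
      refine Finset.sum_le_sum fun i _ => mul_le_mul_of_nonneg_left ?_ (hw i)
      have hd : 0 ≤ X i / (8 * μ) := div_nonneg (hX i) (by linarith)
      split_ifs with hi
      · linarith
      · have := (one_le_div (by linarith : 0 < 8 * μ)).2 (not_le.1 hi).le
        linarith
    refine le_trans ?_ this
    simp only [mul_sub, mul_one, Finset.sum_sub_distrib, h1, ← mul_div_assoc, ← Finset.sum_div]
    have : (∑ i, w i * X i) / (8 * μ) ≤ 1 / 8 := by
      rw [div_le_div_iff₀ (by linarith) (by norm_num)]
      linarith
    linarith

-- Call `i` good if at most half of the weight lies strictly above `X i`. If some index is bad, take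
-- a bad one with `X` maximal: more than half of the weight lies above it, and all of that is good.
open Classical in
theorem half_le_sum_ite_median {ι : Type*} [Fintype ι] {w : ι → ℝ} (X : ι → ℝ)
    (hw : ∀ i, 0 ≤ w i) (h1 : ∑ i, w i = 1) :
    1 / 2 ≤ ∑ i, w i * (if ∑ j, w j * (if X i < X j then 1 else 0) ≤ 1 / 2 then 1 else 0) := by
  set good : ι → Prop := fun i => ∑ j, w j * (if X i < X j then 1 else 0) ≤ 1 / 2 with hg
  rcases (Finset.univ.filter fun i => ¬ good i).eq_empty_or_nonempty with h | h
  · have : ∀ i, good i := by simpa using Finset.filter_eq_empty_iff.1 h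
    refine le_trans (by norm_num) (h1.symm.trans_le (Finset.sum_le_sum fun i _ => ?_))
    rw [if_pos (this i), mul_one]
  · obtain ⟨i, hi, hmax⟩ := Finset.exists_max_image _ X h
    have hi' : 1 / 2 < ∑ j, w j * (if X i < X j then 1 else 0) :=
      not_le.1 (Finset.mem_filter.1 hi).2
    refine hi'.le.trans (Finset.sum_le_sum fun j _ => mul_le_mul_of_nonneg_left ?_ (hw j))
    by_cases hj : X i < X j
    · have : good j := by
        by_contra hb
        exact absurd (hmax j (Finset.mem_filter.2 ⟨Finset.mem_univ _, hb⟩)) (not_le.2 hj)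
      rw [if_pos hj, if_pos this]
    · rw [if_neg hj]
      split_ifs <;> norm_num

/-- The center `c`, moved towards `p` by the fraction `a` of the way. -/
def towards {H : Type*} [NormedAddCommGroup H] [InnerProductSpace ℝ H] (a : ℝ) (c p : H) : H := (1 - a) • c + a • p

/-! ### The geometry of a subgradient step -/

/-- The standard inequality for one step of length `η`: expand the square and bound `⟪x - p, c - p⟫`
by Cauchy–Schwarz. Here `x` is the reference center; with `b` its farthest distance and `p` the
farthest point from `c`, the middle term is the difference of the two costs of the realization. If
`c = p`, the fraction is `0` and the center stays. -/
theorem norm_towards_sub_sq_le {H : Type*} [NormedAddCommGroup H]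
    [InnerProductSpace ℝ H] {c p x : H} {η b : ℝ} (hη : 0 ≤ η) (hb : ‖x - p‖ ≤ b) :
    ‖towards (η / ‖c - p‖) c p - x‖ ^ 2 ≤ ‖c - x‖ ^ 2 - 2 * η * (‖c - p‖ - b) + η ^ 2 := by
  have hb0 : 0 ≤ b := (norm_nonneg _).trans hb
  rcases eq_or_ne (‖c - p‖) 0 with h | h
  · simp only [h, towards, div_zero, sub_zero, one_smul, zero_smul, add_zero]
    nlinarith [mul_nonneg hη hb0, sq_nonneg η]
  · have e1 : towards (η / ‖c - p‖) c p - x = (c - x) - (η / ‖c - p‖) • (c - p) := by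
      simp only [towards, sub_smul, one_smul, smul_sub]
      abel
    have e2 : inner ℝ (c - x) (c - p) = ‖c - p‖ ^ 2 - inner ℝ (x - p) (c - p) := by
      rw [← real_inner_self_eq_norm_sq, ← inner_sub_left]
      congr 1
      abel
    have e3 : inner ℝ (x - p) (c - p) ≤ b * ‖c - p‖ :=
      (real_inner_le_norm _ _).trans (mul_le_mul_of_nonneg_right hb (norm_nonneg _))
    have hpos : 0 < ‖c - p‖ := lt_of_le_of_ne (norm_nonneg _) h.symm
    rw [e1, norm_sub_sq_real, inner_smul_right, norm_smul, mul_pow, Real.norm_eq_abs, sq_abs, e2]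
    have e4 : (η / ‖c - p‖) ^ 2 * ‖c - p‖ ^ 2 = η ^ 2 := by
      rw [← mul_pow, div_mul_cancel₀ _ h]
    have e5 : η / ‖c - p‖ * inner ℝ (x - p) (c - p) ≤ η * b := by
      calc _ ≤ η / ‖c - p‖ * (b * ‖c - p‖) :=
            mul_le_mul_of_nonneg_left e3 (div_nonneg hη hpos.le)
        _ = _ := by field_simp
    have e6 : η / ‖c - p‖ * ‖c - p‖ ^ 2 = η * ‖c - p‖ := by field_simp
    rw [e4, mul_sub, e6]
    linarith

namespace ProbInput

variable {d n z : ℕ} (D : ProbInput d n z) {H : Type*} [NormedAddCommGroup H]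
  [InnerProductSpace ℝ H] (φ : EuclideanSpace ℝ (Fin d) → H)

/-! ### Existence of an optimal center -/

/-- Orthogonal projection onto the span `V` of the finitely many points brings a center no farther
from any of them, so it suffices to minimize over `V`. There the cost is continuous, and coercive
because some nonempty realization has positive weight. -/
theorem exists_isMinOn_expectedCost :
    ∃ c : H, IsMinOn (expectedCost D φ) Set.univ c := by
  rcases D.hitProb_nonneg.eq_or_lt with h | h
  · refine ⟨0, fun c _ => ?_⟩
    simp only [Set.mem_ofPred_eq, D.expectedCost_eq_mul φ, ← h, zero_mul, le_refl]
  obtain ⟨g, -, hg⟩ : ∃ g ∈ Finset.univ, 0 < D.condWeight g := by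
    refine Finset.exists_lt_of_sum_lt ?_
    rw [D.sum_condWeight h, Finset.sum_const_zero]
    exact one_pos
  have hne : D.Nonempty g := by
    by_contra hne
    simp [condWeight, hne] at hg
  obtain ⟨i, hi⟩ := hne
  set V : Submodule ℝ H :=
    Submodule.span ℝ (Set.range fun x : Fin n × Fin z => D.point φ x.1 x.2) with hV
  have hp : ∀ (i : Fin n) (j : Fin z), D.point φ i j ∈ V := fun i j =>
    Submodule.subset_span ⟨(i, j), rfl⟩
  have : FiniteDimensional ℝ V := FiniteDimensional.span_of_finite ℝ (Set.finite_range _)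
  have : ProperSpace V := FiniteDimensional.proper ℝ V
  have hw : 0 < D.hitProb * D.condWeight g := mul_pos h hg
  have hlow : ∀ c : V, D.hitProb * D.condWeight g * (‖c‖ - ‖D.point φ i (g i)‖) ≤
      expectedCost D φ (c : H) := by
    intro c
    rw [D.expectedCost_eq_mul, mul_assoc]
    refine mul_le_mul_of_nonneg_left ?_ h.le
    have h1 : D.condWeight g * D.far φ c g ≤ D.condCost φ c :=
      Finset.single_le_sum (fun g _ => mul_nonneg (D.condWeight_nonneg g) (D.far_nonneg φ (c : H) g))
        (Finset.mem_univ g)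
    refine le_trans (mul_le_mul_of_nonneg_left ?_ hg.le) h1
    exact (norm_sub_norm_le (c : H) _).trans (D.norm_sub_le_far φ c g i hi)
  obtain ⟨c, hc⟩ := (show Continuous fun c : V => expectedCost D φ (c : H) from
    (D.continuous_expectedCost φ).comp continuous_subtype_val).exists_forall_le
      (Filter.tendsto_atTop_mono hlow (Filter.Tendsto.const_mul_atTop hw
        (Filter.tendsto_atTop_add_const_right _ _ tendsto_norm_cocompact_atTop)))
  refine ⟨c, fun x _ => (hc ⟨V.starProjection x, V.starProjection_apply_mem x⟩).trans ?_⟩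
  simp only [D.expectedCost_eq]
  refine Finset.sum_le_sum fun g _ => mul_le_mul_of_nonneg_left ?_ (D.weight_nonneg g)
  refine (D.far_le_iff φ).2 ⟨D.far_nonneg φ x g, fun i hi => ?_⟩
  refine le_trans ?_ (D.norm_sub_le_far φ x g i hi)
  conv_lhs => rw [← V.starProjection_eq_self_iff.2 (hp i (g i)), ← map_sub]
  exact V.norm_starProjection_apply_le _

/-! ### Stochastic subgradient descent -/

/-- Jensen's inequality: the cost is a convex function of the center. -/
theorem condCost_average_le {T : ℕ} (hT : 0 < T) (x : ℕ → H) :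
    D.condCost φ ((T : ℝ)⁻¹ • ∑ t ∈ Finset.range T, x t) ≤
      (T : ℝ)⁻¹ * ∑ t ∈ Finset.range T, D.condCost φ (x t) := by
  have hT' : (0 : ℝ) < T := by exact_mod_cast hT
  have h : ∀ g, D.far φ ((T : ℝ)⁻¹ • ∑ t ∈ Finset.range T, x t) g ≤
      (T : ℝ)⁻¹ * ∑ t ∈ Finset.range T, D.far φ (x t) g := by
    intro g
    rw [far_le_iff]
    refine ⟨mul_nonneg (inv_nonneg.2 hT'.le) (Finset.sum_nonneg fun t _ => D.far_nonneg φ _ g),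
      fun i hi => ?_⟩
    have : (T : ℝ)⁻¹ • ∑ t ∈ Finset.range T, x t - D.point φ i (g i) =
        (T : ℝ)⁻¹ • ∑ t ∈ Finset.range T, (x t - D.point φ i (g i)) := by
      rw [Finset.sum_sub_distrib, Finset.sum_const, Finset.card_range, smul_sub,
        ← Nat.cast_smul_eq_nsmul ℝ, smul_smul, inv_mul_cancel₀ hT'.ne', one_smul]
    rw [this, norm_smul, Real.norm_of_nonneg (inv_nonneg.2 hT'.le)]
    exact mul_le_mul_of_nonneg_left ((norm_sum_le _ _).trans
      (Finset.sum_le_sum fun t _ => D.norm_sub_le_far φ (x t) g i hi)) (inv_nonneg.2 hT'.le)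
  calc _ ≤ ∑ g, D.condWeight g * ((T : ℝ)⁻¹ * ∑ t ∈ Finset.range T, D.far φ (x t) g) :=
        Finset.sum_le_sum fun g _ => mul_le_mul_of_nonneg_left (h g) (D.condWeight_nonneg g)
    _ = _ := by
        simp only [condCost, Finset.mul_sum]
        rw [Finset.sum_comm]
        refine Finset.sum_congr rfl fun t _ => Finset.sum_congr rfl fun g _ => ?_
        ring

/-- `val` bounds from below the probability that the descent with steps of length `η`, continued
from the history `x 0, …, x t` up to time `T`, ends with an average satisfying `Q`. -/
structure DescentBound (η : ℝ) (T : ℕ) (Q : H → Prop) (val : ℕ → (ℕ → H) → ℝ) : Prop where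
  step : ∀ t < T, ∀ x : ℕ → H, ∃ u : (Fin n → Fin z) → ℝ,
    val t x ≤ ∑ g, D.condWeight g * u g ∧
    ∀ g, ∀ i : Fin n, D.present? i (g i) → ‖x t - D.point φ i (g i)‖ = D.far φ (x t) g →
      u g ≤ val (t + 1) (Function.update x (t + 1)
        (towards (η / ‖x t - D.point φ i (g i)‖) (x t) (D.point φ i (g i))))
  le_one : ∀ x, val T x ≤ 1
  good : ∀ x, 0 < val T x → Q ((T : ℝ)⁻¹ • ∑ t ∈ Finset.range T, x t)

theorem sum_condWeight_mul_const (h : 0 < D.hitProb) (a : ℝ) : ∑ g, D.condWeight g * a = a := by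
  rw [← Finset.sum_mul, D.sum_condWeight h, one_mul]

/-- The degenerate case, in which one cannot divide by the optimal cost. The step length is `0` and
the start is `y`, so the descent never moves; `val` is the indicator of this. -/
theorem DescentBound.of_condCost_eq_zero (h : 0 < D.hitProb) {T : ℕ} (hT : 0 < T) {ε : ℝ} {y : H}
    (hy : D.condCost φ y = 0) :
    ∃ val, DescentBound D φ 0 T (fun c => D.condCost φ c ≤ (1 + ε) * D.condCost φ y) val ∧
      ∀ x : ℕ → H, x 0 = y → 7 / 8 ≤ val 0 x := by
  classical
  refine ⟨fun t x => if ∀ s ≤ t, x s = y then 1 else 0, ⟨fun t _ x => ?_, fun x => ?_,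
    fun x hx => ?_⟩, fun x hx => ?_⟩
  · refine ⟨fun _ => if ∀ s ≤ t, x s = y then 1 else 0, (D.sum_condWeight_mul_const h _).ge,
      fun g i _ _ => ?_⟩
    by_cases hs : ∀ s ≤ t, x s = y
    · refine (if_pos hs).trans_le (if_pos fun s hst => ?_).ge
      rcases Nat.le_succ_iff.1 hst with h' | rfl
      · rw [Function.update_of_ne (by omega)]
        exact hs s h'
      · simp [towards, hs t le_rfl]
    · rw [if_neg hs]
      split_ifs <;> norm_num
  · split_ifs <;> norm_num
  · have hs : ∀ s ≤ T, x s = y := by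
      by_contra hs
      simp [hs] at hx
    have : ∑ t ∈ Finset.range T, x t = T • y := by
      rw [Finset.sum_congr rfl fun t ht => hs t (Finset.mem_range.1 ht).le]
      simp
    rw [this, ← Nat.cast_smul_eq_nsmul ℝ, smul_smul,
      inv_mul_cancel₀ (by exact_mod_cast hT.ne'), one_smul, hy]
    simp
  · have : ∀ s ≤ 0, x s = y := fun s hs => by rwa [Nat.le_zero.1 hs]
    exact le_trans (by norm_num) (if_pos this).ge

/-- Subgradient descent with Markov's inequality built into `val`. The potential is the regret so
far, plus `‖x t - y‖² / (2η)`, plus `η/2` for each remaining step; it does not increase in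
expectation. Its ratio to the tolerated regret `TεF` bounds the probability of failure. -/
theorem DescentBound.of_condCost_pos (h : 0 < D.hitProb) {ε η : ℝ} {k T : ℕ} {y : H}
    (hε : 0 < ε) (hk : 1 ≤ ε * k) (hT : T = 368640 * (k * k)) (hmin : ∀ c, D.condCost φ y ≤ D.condCost φ c)
    (hy : 0 < D.condCost φ y) (hη : D.condCost φ y ≤ η * (720 * k))
    (hη' : η * (720 * k) ≤ 90 * D.condCost φ y) :
    ∃ val, DescentBound D φ η T (fun c => D.condCost φ c ≤ (1 + ε) * D.condCost φ y) val ∧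
      ∀ x : ℕ → H, ‖x 0 - y‖ ≤ 8 * D.condCost φ y → 7 / 8 ≤ val 0 x := by
  set F := D.condCost φ y with hF
  have hk0 : (0 : ℝ) < k := by
    rcases Nat.eq_zero_or_pos k with rfl | h'
    · norm_num at hk
    · exact_mod_cast h'
  have hη0 : 0 < η := pos_of_mul_pos_left (hy.trans_le hη) (by positivity)
  have hTk : (T : ℝ) = 368640 * (k * k) := by rw [hT]; push_cast; ring
  have hT0 : (0 : ℝ) < T := by rw [hTk]; positivity
  have hden : 0 < T * ε * F := by positivity
  refine ⟨fun t x => 1 - (∑ s ∈ Finset.range t, (D.condCost φ (x s) - F) + ‖x t - y‖ ^ 2 / (2 * η)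
    + (T - t) * (η / 2)) / (T * ε * F), ⟨fun t _ x => ?_, fun x => ?_, fun x hx => ?_⟩,
    fun x hx => ?_⟩
  -- `u g` is `val (t + 1)` with the new squared distance replaced by its bound from
  -- `norm_towards_sub_sq_le`. Averaging over `g` turns the difference of farthest distances into
  -- `D.condCost φ (x t) - F`, which cancels the newly added regret.
  · refine ⟨fun g => 1 - (∑ s ∈ Finset.range (t + 1), (D.condCost φ (x s) - F) +
      (‖x t - y‖ ^ 2 - 2 * η * (D.far φ (x t) g - D.far φ y g) + η ^ 2) / (2 * η)
      + (T - (t + 1 : ℕ)) * (η / 2)) / (T * ε * F), le_of_eq ?_, fun g i hi hg => ?_⟩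
    · have hc : ∑ g, (D.condWeight g * D.far φ (x t) g - D.condWeight g * D.far φ y g) =
          D.condCost φ (x t) - F := Finset.sum_sub_distrib _ _
      have e : ∀ g, D.condWeight g * (1 - (∑ s ∈ Finset.range (t + 1), (D.condCost φ (x s) - F) +
          (‖x t - y‖ ^ 2 - 2 * η * (D.far φ (x t) g - D.far φ y g) + η ^ 2) / (2 * η)
          + (T - (t + 1 : ℕ)) * (η / 2)) / (T * ε * F)) =
          D.condWeight g * (1 - (∑ s ∈ Finset.range (t + 1), (D.condCost φ (x s) - F) +
          (‖x t - y‖ ^ 2 + η ^ 2) / (2 * η) + (T - (t + 1 : ℕ)) * (η / 2)) / (T * ε * F)) +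
          (D.condWeight g * D.far φ (x t) g - D.condWeight g * D.far φ y g) / (T * ε * F) := by
        intro g
        field_simp
        ring
      simp only [e]
      rw [Finset.sum_add_distrib, D.sum_condWeight_mul_const h, ← Finset.sum_div,
        hc,  Finset.sum_range_succ]
      push_cast
      field_simp
      ring
    · refine sub_le_sub_left (div_le_div_of_nonneg_right (add_le_add (add_le_add
        (le_of_eq ?_) ?_) le_rfl) hden.le) 1
      · refine Finset.sum_congr rfl fun s hs => ?_
        rw [Function.update_of_ne (Finset.mem_range.1 hs).ne]
      · rw [Function.update_self]
        refine div_le_div_of_nonneg_right ?_ (by positivity)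
        rw [← hg]
        exact norm_towards_sub_sq_le hη0.le (D.norm_sub_le_far φ y g i hi)
  · refine sub_le_self _ (div_nonneg (add_nonneg (add_nonneg (Finset.sum_nonneg fun s _ =>
      sub_nonneg.2 (hmin _)) (by positivity)) ?_) hden.le)
    rw [sub_self, zero_mul]
  · have hT' : 0 < T := by exact_mod_cast hT0
    refine (D.condCost_average_le φ hT' x).trans ?_
    rw [sub_pos, div_lt_one hden, sub_self, zero_mul, add_zero, Finset.sum_sub_distrib,
      Finset.sum_const, Finset.card_range, nsmul_eq_mul] at hx
    have : 0 ≤ ‖x T - y‖ ^ 2 / (2 * η) := by positivity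
    rw [inv_mul_le_iff₀ hT0]
    linarith
  · simp only [Finset.range_zero, Finset.sum_empty, zero_add, Nat.cast_zero, sub_zero]
    -- The constants meet here: `(8F)² · 720k / (2F) = 23040 k F`, and `368640 = 16 · 23040`. The
    -- other half, `T η / 2`, is at most `T F / (16 k)` because `90 / (2 · 720) = 1/16`.
    have h1 : ‖x 0 - y‖ ^ 2 / (2 * η) ≤ T * F / (16 * k) := by
      rw [div_le_div_iff₀ (by positivity) (by positivity), hTk]
      have h3 : ‖x 0 - y‖ ^ 2 ≤ (8 * F) ^ 2 := pow_le_pow_left₀ (norm_nonneg _) hx 2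
      have h4 := mul_le_mul_of_nonneg_left hη (show 0 ≤ 1024 * (F * k) by positivity)
      nlinarith [mul_le_mul_of_nonneg_right h3 (show 0 ≤ 16 * (k : ℝ) by positivity)]
    have h2 : T * (η / 2) ≤ T * F / (16 * k) := by
      rw [mul_div_assoc]
      refine mul_le_mul_of_nonneg_left ?_ hT0.le
      rw [div_le_div_iff₀ (by norm_num) (by positivity)]
      linarith
    have h3 : (‖x 0 - y‖ ^ 2 / (2 * η) + T * (η / 2)) / (T * ε * F) ≤ 1 / 8 := by
      rw [div_le_iff₀ hden]
      have : T * F / (16 * k) ≤ T * F * ε / 16 := by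
        rw [div_le_div_iff₀ (by positivity) (by norm_num)]
        nlinarith [mul_le_mul_of_nonneg_left hk (show 0 ≤ T * F by positivity)]
      linarith
    linarith

end ProbInput

/-! ### Subroutines: norms and distances of implicit centers -/

/-- The scalar variable in cell `0` of the natural-number array `a`. -/
def NExp.var (a : ℕ) : NExp := .get a (.const 0)

/-- The scalar variable in cell `0` of the real array `a`. -/
def RExp.var (a : ℕ) : RExp := .get a (.const 0)

/-- Assignment to a scalar variable. -/
def Cmd.nvar (a : ℕ) (x : NExp) : Cmd := .nset a (.const 0) x

/-- Assignment to a scalar variable. -/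
def Cmd.rvar (a : ℕ) (x : RExp) : Cmd := .rset a (.const 0) x

@[simp] theorem NExp.eval_var (O : Oracle) (m : Mem) (a : ℕ) :
    (NExp.var a).eval O m = m.nat a 0 := rfl

@[simp] theorem NExp.cost_var (a : ℕ) : (NExp.var a).cost = 2 := rfl

@[simp] theorem RExp.eval_var (O : Oracle) (m : Mem) (a : ℕ) :
    (RExp.var a).eval O m = m.real a 0 := rfl

@[simp] theorem RExp.cost_var (O : Oracle) (a : ℕ) : (RExp.var a).cost O = 2 := rfl

attribute [simp] NExp.eval RExp.eval NExp.cost RExp.cost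

theorem Agree.nat {l : ℕ} {m m' : Mem} (h : Agree l m m') {a : ℕ} (ha : a < l) :
    m'.nat a = m.nat a := (h a ha).1

theorem Agree.real {l : ℕ} {m m' : Mem} (h : Agree l m m') {a : ℕ} (ha : a < l) :
    m'.real a = m.real a := (h a ha).2

theorem Triple.nvar {O : Oracle} {E : Mem → Prop} {m : Mem} {Q : Mem → Prop} {a : ℕ} {x : NExp}
    (h : Q (m.setNat a 0 (x.eval O m))) : Triple O E (.nvar a x) m (x.cost + 2) Q :=
  (Triple.nset (Q := Q) h).mono (fun _ h => h) (by simp only [NExp.cost]; omega)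

theorem Triple.rvar {O : Oracle} {E : Mem → Prop} {m : Mem} {Q : Mem → Prop} {a : ℕ} {x : RExp}
    (h : Q (m.setReal a 0 (x.eval O m))) : Triple O E (.rvar a x) m (x.cost O + 2) Q :=
  (Triple.rset (Q := Q) h).mono (fun _ h => h) (by simp only [NExp.cost]; omega)

theorem Triple.weaken {O : Oracle} {E : Mem → Prop} {p : Cmd} {m : Mem} {b b' : ℕ}
    {Q : Mem → Prop} (h : Triple O E p m b Q) (hb : b ≤ b') : Triple O E p m b' Q :=
  h.mono (fun _ h => h) hb

theorem Triple.nvar_seq {O : Oracle} {E : Mem → Prop} {q : Cmd} {m : Mem} {b a : ℕ} {x : NExp}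
    {Q : Mem → Prop} (h : Triple O E q (m.setNat a 0 (x.eval O m)) b Q) :
    Triple O E (.seq (.nvar a x) q) m (b + (x.cost + 3)) Q :=
  ((Triple.nvar (Q := fun m' => m' = m.setNat a 0 (x.eval O m)) rfl).seq
    fun _ h' => h' ▸ h).weaken (by omega)

theorem Triple.rvar_seq {O : Oracle} {E : Mem → Prop} {q : Cmd} {m : Mem} {b a : ℕ} {x : RExp}
    {Q : Mem → Prop} (h : Triple O E q (m.setReal a 0 (x.eval O m)) b Q) :
    Triple O E (.seq (.rvar a x) q) m (b + (x.cost O + 3)) Q :=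
  ((Triple.rvar (Q := fun m' => m' = m.setReal a 0 (x.eval O m)) rfl).seq
    fun _ h' => h' ▸ h).weaken (by omega)

/-- The element of the feature space with the coefficients in the real array `a`. -/
def listSum {H : Type*} [NormedAddCommGroup H] [InnerProductSpace ℝ H] (v : ℕ → ℕ → H) (m : Mem)
    (a : ℕ) : H :=
  ∑ w ∈ Finset.range (m.nat 0 0), m.real a w • v (m.nat 1 w) (m.nat 2 w)

theorem Agree.listSum {H : Type*} [NormedAddCommGroup H] [InnerProductSpace ℝ H] {v : ℕ → ℕ → H}
    {l : ℕ} {m m' : Mem} (h : Agree l m m') (hl : 3 ≤ l) {a : ℕ} (ha : a < l) :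
    listSum v m' a = listSum v m a := by
  simp only [PSVDD.listSum, h.nat (show 0 < l by omega), h.nat (show 1 < l by omega),
    h.nat (show 2 < l by omega), h.real ha]

/-- The inner product of the current center with the location indexed by the variables `25, 26`. -/
def innerProd : Cmd :=
  .seq (.rvar 35 (.const 0)) (.forLoop 35 (.var 0) (.rvar 35 (.add (.var 35)
    (.mul (.get 1 (.var 35)) (.ker (.get 1 (.var 35)) (.get 2 (.var 35)) (.var 25) (.var 26))))))

/-- The squared norm of the current center. -/
def normSq : Cmd :=
  .seq (.rvar 25 (.const 0)) (.forLoop 27 (.var 0)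
    (.seq (.nvar 25 (.get 1 (.var 27))) (.seq (.nvar 26 (.get 2 (.var 27))) (.seq innerProd
      (.rvar 25 (.add (.var 25) (.mul (.get 1 (.var 27)) (.var 35))))))))

/-- The distance of the current center to the location indexed by the variables `25, 26`. -/
def distTo : Cmd :=
  .seq innerProd (.rvar 30 (.sqrt (.add (.sub (.var 25) (.mul (.const 2) (.var 35)))
    (.ker (.var 25) (.var 26) (.var 25) (.var 26)))))

section Subroutines

variable {O : Oracle} {E : Mem → Prop} {H : Type*} [NormedAddCommGroup H] [InnerProductSpace ℝ H]
  {v : ℕ → ℕ → H}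

theorem triple_innerProd (hker : ∀ i j k l, O.ker i j k l = inner ℝ (v i j) (v k l)) (m : Mem) :
    Triple O E innerProd m (m.nat 0 0 * (O.kerCost + 40) + 20) fun m' => Agree 35 m m' ∧
      m'.real 35 0 = inner ℝ (listSum v m 1) (v (m.nat 25 0) (m.nat 26 0)) := by
  refine Triple.rvar_seq (Triple.forLoop (N := m.nat 0 0) (b := O.kerCost + 20)
      (fun i m' => Agree 35 m m' ∧ m'.nat 35 0 = i ∧ m'.real 35 0 =
        ∑ w ∈ Finset.range i, m.real 1 w * inner ℝ (v (m.nat 1 w) (m.nat 2 w))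
          (v (m.nat 25 0) (m.nat 26 0))) ?_ ?_ ?_) |>.mono ?_ ?_
  · exact ⟨((Agree.refl 35 m).setReal le_rfl 0 _).setNat le_rfl 0 0, by simp, by simp⟩
  · rintro i m' ⟨h, hi, -⟩
    exact ⟨hi, by simp [h.nat]⟩
  · rintro i m' - ⟨h, hi, hs⟩
    refine Triple.weaken (Triple.rvar ⟨by simp [hi], (h.setReal le_rfl _ _).setNat le_rfl _ _,
      by simp, ?_⟩) ?_
    · simp [h.nat, h.real, hi, hs, hker, Finset.sum_range_succ]
    · simp
      omega
  · rintro m' ⟨h, -, hs⟩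
    refine ⟨h, ?_⟩
    rw [hs, listSum, sum_inner]
    simp only [real_inner_smul_left]
  · simp
    ring_nf
    omega

theorem triple_normSq (hker : ∀ i j k l, O.ker i j k l = inner ℝ (v i j) (v k l)) (m : Mem) :
    Triple O E normSq m (m.nat 0 0 * (m.nat 0 0 * (O.kerCost + 40) + 70) + 20) fun m' =>
      Agree 25 m m' ∧ m'.real 25 0 = ‖listSum v m 1‖ ^ 2 := by
  refine Triple.rvar_seq (Triple.forLoop (N := m.nat 0 0)
      (b := m.nat 0 0 * (O.kerCost + 40) + 50)
      (fun i m' => Agree 25 m m' ∧ m'.nat 27 0 = i ∧ m'.real 25 0 =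
        ∑ w ∈ Finset.range i, m.real 1 w *
          inner ℝ (listSum v m 1) (v (m.nat 1 w) (m.nat 2 w))) ?_ ?_ ?_) |>.mono ?_ ?_
  · exact ⟨((Agree.refl 25 m).setReal le_rfl 0 _).setNat (by norm_num) 0 0, by simp, by simp⟩
  · rintro i m' ⟨h, hi, -⟩
    exact ⟨hi, by simp [h.nat]⟩
  · rintro i m' - ⟨h, hi, hs⟩
    refine Triple.weaken (Triple.nvar_seq (Triple.nvar_seq
      ((triple_innerProd hker _).seq fun m₃ h₃ => Triple.rvar ?_))) ?_
    · have h2 := (h.setNat le_rfl 0 (m.nat 1 i)).setNat (show 25 ≤ 26 by norm_num) 0 (m.nat 2 i)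
      simp [hi, h.nat] at h₃
      have h3 : Agree 25 m m₃ := h2.trans (h₃.1.mono (by norm_num))
      have e1 : m₃.nat 27 0 = i := by simp [h₃.1.nat, hi]
      refine ⟨by simp [e1], (h3.setReal le_rfl _ _).setNat (by norm_num) _ _, by simp, ?_⟩
      have e2 : m₃.real 25 0 = m'.real 25 0 := by simp [h₃.1.real]
      have e3 := h2.listSum (v := v) (by norm_num) (show 1 < 25 by norm_num)
      simp [h₃.2, e1, e2, e3, h3.real, hs, Finset.sum_range_succ]
    · simp [h.nat]
  · rintro m' ⟨h, -, hs⟩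
    refine ⟨h, ?_⟩
    rw [hs, ← real_inner_self_eq_norm_sq]
    conv_rhs => rw [listSum, inner_sum]
    simp only [real_inner_smul_right]
    rfl
  · simp
    ring_nf
    omega

/-- The squared norm of the center is expected in the real variable `25`. It is computed once per
center, so a distance takes a single pass through the list instead of a quadratic number of kernel
evaluations. -/
theorem triple_distTo (hker : ∀ i j k l, O.ker i j k l = inner ℝ (v i j) (v k l)) (m : Mem)
    (hm : m.real 25 0 = ‖listSum v m 1‖ ^ 2) :
    Triple O E distTo m (m.nat 0 0 * (O.kerCost + 40) + O.kerCost + 50) fun m' => Agree 30 m m' ∧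
      m'.real 30 0 = ‖listSum v m 1 - v (m.nat 25 0) (m.nat 26 0)‖ := by
  refine Triple.weaken ((triple_innerProd hker m).seq fun m₁ h₁ => Triple.rvar
    ⟨(h₁.1.mono (by norm_num)).setReal le_rfl _ _, ?_⟩) ?_
  · simp only [Mem.setReal_real, Function.update_self, RExp.eval, RExp.eval_var, NExp.eval_var,
      h₁.2, h₁.1.nat (show 25 < 35 by norm_num), h₁.1.nat (show 26 < 35 by norm_num),
      h₁.1.real (show 25 < 35 by norm_num), hm, hker, real_inner_self_eq_norm_sq, Rat.cast_ofNat]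
    rw [← norm_sub_sq_real, Real.sqrt_sq (norm_nonneg _)]
  · simp
    omega

end Subroutines

/-! ### Subroutines: drawing a realization and finding its farthest point -/

attribute [simp] BExp.holds BExp.cost

namespace ValTriple

variable {O : Oracle} {E : Mem → Prop} {m : Mem} {e : ℝ} {b b' : ℕ} {Q R : Mem → ℝ → Prop}
  {p q : Cmd}

theorem weaken (h : ValTriple O E p m e b Q) (hb : b ≤ b') : ValTriple O E p m e b' Q :=
  h.mono (fun _ _ h => h) hb

theorem nvar_seq {a : ℕ} {x : NExp} (h : ValTriple O E q (m.setNat a 0 (x.eval O m)) e b Q) :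
    ValTriple O E (.seq (.nvar a x) q) m e (b + (x.cost + 3)) Q :=
  (triple_seq (Triple.nvar (Q := fun m' => m' = m.setNat a 0 (x.eval O m)) rfl)
    fun _ h' => h' ▸ h).weaken (by omega)

theorem rvar_seq {a : ℕ} {x : RExp} (h : ValTriple O E q (m.setReal a 0 (x.eval O m)) e b Q) :
    ValTriple O E (.seq (.rvar a x) q) m e (b + (x.cost O + 3)) Q :=
  (triple_seq (Triple.rvar (Q := fun m' => m' = m.setReal a 0 (x.eval O m)) rfl)
    fun _ h' => h' ▸ h).weaken (by omega)

theorem nvar {a : ℕ} {x : NExp} (h : Q (m.setNat a 0 (x.eval O m)) e) :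
    ValTriple O E (.nvar a x) m e (x.cost + 2) Q :=
  (of_triple (Triple.nvar (Q := fun m' => m' = m.setNat a 0 (x.eval O m)) rfl)).mono
    (fun _ _ h' => h'.1 ▸ h'.2 ▸ h) le_rfl

theorem skip (h : Q m e) : ValTriple O E .skip m e 1 Q :=
  fun _ _ hk => (hk m e h).skip

theorem nset {a : ℕ} {i x : NExp} (h : Q (m.setNat a (i.eval O m) (x.eval O m)) e) :
    ValTriple O E (.nset a i x) m e (i.cost + x.cost + 1) Q :=
  fun _ _ hk => (hk _ e h).nset

theorem while_true {c : BExp} (hc : c.holds O m) (hp : ValTriple O E p m e b R)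
    (hw : ∀ m' e', R m' e' → ValTriple O E (.while c p) m' e' b' Q) :
    ValTriple O E (.while c p) m e (b + b' + (c.cost O + 1)) Q :=
  fun k B hk => (Achieves.while_true hc (hp (.while c p :: k) (B + b') fun m' e' h =>
    hw m' e' h k B hk)).mono (by omega)

theorem while_false {c : BExp} (hc : ¬ c.holds O m) (h : Q m e) :
    ValTriple O E (.while c p) m e (c.cost O + 1) Q :=
  fun _ _ hk => Achieves.while_false hc (hk m e h)

end ValTriple

/-- Find the point of the realization in the array `15` that is farthest from the current center:
its indices are put into the variables `16, 17` and its distance into the real variable `16`. -/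
def farthest : Cmd :=
  .seq normSq (.seq (.rvar 16 (.const 0)) (.forLoop 18 .n
    (.ite (.present (.var 18) (.get 15 (.var 18)))
      (.seq (.nvar 25 (.var 18)) (.seq (.nvar 26 (.get 15 (.var 18))) (.seq distTo
        (.ite (.rle (.var 16) (.var 30))
          (.seq (.rvar 16 (.var 30)) (.seq (.nvar 16 (.var 18)) (.nvar 17 (.get 15 (.var 18)))))
          .skip))))
      .skip)))

/-- Draw the location of the row in the variable `20` and put its index into the array `15`. The
variable `21` says whether an earlier row is present. -/
def drawRow : Cmd :=
  .seq (.rvar 20 (.const 0)) (.forLoop 22 .z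
    (.seq (.ite (.present (.var 20) (.var 22)) (.rvar 21 (.prob (.var 20) (.var 22)))
      (.ite (.nle (.const 1) (.var 21)) (.rvar 21 (.prob (.var 20) (.var 22)))
        (.rvar 21 (.mul (.prob (.var 20) (.var 22)) (.get 2 (.var 20))))))
    (.seq (.rvar 20 (.add (.var 20) (.var 21)))
    (.seq (.toss 23 (.const 0) (.div (.var 21) (.var 20)))
      (.ite (.nle (.const 1) (.var 23)) (.nset 15 (.var 20) (.var 22)) .skip)))))

/-- Draw a realization, conditioned on being nonempty, into the array `15`. -/
def drawRows : Cmd :=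
  .seq (.nvar 20 .n) (.seq (.nvar 21 (.const 0)) (.while (.nle (.const 1) (.var 20))
    (.seq (.nvar 20 (.sub (.var 20) (.const 1))) (.seq drawRow
      (.ite (.present (.var 20) (.get 15 (.var 20))) (.nvar 21 (.const 1)) .skip)))))

section Subroutines

variable {O : Oracle} {E : Mem → Prop} {H : Type*} [NormedAddCommGroup H] [InnerProductSpace ℝ H]
  {v : ℕ → ℕ → H}

theorem triple_farthest (hker : ∀ i j k l, O.ker i j k l = inner ℝ (v i j) (v k l)) (m : Mem) :
    Triple O E farthest m (m.nat 0 0 * (m.nat 0 0 * (O.kerCost + 40) + 70) +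
      O.n * (m.nat 0 0 * (O.kerCost + 40) + O.kerCost + 140) + 60) fun m' =>
      Agree 16 m m' ∧ m'.real 25 0 = ‖listSum v m 1‖ ^ 2 ∧
      m'.real 16 0 = farDist O.present v (listSum v m 1) O.n (m.nat 15) ∧
      ((∃ k < O.n, O.present k (m.nat 15 k)) → ∃ k < O.n, O.present k (m.nat 15 k) ∧
        m'.nat 16 0 = k ∧ m'.nat 17 0 = m.nat 15 k ∧
        ‖listSum v m 1 - v k (m.nat 15 k)‖ =
          farDist O.present v (listSum v m 1) O.n (m.nat 15)) := by
  set c := listSum v m 1 with hc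
  refine Triple.mono ((triple_normSq hker m).seq fun m₁ h₁ => Triple.rvar_seq
    (Triple.forLoop (N := O.n) (b := m.nat 0 0 * (O.kerCost + 40) + O.kerCost + 125)
      (fun i m' => Agree 16 m m' ∧ m'.nat 18 0 = i ∧ m'.real 25 0 = ‖c‖ ^ 2 ∧
        m'.real 16 0 = farDist O.present v c i (m.nat 15) ∧
        ((∃ k < i, O.present k (m.nat 15 k)) → ∃ k < i, O.present k (m.nat 15 k) ∧
          m'.nat 16 0 = k ∧ m'.nat 17 0 = m.nat 15 k ∧
          ‖c - v k (m.nat 15 k)‖ = farDist O.present v c i (m.nat 15))) ?_ ?_ ?_)) ?_ ?_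
    (R := fun m' => Agree 16 m m' ∧ m'.nat 18 0 = O.n ∧ m'.real 25 0 = ‖c‖ ^ 2 ∧
        m'.real 16 0 = farDist O.present v c O.n (m.nat 15) ∧
        ((∃ k < O.n, O.present k (m.nat 15 k)) → ∃ k < O.n, O.present k (m.nat 15 k) ∧
          m'.nat 16 0 = k ∧ m'.nat 17 0 = m.nat 15 k ∧
          ‖c - v k (m.nat 15 k)‖ = farDist O.present v c O.n (m.nat 15)))
  · exact ⟨((h₁.1.mono (by norm_num)).setReal le_rfl 0 _).setNat (by norm_num) 0 0, by simp,
      by simp [h₁.2, ← hc], by simp [farDist], by simp⟩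
  · rintro i m' ⟨-, hi, -⟩
    exact ⟨hi, rfl⟩
  · rintro i m' - ⟨h, hi, hN, hd, hf⟩
    refine Triple.weaken (Triple.ite (b := m.nat 0 0 * (O.kerCost + 40) + O.kerCost + 110)
      (fun hp => ?_) fun hp => Triple.weaken (Triple.skip ?_) (by omega)) ?_
    · have hp' : O.present i (m.nat 15 i) := by simpa [hi, h.nat] using hp
      have hfd : farDist O.present v c (i + 1) (m.nat 15) =
          max (farDist O.present v c i (m.nat 15)) ‖c - v i (m.nat 15 i)‖ := by
        simp only [farDist, if_pos hp']
      refine Triple.weaken (Triple.nvar_seq (Triple.nvar_seq ((triple_distTo hker _ ?_).seq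
        fun m₃ h₃ => Triple.ite (b := 30) (fun hle => Triple.weaken (Triple.rvar_seq
          (Triple.nvar_seq (Triple.nvar ?_))) ?_)
          fun hle => Triple.weaken (Triple.skip ?_) (by omega)))) ?_
      · have h2 := (h.setNat (show 16 ≤ 25 by norm_num) 0 i).setNat (show 16 ≤ 26 by norm_num) 0
          (m.nat 15 i)
        have e3 := h2.listSum (v := v) (by norm_num) (show 1 < 16 by norm_num)
        simp [hi, h.nat, e3, hN, hc]
      all_goals try
        have h2 := (h.setNat (show 16 ≤ 25 by norm_num) 0 i).setNat (show 16 ≤ 26 by norm_num) 0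
          (m.nat 15 i)
        have e3 := h2.listSum (v := v) (by norm_num) (show 1 < 16 by norm_num)
        simp [hi, h.nat] at h₃
        rw [e3, ← hc] at h₃
        have h3 : Agree 16 m m₃ := h2.trans (h₃.1.mono (by norm_num))
        have e1 : m₃.nat 18 0 = i := by simp [h₃.1.nat, hi]
        have e2 : m₃.real 16 0 = farDist O.present v c i (m.nat 15) := by simp [h₃.1.real, hd]
        have e4 : m₃.real 25 0 = ‖c‖ ^ 2 := by simp [h₃.1.real, hN]
      · simp [e2, h₃.2] at hle
        refine ⟨by simp [e1], (((h3.setReal le_rfl _ _).setNat (by norm_num) _ _).setNat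
          (by norm_num) _ _).setNat (by norm_num) _ _, by simp, by simp [e4], ?_, fun _ =>
          ⟨i, by omega, hp', by simp [e1], by simp [e1, h3.nat], ?_⟩⟩
        · simp [h₃.2, hfd, max_eq_right hle]
        · rw [hfd, max_eq_right hle]
      · simp
      · simp [e2, h₃.2] at hle
        refine ⟨e1, h3.setNat (by norm_num) _ _, by simp, by simp [e4], ?_, fun _ => ?_⟩
        · simp [e2, hfd, max_eq_left hle.le]
        -- The new distance is strictly below the current maximum, which is therefore positive and
        -- attained at an earlier present row. Since ties replace the maximum, the first present
        -- point is always recorded, even at distance `0`.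
        · obtain ⟨k, hk, hpk, h4, h5, h6⟩ := hf (by
            by_contra hcon
            refine absurd (farDist_le_iff.2 ⟨le_rfl, fun k hk hpk => absurd ⟨k, hk, hpk⟩ hcon⟩)
              (not_le.2 ((norm_nonneg _).trans_lt hle)))
          refine ⟨k, by omega, hpk, ?_, ?_, ?_⟩
          · simp [h₃.1.nat, h4]
          · simp [h₃.1.nat, h5]
          · rw [h6, hfd, max_eq_left hle.le]
      · simp [h.nat]
    · have hp' : ¬ O.present i (m.nat 15 i) := by simpa [hi, h.nat] using hp
      have hfd : farDist O.present v c (i + 1) (m.nat 15) =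
          farDist O.present v c i (m.nat 15) := by
        simp only [farDist, if_neg hp']
      refine ⟨hi, h.setNat (by norm_num) _ _, by simp, by simp [hN], by simp [hd, hfd], ?_⟩
      rintro ⟨k, hk, hpk⟩
      have hki : k < i := by
        rcases Nat.lt_succ_iff_lt_or_eq.1 hk with h' | rfl
        exacts [h', absurd hpk hp']
      obtain ⟨k, hk, hpk, h4, h5, h6⟩ := hf ⟨k, hki, hpk⟩
      exact ⟨k, by omega, hpk, by simp [h4], by simp [h5], by rw [h6, hfd]⟩
    · simp
  · rintro m' ⟨h, -, hr⟩
    exact ⟨h, hr⟩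
  · simp
    ring_nf
    omega

/-- Weighted reservoir sampling: in one pass, location `j` replaces the candidate with probability
`w j / A (j + 1)`, where `A` denotes the prefix sums. This ends with the law `w j / A z`, without
knowing the total in advance. -/
theorem valTriple_drawRow (hP : ∀ i j, 0 ≤ O.prob i j) (f : ℕ → ℝ) (m : Mem)
    (hS : m.real 2 (m.nat 20 0) = hit O.z O.prob O.present (m.nat 20 0)) :
    ValTriple O E drawRow m (∑ j ∈ Finset.range O.z,
        rowWeight O.z O.prob O.present (m.nat 21 0) (m.nat 20 0) j /
          (∑ j' ∈ Finset.range O.z, rowWeight O.z O.prob O.present (m.nat 21 0) (m.nat 20 0) j') *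
          f j) (O.z * 100 + 30) fun m' e' =>
      Agree 15 m m' ∧ m'.nat 20 = m.nat 20 ∧ m'.nat 21 = m.nat 21 ∧
        ∃ j, m'.nat 15 = Function.update (m.nat 15) (m.nat 20 0) j ∧ (e' ≤ f j ∨ e' ≤ 0) := by
  set r := m.nat 20 0 with hr
  set w := fun j => rowWeight O.z O.prob O.present (m.nat 21 0) r j with hw
  have hw0 : ∀ j, 0 ≤ w j := fun j => rowWeight_nonneg hP _ _ _
  set A := fun j => ∑ j' ∈ Finset.range j, w j' with hA
  have hA0 : ∀ j, 0 ≤ A j := fun j => Finset.sum_nonneg fun j _ => hw0 j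
  have hAs : ∀ j, A (j + 1) = A j + w j := fun j => Finset.sum_range_succ _ _
  change ValTriple O E drawRow m (∑ j ∈ Finset.range O.z, w j / A O.z * f j) _ _
  refine ValTriple.mono (ValTriple.rvar_seq (ValTriple.forLoop (N := O.z) (b := 80)
    -- Before round `j`, each location from `j` on still has its final chance `w j' / A z`, and the
    -- current candidate `x` survives with probability `A j / A z`. The initial candidate is
    -- arbitrary, since `A 0 = 0`.
    (fun j m' e' => Agree 15 m m' ∧ m'.nat 20 = m.nat 20 ∧ m'.nat 21 = m.nat 21 ∧
      m'.nat 22 0 = j ∧ m'.real 20 0 = A j ∧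
      ∃ x, m'.nat 15 = Function.update (m.nat 15) r x ∧
        e' ≤ ∑ j' ∈ Finset.Ico j O.z, w j' / A O.z * f j' + A j / A O.z * f x) ?_ ?_ ?_)) ?_ ?_
  · refine ⟨((Agree.refl 15 m).setReal (by norm_num) 0 _).setNat (by norm_num) 0 0, by simp,
      by simp, by simp, by simp [hA], m.nat 15 r, by simp, ?_⟩
    simp [hA]
  · rintro j m' e' ⟨-, -, -, hj, -⟩
    exact ⟨hj, rfl⟩
  · rintro j m' e' hjz ⟨h, h20, h21, hj, hAj, x, hx, he⟩
    have hi : m'.nat 20 0 = r := by rw [h20]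
    refine ValTriple.weaken (ValTriple.triple_seq (b₁ := 30)
      (R := fun m₁ => m₁ = m'.setReal 21 0 (w j)) ?_ fun m₁ h₁ => ValTriple.rvar_seq
      (ValTriple.seq (b₂ := 20) (ValTriple.toss (e₁ := ∑ j' ∈ Finset.Ico (j + 1) O.z, w j' / A O.z * f j' +
          A (j + 1) / A O.z * f j) (e₀ := ∑ j' ∈ Finset.Ico (j + 1) O.z, w j' / A O.z * f j' +
          A (j + 1) / A O.z * f x)
          (Q := fun m₂ e₂ => ∃ s, m₂ = ((m'.setReal 21 0 (w j)).setReal 20 0 (A (j + 1))).setNat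
            23 0 s ∧ e₂ ≤ ∑ j' ∈ Finset.Ico (j + 1) O.z, w j' / A O.z * f j' +
            A (j + 1) / A O.z * f (if 1 ≤ s then j else x)) ?_ ?_ ?_ ?_ ?_)
        fun m₂ e₂ h₂ => ?_)) ?_
    · refine Triple.weaken (Triple.ite (b := 20) (fun hp => Triple.weaken (Triple.rvar ?_) ?_)
        fun hp => Triple.weaken (Triple.ite (b := 12) (fun hs => Triple.weaken (Triple.rvar ?_) ?_)
          fun hs => Triple.weaken (Triple.rvar ?_) ?_) ?_) ?_
      · simp [hi, hj] at hp
        simp [hi, hj, hw, rowWeight, hp]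
      · simp
      · simp [hi, hj] at hp
        simp [h21] at hs
        simp [hi, hj, hw, rowWeight, hs]
      · simp
      · simp [hi, hj] at hp
        simp [h21] at hs
        simp [hi, hj, hw, rowWeight, hp, hs, h.real, hS]
      · simp
      · simp
      · simp
    · simp [h₁, hAj]
      exact div_nonneg (hw0 j) (add_nonneg (hA0 j) (hw0 j))
    · simp [h₁, hAj]
      exact div_le_one_of_le₀ (by linarith [hA0 j]) (add_nonneg (hA0 j) (hw0 j))
    · simp [h₁, hAj]
      refine he.trans ?_
      rw [← hAs, Finset.sum_eq_sum_Ico_succ_bot hjz]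
      rcases eq_or_ne (A (j + 1)) 0 with h0 | h0
      · have h1 := hAs j
        have h2 : w j = 0 := by linarith [hA0 j, hw0 j]
        have h3 : A j = 0 := by linarith [hA0 j, hw0 j]
        simp [h0, h2, h3]
      · have h1 := hAs j
        have h2 : A j = A (j + 1) - w j := by linarith
        rw [h2]
        refine le_of_eq ?_
        field_simp
        ring
    · exact ⟨1, by simp [h₁, hAj, hAs], by simp⟩
    · exact ⟨0, by simp [h₁, hAj, hAs], by simp⟩
    · obtain ⟨s, rfl, he₂⟩ := h₂
      have h3 : ∀ s, Agree 15 m (((m'.setReal 21 0 (w j)).setReal 20 0 (A (j + 1))).setNat 23 0 s) :=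
        fun s => ((h.setReal (by norm_num) _ _).setReal (by norm_num) _ _).setNat (by norm_num) _ _
      refine ValTriple.weaken (ValTriple.ite (b := 10) (fun hs => ValTriple.weaken
        (ValTriple.nset ?_) ?_) fun hs => ValTriple.weaken (ValTriple.skip ?_) (by omega)) ?_
      · simp at hs
        refine ⟨by simp [hj], ((h3 s).setNat (by norm_num) _ _).setNat (by norm_num) _ _,
          by simp [h20], by simp [h21], by simp, by simp, j, ?_, ?_⟩
        · simp [hx, hi, hj]
        · simpa only [if_pos hs] using he₂
      · simp
      · simp at hs
        refine ⟨by simp [hj], (h3 s).setNat (by norm_num) _ _,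
          by simp [h20], by simp [h21], by simp, by simp, x, ?_, ?_⟩
        · simp [hx]
        · simpa [hs] using he₂
      · simp
    · simp
  · rintro m' e' ⟨h, h20, h21, -, -, x, hx, he⟩
    refine ⟨h, h20, h21, x, hx, ?_⟩
    rw [Finset.Ico_self, Finset.sum_empty, zero_add] at he
    -- With total weight zero all quotients are `0`, and so is the promised value.
    rcases eq_or_ne (A O.z) 0 with h0 | h0
    · right
      simpa [h0] using he
    · left
      rwa [div_self h0, one_mul] at he
  · simp
    omega

theorem valTriple_drawRows (hP : ∀ i j, 0 ≤ O.prob i j) (f : (ℕ → ℕ) → ℝ) (m : Mem)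
    (hS : ∀ i ≤ O.n, m.real 2 i = hit O.z O.prob O.present i) :
    ValTriple O E drawRows m (hitSum O.z O.prob O.present O.n 0 f (m.nat 15))
      (O.n * (O.z * 100 + 80) + 30) fun m' e' =>
      Agree 15 m m' ∧ (e' ≤ f (m'.nat 15) ∨ e' ≤ 0) := by
  have key : ∀ i ≤ O.n, ∀ m' e', Agree 15 m m' → m'.nat 20 0 = i →
      (e' ≤ hitSum O.z O.prob O.present i (m'.nat 21 0) f (m'.nat 15) ∨ e' ≤ 0) →
      ValTriple O E (.while (.nle (.const 1) (.var 20))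
        (.seq (.nvar 20 (.sub (.var 20) (.const 1))) (.seq drawRow
        (.ite (.present (.var 20) (.get 15 (.var 20))) (.nvar 21 (.const 1)) .skip)))) m' e'
        (i * (O.z * 100 + 80) + 10) fun m' e' =>
        Agree 15 m m' ∧ (e' ≤ f (m'.nat 15) ∨ e' ≤ 0) := by
    intro i
    induction i with
    | zero =>
      intro _ m' e' h hi he
      refine ValTriple.weaken (ValTriple.while_false (by simp [hi]) ⟨h, he⟩) (by simp)
    | succ i ih =>
      intro hin m' e' h hi he
      -- `F j` is the value of continuing after drawing `j` in row `i`; a lost run takes `F = 0`, so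
      -- that both cases go through the same rule.
      obtain ⟨F, hF, hF'⟩ : ∃ F : ℕ → ℝ, e' ≤ ∑ j ∈ Finset.range O.z,
          rowWeight O.z O.prob O.present (m'.nat 21 0) i j /
          (∑ j' ∈ Finset.range O.z, rowWeight O.z O.prob O.present (m'.nat 21 0) i j') * F j ∧
          ∀ j e, (e ≤ F j ∨ e ≤ 0) → ∀ s, (O.present i j → s = 1) → (¬ O.present i j → s = m'.nat 21 0) →
            (e ≤ hitSum O.z O.prob O.present i s f (Function.update (m'.nat 15) i j) ∨ e ≤ 0) := by
        classical
        rcases he with he | he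
        · refine ⟨fun j => hitSum O.z O.prob O.present i (if O.present i j then 1 else m'.nat 21 0) f
            (Function.update (m'.nat 15) i j), he, fun j e h s hs hs' => ?_⟩
          by_cases hp : O.present i j <;> simp only [hp, if_true, if_false] at h
          exacts [hs hp ▸ h, hs' hp ▸ h]
        · exact ⟨fun _ => 0, by simpa using he, fun j e h s _ _ => Or.inr (h.elim id id)⟩
      refine ValTriple.weaken (ValTriple.while_true (b' := i * (O.z * 100 + 80) + 10) (by simp [hi])
        (ValTriple.nvar_seq (ValTriple.mono_val (ValTriple.seq (valTriple_drawRow hP F _ ?_)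
        fun m₁ e₁ h₁ => ValTriple.ite (b := 10) (Q := fun m₂ e₂ => Agree 15 m m₂ ∧
            m₂.nat 20 0 = i ∧ (e₂ ≤ hitSum O.z O.prob O.present i (m₂.nat 21 0) f (m₂.nat 15) ∨
              e₂ ≤ 0))
          (fun hp => ValTriple.weaken (ValTriple.nvar ?_) ?_)
          fun hp => ValTriple.weaken (ValTriple.skip ?_) (by omega)) ?_))
        fun m₂ e₂ h₂ => ih (by omega) m₂ e₂ h₂.1 h₂.2.1 h₂.2.2) ?_
      · simp [hi, h.real, hS i (by omega)]
      · obtain ⟨h3, h20, h21, j, hj, he₁⟩ := h₁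
        simp [hi] at h20 h21 hj
        simp [h20, hj] at hp
        refine ⟨(h.setNat (by norm_num) _ _).trans h3 |>.setNat (by norm_num) _ _, by simp [h20],
          ?_⟩
        simp only [hj, Mem.setNat_nat, NExp.eval, Function.update_self, ne_eq, Nat.reduceEqDiff,
          not_false_eq_true, Function.update_of_ne]
        exact hF' j e₁ he₁ 1 (fun _ => rfl) fun h => absurd hp h
      · simp
      · obtain ⟨h3, h20, h21, j, hj, he₁⟩ := h₁
        simp [hi] at h20 h21 hj
        simp [h20, hj] at hp
        refine ⟨(h.setNat (by norm_num) _ _).trans h3, by simp [h20], ?_⟩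
        rw [hj]
        exact hF' j e₁ he₁ _ (fun h => absurd h hp) fun _ => by rw [h21]
      · simpa [hi] using hF
      · simp
        ring_nf
        omega
  refine ValTriple.weaken (ValTriple.nvar_seq (ValTriple.nvar_seq
    (key O.n le_rfl _ _ ?_ ?_ (Or.inl ?_)))) ?_
  · exact ((Agree.refl 15 m).setNat (by norm_num) _ _).setNat (by norm_num) _ _
  · simp
  · simp
  · simp

end Subroutines

/-- Draw a realization and find its point that is farthest from the current center. -/
def draw : Cmd := .seq drawRows farthest

-- Sampling and search combined: `u g` may be any lower bound for the success after the realization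
-- `g`, and the value before the draw is its conditional expectation.
open ProbInput in
theorem valTriple_draw {d n z : ℕ} (D : ProbInput d n z) {H : Type*} [NormedAddCommGroup H]
    [InnerProductSpace ℝ H] {K : EuclideanSpace ℝ (Fin d) → EuclideanSpace ℝ (Fin d) → ℝ}
    {φ : EuclideanSpace ℝ (Fin d) → H} {ε : ℝ} {E : Mem → Prop}
    (hker : ∀ i j k l, (D.oracle K ε).ker i j k l = inner ℝ (D.point φ i j) (D.point φ k l))
    (hpos : 0 < D.hitProb) (u : (Fin n → Fin z) → ℝ) (m : Mem)
    (hS : ∀ i ≤ n, m.real 2 i = hit z D.prob? D.present? i) :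
    ValTriple (D.oracle K ε) E draw m (∑ g, D.condWeight g * u g)
      (n * (z * 100 + 80) + m.nat 0 0 * (m.nat 0 0 * (d + 40) + 70) +
        n * (m.nat 0 0 * (d + 40) + d + 140) + 100) fun m' e' => Agree 15 m m' ∧
      m'.real 25 0 = ‖listSum (D.point φ) m 1‖ ^ 2 ∧
      (e' ≤ 0 ∨ ∃ g, ∃ i : Fin n, D.present? i (g i) ∧ m'.nat 16 0 = i ∧ m'.nat 17 0 = g i ∧
        m'.real 16 0 = D.far φ (listSum (D.point φ) m 1) g ∧
        ‖listSum (D.point φ) m 1 - D.point φ i (g i)‖ = D.far φ (listSum (D.point φ) m 1) g ∧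
        e' ≤ u g) := by
  classical
  -- The sampler does not promise indices in range or a nonempty outcome. Such outcomes get the
  -- value `0`, which leaves the expectation unchanged, as they have conditional weight zero.
  have hsum := D.hitSum_eq hpos (fun J => if h : ∀ i : Fin n, J i < z then
    (if D.Nonempty (fun i => ⟨J i, h i⟩) then u fun i => ⟨J i, h i⟩ else 0) else 0) (m.nat 15)
  have hsum' : ∑ g, D.condWeight g * u g = hitSum z D.prob? D.present? n 0
      (fun J => if h : ∀ i : Fin n, J i < z then
      (if D.Nonempty (fun i => ⟨J i, h i⟩) then u fun i => ⟨J i, h i⟩ else 0) else 0)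
      (m.nat 15) := by
    rw [hsum]
    refine Finset.sum_congr rfl fun g _ => ?_
    have h : ∀ i : Fin n, extend g (m.nat 15) i < z := fun i => by
      rw [extend_fin]
      exact (g i).2
    have hg : (fun i : Fin n => (⟨extend g (m.nat 15) i, h i⟩ : Fin z)) = g := by
      funext i
      exact Fin.ext (extend_fin g _ i)
    rw [dif_pos h, hg]
    split_ifs with hne
    · rfl
    · simp [condWeight, hne]
  rw [hsum']
  refine ValTriple.weaken (ValTriple.seq (valTriple_drawRows (O := D.oracle K ε)
    D.prob?_nonneg _ m hS) fun m₁ e₁ h₁ => ValTriple.mono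
      (ValTriple.of_triple (triple_farthest hker m₁)) ?_ (b' := m.nat 0 0 * (m.nat 0 0 * (d + 40) +
        70) + n * (m.nat 0 0 * (d + 40) + d + 140) + 60) ?_) ?_
  · rintro m' e' ⟨⟨h, hN, hd, hf⟩, rfl⟩
    have hl := h₁.1.listSum (v := D.point φ) (by norm_num) (show 1 < 15 by norm_num)
    rw [hl] at hN hd hf
    refine ⟨h₁.1.trans (h.mono (by norm_num)), hN, ?_⟩
    rcases h₁.2 with he | he
    · split_ifs at he with hlt hne
      · obtain ⟨i, hi⟩ := hne
        obtain ⟨k, hk, hpk, h16, h17, hk'⟩ := hf ⟨i, i.2, hi⟩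
        have hfar := D.farDist_eq_far φ (listSum (D.point φ) m 1) (J := m₁.nat 15)
          (g := fun i => ⟨m₁.nat 15 i, hlt i⟩) fun _ => rfl
        exact Or.inr ⟨fun i => ⟨m₁.nat 15 i, hlt i⟩, ⟨k, hk⟩, hpk, h16, h17, hd.trans hfar,
          hk'.trans hfar, he⟩
      · exact Or.inl he
      · exact Or.inl he
    · exact Or.inl he
  · rw [h₁.1.nat (by norm_num)]
    exact le_rfl
  · simp only [oracle]
    omega

/-! ### Subroutines: the main phases -/

/-- Compute the probabilities that one of the first `i` rows is present, into the array `2`. -/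
def computeHits : Cmd :=
  .forLoop 6 .n (.seq (.rvar 6 (.const 0)) (.seq (.forLoop 7 .z
    (.ite (.present (.var 6) (.var 7)) (.rvar 6 (.add (.var 6) (.prob (.var 6) (.var 7))))
      (.rvar 6 (.add (.var 6) (.mul (.prob (.var 6) (.var 7)) (.get 2 (.var 6)))))))
    (.rset 2 (.add (.var 6) (.const 1)) (.var 6))))

/-- Compute the least `k` such that `ε k ≥ 1`, into the variable `4`. -/
def computeCeil : Cmd :=
  .seq (.nvar 4 (.const 0)) (.while (.not (.rle (.const 1) (.mul .eps (.cast (.var 4)))))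
    (.nvar 4 (.add (.var 4) (.const 1))))

/-- Add the current center, divided by the number of steps, to the output. -/
def accumulate : Cmd :=
  .forLoop 8 (.var 0) (.rset 0 (.var 8)
    (.add (.get 0 (.var 8)) (.div (.get 1 (.var 8)) (.cast (.var 5)))))

/-- Move the current center towards the point found by `farthest`, by the fraction in the real
variable `7`; the point is entered into the list at the position in the variable `9`. -/
def moveCenter : Cmd :=
  .seq (.nset 1 (.var 9) (.var 16)) (.seq (.nset 2 (.var 9) (.var 17))
    (.seq (.forLoop 8 (.var 0) (.rset 1 (.var 8) (.mul (.sub (.const 1) (.var 7)) (.get 1 (.var 8)))))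
      (.rset 1 (.var 9) (.var 7))))

/-- Sum the excesses over the distance in the real variable `16`. -/
def sumExcess : Cmd :=
  .seq (.rvar 8 (.var 16)) (.seq (.rvar 9 (.const 0)) (.forLoop 6 .n (.forLoop 7 .z
    (.ite (.present (.var 6) (.var 7))
      (.seq (.nvar 25 (.var 6)) (.seq (.nvar 26 (.var 7)) (.seq distTo
        (.ite (.rle (.var 8) (.var 30)) (.rvar 9 (.add (.var 9)
          (.mul (.prob (.var 6) (.var 7)) (.sub (.var 30) (.var 8))))) .skip))))
      .skip))))

theorem Triple.nset_seq {O : Oracle} {E : Mem → Prop} {q : Cmd} {m : Mem} {b a : ℕ} {i x : NExp}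
    {Q : Mem → Prop} (h : Triple O E q (m.setNat a (i.eval O m) (x.eval O m)) b Q) :
    Triple O E (.seq (.nset a i x) q) m (b + (i.cost + x.cost + 2)) Q :=
  ((Triple.nset (Q := fun m' => m' = m.setNat a (i.eval O m) (x.eval O m)) rfl).seq
    fun _ h' => h' ▸ h).weaken (by omega)

section Subroutines

variable {O : Oracle} {E : Mem → Prop}

theorem triple_computeHits (m : Mem) (h0 : m.real 2 0 = 0) :
    Triple O E computeHits m (O.n * (O.z * 40 + 60) + 20) fun m' =>
      (∀ a < 6, m'.nat a = m.nat a) ∧ m'.real 0 = m.real 0 ∧ m'.real 1 = m.real 1 ∧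
        ∀ i ≤ O.n, m'.real 2 i = hit O.z O.prob O.present i := by
  refine Triple.mono (Triple.forLoop (N := O.n) (b := O.z * 40 + 45) (fun i m' =>
    m'.nat 6 0 = i ∧ (∀ a < 6, m'.nat a = m.nat a) ∧ m'.real 0 = m.real 0 ∧
      m'.real 1 = m.real 1 ∧ ∀ k ≤ i, m'.real 2 k = hit O.z O.prob O.present k) ?_ ?_ ?_) ?_ ?_
  · refine ⟨by simp, fun a ha => by simp [Function.update_of_ne ha.ne], by simp, by simp,
      fun k hk => ?_⟩
    obtain rfl := Nat.le_zero.1 hk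
    simpa [hit] using h0
  · exact fun i m' h => ⟨h.1, rfl⟩
  · rintro i m' - ⟨hi, hn, hr0, hr1, hr2⟩
    refine Triple.weaken (Triple.rvar_seq ((Triple.forLoop (N := O.z) (b := 22) (fun j m₁ =>
      m₁.nat 7 0 = j ∧ m₁.nat 6 = m'.nat 6 ∧ (∀ a < 6, m₁.nat a = m.nat a) ∧
        m₁.real 0 = m.real 0 ∧ m₁.real 1 = m.real 1 ∧ m₁.real 2 = m'.real 2 ∧
        m₁.real 6 0 = ∑ j' ∈ Finset.range j, rowWeight O.z O.prob O.present 0 i j')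
        ?_ ?_ ?_).seq fun m₁ h₁ => Triple.rset ?_)) ?_
    · refine ⟨by simp, by simp, fun a ha => ?_, by simp [hr0], by simp [hr1], by simp, by simp⟩
      simp [Function.update_of_ne (show a ≠ 7 by omega), hn a ha]
    · exact fun j m₁ h => ⟨h.1, rfl⟩
    · rintro j m₁ - ⟨hj, h6, hn₁, hr0₁, hr1₁, hr2₁, hs⟩
      refine Triple.weaken (Triple.ite (b := 15) (fun hp => Triple.weaken (Triple.rvar ?_) ?_)
        fun hp => Triple.weaken (Triple.rvar ?_) ?_) ?_
      · simp [hj, h6, hi] at hp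
        refine ⟨by simp [hj], by simp, by simp [h6], fun a ha => ?_, by simp [hr0₁],
          by simp [hr1₁], by simp [hr2₁], ?_⟩
        · simp [Function.update_of_ne (show a ≠ 7 by omega), hn₁ a ha]
        · simp [Finset.sum_range_succ, hs, hj, h6, hi, rowWeight, hp]
      · simp
      · simp [hj, h6, hi] at hp
        refine ⟨by simp [hj], by simp, by simp [h6], fun a ha => ?_, by simp [hr0₁],
          by simp [hr1₁], by simp [hr2₁], ?_⟩
        · simp [Function.update_of_ne (show a ≠ 7 by omega), hn₁ a ha]
        · simp [Finset.sum_range_succ, hs, hj, h6, hi, rowWeight, hp, hr2₁, hr2 i le_rfl]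
      · simp
      · simp
    · obtain ⟨-, h6, hn₁, hr0₁, hr1₁, hr2₁, hs⟩ := h₁
      refine ⟨by simp [h6, hi], by simp, fun a ha => ?_, by simp [hr0₁], by simp [hr1₁],
        fun k hk => ?_⟩
      · simp [Function.update_of_ne ha.ne, hn₁ a ha]
      · simp only [Mem.setNat_real, Mem.setReal_real, Function.update_self, NExp.eval,
          NExp.eval_var, RExp.eval_var, h6, hi]
        rcases Nat.le_succ_iff.1 hk with hk' | rfl
        · rw [Function.update_of_ne (by omega), hr2₁, hr2 k hk']
        · rw [Function.update_self, hs, sum_rowWeight_zero]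
    · simp
      omega
  · exact fun m' h => h.2
  · simp
    ring_nf
    omega

/-- Reals cannot be rounded, so `⌈1/ε⌉` is found by counting up, at a cost of order `1/ε`. -/
theorem triple_computeCeil (hε : 0 < O.eps) (m : Mem) :
    Triple O E computeCeil m (⌈1 / O.eps⌉₊ * 20 + 20) fun m' =>
      m' = m.setNat 4 0 ⌈1 / O.eps⌉₊ := by
  intro k B e hk
  have key : ∀ i j, j + i = ⌈1 / O.eps⌉₊ → Achieves O E
      (.while (.not (.rle (.const 1) (.mul .eps (.cast (.var 4)))))
        (.nvar 4 (.add (.var 4) (.const 1))) :: k) (m.setNat 4 0 j) (B + (i * 20 + 9)) e := by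
    intro i
    induction i with
    | zero =>
      intro j hj
      obtain rfl : j = ⌈1 / O.eps⌉₊ := by omega
      refine Achieves.mono (Achieves.while_false ?_ (hk _ rfl)) (by simp)
      have := Nat.le_ceil (1 / O.eps)
      rw [div_le_iff₀ hε] at this
      simpa [mul_comm] using this
    | succ i ih =>
      intro j hj
      have h1 := Nat.lt_ceil.1 (show j < ⌈1 / O.eps⌉₊ by omega)
      rw [lt_div_iff₀ hε] at h1
      refine Achieves.mono (Achieves.while_true (by simpa [mul_comm] using h1) (Achieves.nset ?_
        (B := B + (i * 20 + 9)))) (by simp; omega)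
      have := ih (j + 1) (by omega)
      simpa [Mem.setNat, Cmd.nvar] using this
  refine Achieves.mono (Achieves.seq (Achieves.nset (key ⌈1 / O.eps⌉₊ 0 (by omega)))) ?_
  simp only [NExp.cost]
  omega

theorem triple_accumulate (m : Mem) :
    Triple O E accumulate m (m.nat 0 0 * 30 + 20) fun m' => (∀ a ≠ 8, m'.nat a = m.nat a) ∧
      (∀ a ≠ 0, m'.real a = m.real a) ∧ ∀ w, m'.real 0 w =
        m.real 0 w + if w < m.nat 0 0 then m.real 1 w / m.nat 5 0 else 0 := by
  refine Triple.mono (Triple.forLoop (N := m.nat 0 0) (b := 15) (fun i m' => m'.nat 8 0 = i ∧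
    (∀ a ≠ 8, m'.nat a = m.nat a) ∧ (∀ a ≠ 0, m'.real a = m.real a) ∧ ∀ w, m'.real 0 w =
      m.real 0 w + if w < i then m.real 1 w / m.nat 5 0 else 0) ?_ ?_ ?_) ?_ ?_
  · exact ⟨by simp, fun a ha => by simp [ha], fun a ha => by simp, by simp⟩
  · rintro i m' ⟨hi, hn, -⟩
    exact ⟨hi, by simp [hn]⟩
  · rintro i m' - ⟨hi, hn, hr, hw⟩
    refine Triple.weaken (Triple.rset ⟨by simp [hi], by simp, fun a ha => by simp [ha, hn],
      fun a ha => by simp [ha, hr], fun w => ?_⟩) ?_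
    · rcases lt_trichotomy w i with h | rfl | h
      · simp [hi, h.ne, hw, h, h.trans (Nat.lt_succ_self i)]
      · simp [hi, hw, hr, hn]
      · simp [hi, h.ne', hw, h.not_gt, show ¬ w < i + 1 by omega]
    · simp
  · exact fun m' h => h.2
  · simp
    ring_nf
    omega

theorem triple_moveCenter (m : Mem) :
    Triple O E moveCenter m (m.nat 0 0 * 30 + 40) fun m' =>
      (∀ a, a ≠ 1 → a ≠ 2 → a ≠ 8 → m'.nat a = m.nat a) ∧ (∀ a ≠ 1, m'.real a = m.real a) ∧
      m'.nat 1 = Function.update (m.nat 1) (m.nat 9 0) (m.nat 16 0) ∧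
      m'.nat 2 = Function.update (m.nat 2) (m.nat 9 0) (m.nat 17 0) ∧
      m'.real 1 = Function.update (fun w => (if w < m.nat 0 0 then 1 - m.real 7 0 else 1) *
        m.real 1 w) (m.nat 9 0) (m.real 7 0) := by
  refine Triple.weaken (Triple.nset_seq (Triple.nset_seq ((Triple.forLoop (N := m.nat 0 0)
    (b := 15) (fun i m' => m'.nat 8 0 = i ∧
    (∀ a, a ≠ 1 → a ≠ 2 → a ≠ 8 → m'.nat a = m.nat a) ∧ (∀ a ≠ 1, m'.real a = m.real a) ∧
      m'.nat 1 = Function.update (m.nat 1) (m.nat 9 0) (m.nat 16 0) ∧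
      m'.nat 2 = Function.update (m.nat 2) (m.nat 9 0) (m.nat 17 0) ∧
      ∀ w, m'.real 1 w = (if w < i then 1 - m.real 7 0 else 1) * m.real 1 w)
      ?_ ?_ ?_).seq fun m₁ h₁ => Triple.rset ?_))) ?_
  · exact ⟨by simp, fun a h1 h2 h8 => by simp [h1, h2, h8], fun a ha => by simp, by simp, by simp,
      by simp⟩
  · rintro i m' ⟨hi, hn, -⟩
    exact ⟨hi, by simp [hn]⟩
  · rintro i m' - ⟨hi, hn, hr, hn1, hn2, hw⟩
    refine Triple.weaken (Triple.rset ⟨by simp [hi], by simp,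
      fun a h1 h2 h8 => by simp [h8, hn a h1 h2 h8], fun a ha => by simp [ha, hr], by simp [hn1],
      by simp [hn2], fun w => ?_⟩) ?_
    · rcases lt_trichotomy w i with h | rfl | h
      · simp [hi, h.ne, hw, h, h.trans (Nat.lt_succ_self i)]
      · simp [hi, hw, hr]
      · simp [hi, h.ne', hw, h.not_gt, show ¬ w < i + 1 by omega]
    · simp
  · obtain ⟨-, hn, hr, hn1, hn2, hw⟩ := h₁
    refine ⟨fun a h1 h2 h8 => by simp [hn a h1 h2 h8], fun a ha => by simp [ha, hr],
      by simp [hn1], by simp [hn2], ?_⟩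
    simp [hn, hr, ← hw]
  · simp
    ring_nf
    omega

theorem triple_sumExcess {H : Type*} [NormedAddCommGroup H] [InnerProductSpace ℝ H]
    {v : ℕ → ℕ → H} (hker : ∀ i j k l, O.ker i j k l = inner ℝ (v i j) (v k l)) (m : Mem)
    (hm : m.real 25 0 = ‖listSum v m 1‖ ^ 2) :
    Triple O E sumExcess m (O.n * (O.z * (m.nat 0 0 * (O.kerCost + 40) + O.kerCost + 150) + 50) + 50)
      fun m' => Agree 6 m m' ∧ m'.real 8 0 = m.real 16 0 ∧
        m'.real 9 0 = ∑ k ∈ Finset.range O.n, ∑ j ∈ Finset.range O.z,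
          O.prob k j * excess O.present v (listSum v m 1) (m.real 16 0) k j := by
  set c := listSum v m 1 with hc
  set τ := m.real 16 0 with hτ
  refine Triple.mono (Triple.rvar_seq (Triple.rvar_seq (Triple.forLoop (N := O.n)
    (b := O.z * (m.nat 0 0 * (O.kerCost + 40) + O.kerCost + 150) + 20) (fun i m' =>
      m'.nat 6 0 = i ∧ Agree 6 m m' ∧ m'.real 8 0 = τ ∧ m'.real 25 0 = ‖c‖ ^ 2 ∧
      m'.real 9 0 = ∑ k ∈ Finset.range i, ∑ j ∈ Finset.range O.z,
          O.prob k j * excess O.present v c τ k j) ?_ ?_ ?_))) ?_ ?_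
    (R := fun m' => m'.nat 6 0 = O.n ∧ Agree 6 m m' ∧ m'.real 8 0 = τ ∧ m'.real 25 0 = ‖c‖ ^ 2 ∧
      m'.real 9 0 = ∑ k ∈ Finset.range O.n, ∑ j ∈ Finset.range O.z,
          O.prob k j * excess O.present v c τ k j)
  · exact ⟨by simp, (((Agree.refl 6 m).setReal (by norm_num) _ _).setReal (by norm_num) _ _).setNat
      (by norm_num) _ _, by simp [hτ], by simp [hm], by simp⟩
  · exact fun i m' h => ⟨h.1, rfl⟩
  · rintro i m' - ⟨hi, h, h8, h25, h9⟩
    refine Triple.mono (Triple.forLoop (N := O.z)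
      (b := m.nat 0 0 * (O.kerCost + 40) + O.kerCost + 130) (fun j m₁ =>
      m₁.nat 7 0 = j ∧ m₁.nat 6 0 = i ∧ Agree 6 m m₁ ∧ m₁.real 8 0 = τ ∧ m₁.real 25 0 = ‖c‖ ^ 2 ∧
      m₁.real 9 0 = ∑ k ∈ Finset.range i, ∑ j ∈ Finset.range O.z,
          O.prob k j * excess O.present v c τ k j + ∑ j' ∈ Finset.range j,
          O.prob i j' * excess O.present v c τ i j') ?_ ?_ ?_) ?_ ?_
    · exact ⟨by simp, by simp [hi], h.setNat (by norm_num) _ _, by simp [h8], by simp [h25],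
        by simp [h9]⟩
    · exact fun j m₁ h => ⟨h.1, rfl⟩
    · rintro j m₁ - ⟨hj₁, hi₁, h₁, h8₁, h25₁, h9₁⟩
      refine Triple.weaken (Triple.ite (b := m.nat 0 0 * (O.kerCost + 40) + O.kerCost + 110)
        (fun hp => ?_) fun hp => Triple.weaken (Triple.skip ?_) (by omega)) ?_
      · simp [hi₁, hj₁] at hp
        have h2 := (h₁.setNat (show 6 ≤ 25 by norm_num) 0 i).setNat (show 6 ≤ 26 by norm_num) 0 j
        have e3 := h2.listSum (v := v) (by norm_num) (show 1 < 6 by norm_num)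
        refine Triple.weaken (Triple.nvar_seq (Triple.nvar_seq ((triple_distTo hker _ ?_).seq
          fun m₃ h₃ => Triple.weaken (Triple.ite (b := 20) (fun hle => Triple.weaken
            (Triple.rvar ?_) ?_) fun hle => Triple.weaken (Triple.skip ?_) (by omega))
            (b' := 30) ?_))) ?_
        · simp [hi₁, hj₁, e3, h25₁, hc]
        all_goals try
          simp [hi₁, hj₁] at h₃
          rw [e3, ← hc] at h₃
          have h3 : Agree 6 m m₃ := h2.trans (h₃.1.mono (by norm_num))
          have e6 : m₃.nat 6 0 = i := by simp [h₃.1.nat, hi₁]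
          have e7 : m₃.nat 7 0 = j := by simp [h₃.1.nat, hj₁]
          have e8 : m₃.real 8 0 = τ := by simp [h₃.1.real, h8₁]
          have e9 := h9₁
          rw [show m₁.real 9 0 = m₃.real 9 0 by simp [h₃.1.real]] at e9
          have e25 : m₃.real 25 0 = ‖c‖ ^ 2 := by simp [h₃.1.real, h25₁]
        · simp [e8, h₃.2] at hle
          refine ⟨by simp [e7], by simp, by simp [e6], (h3.setReal (by norm_num) _ _).setNat
            (by norm_num) _ _, by simp [e8], by simp [e25], ?_⟩
          simp [e6, e7, e8, e9, h₃.2, Finset.sum_range_succ, excess, hp, hle, add_assoc]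
        · simp
        · simp [e8, h₃.2] at hle
          refine ⟨by simp [e7], by simp, by simp [e6], h3.setNat
            (by norm_num) _ _, by simp [e8], by simp [e25], ?_⟩
          simp [e9, Finset.sum_range_succ, excess, hp, hle.not_ge]
        · simp
        · simp [h₁.nat]
      · simp [hi₁, hj₁] at hp
        refine ⟨hj₁, by simp, by simp [hi₁], h₁.setNat (by norm_num) _ _, by simp [h8₁],
          by simp [h25₁], ?_⟩
        simp [h9₁, Finset.sum_range_succ, excess, hp]
      · simp
    · rintro m₁ ⟨-, hi₁, h₁, h8₁, h25₁, h9₁⟩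
      refine ⟨hi₁, by simp, h₁.setNat (by norm_num) _ _, by simp [h8₁], by simp [h25₁], ?_⟩
      rw [Finset.sum_range_succ]
      simpa using h9₁
    · simp
      ring_nf
      omega
  · exact fun m' h => ⟨h.2.1, h.2.2.1, h.2.2.2.2⟩
  · simp
    ring_nf
    omega

end Subroutines

/-! ### The descent loop -/

/-- The memory `m` holds the current center `c` and the output `s`; the list has `T + 1` entries, of
which those from `slot` on are unused. -/
structure State {d n z : ℕ} (D : ProbInput d n z) {H : Type*} [NormedAddCommGroup H]
    [InnerProductSpace ℝ H] (φ : EuclideanSpace ℝ (Fin d) → H) (T k slot : ℕ) (c s : H) (m : Mem) :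
    Prop where
  len : m.nat 0 0 = T + 1
  ceil : m.nat 4 0 = k
  steps : m.nat 5 0 = T
  hits : ∀ i ≤ n, m.real 2 i = hit z D.prob? D.present? i
  zero : ∀ w, slot ≤ w → m.real 0 w = 0 ∧ m.real 1 w = 0
  cur : listSum (D.point φ) m 1 = c
  out : listSum (D.point φ) m 0 = s

/-- The descent: in each step, draw a realization and move towards its farthest point. -/
def descent : Cmd :=
  .forLoop 3 (.var 5) (.seq accumulate (.seq draw (.seq (.nvar 9 (.add (.var 3) (.const 1)))
    (.seq (.rvar 7 (.div (.var 3) (.var 16))) moveCenter))))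

/-- A bound on the running time of `draw`. -/
def drawCost (d n z T : ℕ) : ℕ :=
  n * (z * 100 + 80) + (T + 1) * ((T + 1) * (d + 40) + 70) +
    n * ((T + 1) * (d + 40) + d + 140) + 100

section Descent

variable {d n z : ℕ} {D : ProbInput d n z} {H : Type*} [NormedAddCommGroup H]
  [InnerProductSpace ℝ H] {K : EuclideanSpace ℝ (Fin d) → EuclideanSpace ℝ (Fin d) → ℝ}
  {φ : EuclideanSpace ℝ (Fin d) → H} {ε : ℝ} {E : Mem → Prop} {T k slot : ℕ} {c s : H} {m m' : Mem}

theorem State.of_eq (h : State D φ T k slot c s m)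
    (hn : ∀ a < 6, a ≠ 3 → m'.nat a = m.nat a) (hr : ∀ a < 3, m'.real a = m.real a) :
    State D φ T k slot c s m' := by
  have n0 := hn 0 (by norm_num) (by norm_num)
  have n1 := hn 1 (by norm_num) (by norm_num)
  have n2 := hn 2 (by norm_num) (by norm_num)
  have r0 := hr 0 (by norm_num)
  have r1 := hr 1 (by norm_num)
  refine ⟨by rw [n0, h.len], by rw [hn 4 (by norm_num) (by norm_num), h.ceil],
    by rw [hn 5 (by norm_num) (by norm_num), h.steps], by rw [hr 2 (by norm_num)]; exact h.hits,
    by rw [r0, r1]; exact h.zero, ?_, ?_⟩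
  · rw [← h.cur]
    simp only [listSum, n0, n1, n2, r1]
  · rw [← h.out]
    simp only [listSum, n0, n1, n2, r0]

theorem State.of_agree {l : ℕ} (h : State D φ T k slot c s m) (ha : Agree l m m')
    (hl : 6 ≤ l := by norm_num) : State D φ T k slot c s m' :=
  h.of_eq (fun _ h6 _ => ha.nat (by omega)) fun _ h3 => ha.real (by omega)

theorem State.triple_accumulate (h : State D φ T k slot c s m) :
    Triple (D.oracle K ε) E accumulate m ((T + 1) * 30 + 20) fun m' =>
      State D φ T k slot c (s + (T : ℝ)⁻¹ • c) m' ∧ m'.nat 3 = m.nat 3 ∧ m'.real 3 = m.real 3 := by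
  refine (PSVDD.triple_accumulate m).mono ?_ (by rw [h.len])
  rintro m' ⟨hn, hr, hw⟩
  rw [h.len, h.steps] at hw
  refine ⟨⟨by rw [hn 0 (by norm_num), h.len], by rw [hn 4 (by norm_num), h.ceil],
    by rw [hn 5 (by norm_num), h.steps], by rw [hr 2 (by norm_num)]; exact h.hits,
    fun w hsw => ?_, ?_, ?_⟩, hn 3 (by norm_num), hr 3 (by norm_num)⟩
  · have := h.zero w hsw
    exact ⟨by simp [hw, this.1, this.2], by rw [hr 1 (by norm_num), this.2]⟩
  · rw [← h.cur]
    simp [listSum, hn, hr]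
  · rw [← h.cur, ← h.out]
    simp only [listSum, hn 0 (by norm_num), hn 1 (by norm_num), hn 2 (by norm_num), h.len, hw,
      Finset.smul_sum, ← Finset.sum_add_distrib]
    refine Finset.sum_congr rfl fun w hw' => ?_
    rw [if_pos (Finset.mem_range.1 hw'), add_smul, smul_smul, div_eq_inv_mul]

/-- The entry `slot` has coefficient zero both in the center and in the output, so overwriting its
location changes neither; each move uses up one fresh entry. -/
theorem State.triple_moveCenter (h : State D φ T k slot c s m) (hs : slot ≤ T)
    (h9 : m.nat 9 0 = slot) :
    Triple (D.oracle K ε) E moveCenter m ((T + 1) * 30 + 40) fun m' =>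
      State D φ T k (slot + 1) (towards (m.real 7 0) c (D.point φ (m.nat 16 0) (m.nat 17 0))) s m' ∧
        m'.nat 3 = m.nat 3 ∧ m'.real 3 = m.real 3 := by
  refine (PSVDD.triple_moveCenter m).mono ?_ (by rw [h.len])
  rintro m' ⟨hn, hr, h1, h2, hγ⟩
  rw [h9] at h1 h2 hγ
  rw [h.len] at hγ
  have hmem : slot ∈ Finset.range (T + 1) := Finset.mem_range.2 (by omega)
  refine ⟨⟨by rw [hn 0 (by norm_num) (by norm_num) (by norm_num), h.len],
    by rw [hn 4 (by norm_num) (by norm_num) (by norm_num), h.ceil],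
    by rw [hn 5 (by norm_num) (by norm_num) (by norm_num), h.steps],
    by rw [hr 2 (by norm_num)]; exact h.hits, fun w hsw => ?_, ?_, ?_⟩,
    hn 3 (by norm_num) (by norm_num) (by norm_num), hr 3 (by norm_num)⟩
  · have := h.zero w (by omega)
    refine ⟨by rw [hr 0 (by norm_num), this.1], ?_⟩
    rw [hγ, Function.update_of_ne (by omega), this.2, mul_zero]
  · simp only [listSum, hn 0 (by norm_num) (by norm_num) (by norm_num), h1, h2, hγ, h.len, towards,
      ← h.cur]
    rw [← Finset.sum_erase_add _ _ hmem, ← Finset.sum_erase_add (Finset.range (T + 1))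
      (fun w => m.real 1 w • D.point φ (m.nat 1 w) (m.nat 2 w)) hmem]
    simp only [Function.update_self, (h.zero slot le_rfl).2, zero_smul, add_zero, Finset.smul_sum]
    congr 1
    refine Finset.sum_congr rfl fun w hw => ?_
    rw [Finset.mem_erase, Finset.mem_range] at hw
    rw [Function.update_of_ne hw.1, Function.update_of_ne hw.1, Function.update_of_ne hw.1,
      if_pos hw.2, smul_smul]
  · rw [← h.out]
    simp only [listSum, hn 0 (by norm_num) (by norm_num) (by norm_num), h1, h2,
      hr 0 (by norm_num)]
    refine Finset.sum_congr rfl fun w _ => ?_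
    rcases eq_or_ne w slot with rfl | hw
    · simp [(h.zero w le_rfl).1]
    · rw [Function.update_of_ne hw, Function.update_of_ne hw]

/-- Connects the abstract history `x` with the memory. The output is updated before the move, so at
the end it is the average of `x 0, …, x (T - 1)`. -/
theorem valTriple_descent
    (hker : ∀ i j k l, (D.oracle K ε).ker i j k l = inner ℝ (D.point φ i j) (D.point φ k l))
    (hpos : 0 < D.hitProb) {Q : H → Prop} {val : ℕ → (ℕ → H) → ℝ}
    (hm : State D φ T k 1 c 0 m) (hval : D.DescentBound φ (m.real 3 0) T Q val) {e : ℝ}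
    {x : ℕ → H} (hx : x 0 = c) (he : e ≤ val 0 x) :
    ValTriple (D.oracle K ε) E descent m e (T * (drawCost d n z T + (T + 1) * 60 + 200) + 20)
      fun m' e' => e' ≤ 0 ∨ e' ≤ 1 ∧ Q (listSum (D.point φ) m' 0) := by
  set η := m.real 3 0 with hη
  refine ValTriple.mono (ValTriple.forLoop (N := T) (b := drawCost d n z T + (T + 1) * 60 + 150)
    (fun t m' e' => m'.nat 3 0 = t ∧ m'.real 3 0 = η ∧ ∃ c' s', State D φ T k (t + 1) c' s' m' ∧
      (e' ≤ 0 ∨ ∃ x, c' = x t ∧ s' = (T : ℝ)⁻¹ • ∑ s ∈ Finset.range t, x s ∧ e' ≤ val t x))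
      ?_ ?_ ?_) ?_ ?_
  · refine ⟨by simp, by simp [hη], c, 0, hm.of_eq (fun a _ h3 => by simp [h3]) fun a _ => by simp,
      Or.inr ⟨x, hx.symm, by simp, he⟩⟩
  · rintro t m' e' ⟨ht, -, c', s', h, -⟩
    exact ⟨ht, h.steps⟩
  · rintro t m' e' htT ⟨ht, hη', c', s', h, he'⟩
    -- For a lost run `u = 0`; otherwise `u` comes from `DescentBound.step`, and the history is
    -- extended by the new center.
    obtain ⟨u, hu, hu'⟩ : ∃ u : (Fin n → Fin z) → ℝ, e' ≤ ∑ g, D.condWeight g * u g ∧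
        ∀ g, ∀ i : Fin n, D.present? i (g i) → ‖c' - D.point φ i (g i)‖ = D.far φ c' g →
        (u g ≤ 0 ∨ ∃ x, towards (η / D.far φ c' g) c' (D.point φ i (g i)) = x (t + 1) ∧
          s' + (T : ℝ)⁻¹ • c' = (T : ℝ)⁻¹ • ∑ s ∈ Finset.range (t + 1), x s ∧
          u g ≤ val (t + 1) x) := by
      rcases he' with he' | ⟨x, rfl, rfl, he'⟩
      · exact ⟨fun _ => 0, by simpa using he', fun g i _ _ => Or.inl le_rfl⟩
      · obtain ⟨u, hu, hu'⟩ := hval.step t htT x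
        refine ⟨u, he'.trans hu, fun g i hi hg => Or.inr ⟨_, ?_, ?_, hu' g i hi hg⟩⟩
        · rw [Function.update_self, hg]
        · rw [Finset.sum_congr rfl fun s hs => Function.update_of_ne
            (Finset.mem_range.1 hs).ne _ _, Finset.sum_range_succ, smul_add]
    refine ValTriple.weaken (ValTriple.triple_seq h.triple_accumulate fun m₁ h₁ =>
      ValTriple.seq (b₁ := drawCost d n z T) (ValTriple.weaken (ValTriple.mono_val
        (valTriple_draw D hker hpos u m₁ h₁.1.hits) hu) ?_) fun m₂ e₂ h₂ => ValTriple.nvar_seq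
      (ValTriple.rvar_seq (ValTriple.mono (ValTriple.of_triple (State.triple_moveCenter
        (φ := φ) (k := k) (slot := t + 1) (c := c') (s := s' + (T : ℝ)⁻¹ • c') ?_ (show t + 1 ≤ T by omega) ?_)) ?_ le_rfl))) ?_
    · rw [h₁.1.len, drawCost]
    · exact ((h₁.1.of_agree h₂.1).of_agree ((Agree.refl 7 m₂).setNat (by norm_num) _ _)).of_agree
        ((Agree.refl 7 _).setReal (by norm_num) _ _)
    · simp [h₂.1.nat, h₁.2.1, ht]
    · rintro m₃ e₃ ⟨⟨h₃, h3n, h3r⟩, rfl⟩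
      have h3n' : m₃.nat 3 = m'.nat 3 := by
        rw [h3n]
        simp [h₂.1.nat, h₁.2.1]
      have h3r' : m₃.real 3 = m'.real 3 := by
        rw [h3r]
        simp [h₂.1.real, h₁.2.2]
      refine ⟨by rw [h3n', ht], by simp, by simp [h3r', hη'], _, _,
        h₃.of_eq (fun a _ ha => by simp [ha]) fun a _ => by simp, ?_⟩
      obtain ⟨h21, -, h2⟩ := h₂
      rw [h₁.1.cur] at h2
      rcases h2 with h2 | ⟨g, i, hi, h16, h17, hr16, hg, he₂⟩
      · exact Or.inl h2
      · rcases hu' g i hi hg with h0 | ⟨x, hx1, hx2, hx3⟩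
        · exact Or.inl (he₂.trans h0)
        · refine Or.inr ⟨x, ?_, hx2, he₂.trans hx3⟩
          rw [← hx1]
          simp [h16, h17, hr16, h21.real, h₁.2.2, hη']
    · simp
      omega
  · rintro m' e' ⟨-, -, c', s', h, he'⟩
    rcases he' with he' | ⟨x, -, hs, he'⟩
    · exact Or.inl he'
    · rcases le_or_gt (val T x) 0 with h0 | h0
      · exact Or.inl (he'.trans h0)
      · refine Or.inr ⟨he'.trans (hval.le_one x), ?_⟩
        rw [h.out, hs]
        exact hval.good x h0
  · simp
    ring_nf
    omega

end Descent

/-! ### The whole program -/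

/-- Start at a point of a realization. -/
def firstPhase : Cmd :=
  .seq draw (.seq (.nvar 9 (.const 0)) (.seq (.rvar 7 (.const 1)) moveCenter))

/-- Compute the step length. -/
def scalePhase : Cmd :=
  .seq draw (.seq sumExcess (.rvar 3 (.div (.add (.var 8) (.div (.var 9) (.get 2 .n)))
    (.mul (.const 720) (.cast (.var 4))))))

/-- The part of the program that is executed if the realization can be nonempty. -/
def mainPhase : Cmd := .seq firstPhase (.seq scalePhase descent)

/-- The program. -/
def program : Cmd :=
  .seq computeHits (.ite (.rle (.get 2 .n) (.const 0)) .skip (.seq computeCeil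
    (.seq (.nvar 5 (.mul (.const 368640) (.mul (.var 4) (.var 4))))
      (.seq (.nvar 0 (.add (.var 5) (.const 1))) mainPhase))))

/-- A bound on the running time of `mainPhase`. -/
def mainCost (d n z T : ℕ) : ℕ :=
  drawCost d n z T + ((T + 1) * 30 + 60) +
    (drawCost d n z T + n * (z * ((T + 1) * (d + 40) + d + 150) + 50) + 80) +
    (T * (drawCost d n z T + (T + 1) * 60 + 200) + 20) + 10

theorem center_eq_listSum {d n z : ℕ} (D : ProbInput d n z) {H : Type*} [NormedAddCommGroup H]
    [InnerProductSpace ℝ H] (φ : EuclideanSpace ℝ (Fin d) → H) (m : Mem) :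
    center D φ m = listSum (D.point φ) m 0 := by
  refine Finset.sum_congr rfl fun w _ => ?_
  unfold ProbInput.point
  split <;> simp_all

/-- Absent or out-of-range locations have kernel value `0` and image `0`, so unused list entries
need no separate treatment. -/
theorem ker_oracle {d n z : ℕ} (D : ProbInput d n z) {H : Type*} [NormedAddCommGroup H]
    [InnerProductSpace ℝ H] {K : EuclideanSpace ℝ (Fin d) → EuclideanSpace ℝ (Fin d) → ℝ}
    {φ : EuclideanSpace ℝ (Fin d) → H} (hK : IsFeatureMap K φ) (ε : ℝ) (i j k l : ℕ) :
    (D.oracle K ε).ker i j k l = inner ℝ (D.point φ i j) (D.point φ k l) := by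
  simp only [ProbInput.oracle, ProbInput.point]
  cases D.loc? i j <;> cases D.loc? k l <;> simp [hK _ _]

-- The two events have probability at least `1/2` and `7/8`, hence jointly at least `3/8`, and `3/8
-- · 7/8 ≥ 1/4`. The reward `7/8` is the value of the descent that follows.
open Classical in
theorem quarter_le_of_goodScale {d n z : ℕ} {D : ProbInput d n z} {H : Type*}
    [NormedAddCommGroup H] {φ : EuclideanSpace ℝ (Fin d) → H} (hpos : 0 < D.hitProb) (c : H) :
    1 / 4 ≤ ∑ g, D.condWeight g *
      (if (∑ g', D.condWeight g' * (if D.far φ c g < D.far φ c g' then 1 else 0) ≤ (1 / 2 : ℝ)) ∧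
        D.far φ c g ≤ 8 * D.condCost φ c then 7 / 8 else 0) := by
  have h1 := half_le_sum_ite_median (D.far φ c) D.condWeight_nonneg (D.sum_condWeight hpos)
  have h2 := sum_ite_le_of_mean D.condWeight_nonneg (D.sum_condWeight hpos)
    (D.far_nonneg φ c) (le_refl (D.condCost φ c))
  have h3 := D.sum_condWeight hpos
  have : ∑ g, D.condWeight g * (7 / 8 *
      ((if (∑ g', D.condWeight g' * (if D.far φ c g < D.far φ c g' then 1 else 0) ≤ (1 / 2 : ℝ))
        then 1 else 0) + (if D.far φ c g ≤ 8 * D.condCost φ c then 1 else 0) - 1)) ≤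
      ∑ g, D.condWeight g *
      (if (∑ g', D.condWeight g' * (if D.far φ c g < D.far φ c g' then 1 else 0) ≤ (1 / 2 : ℝ)) ∧
        D.far φ c g ≤ 8 * D.condCost φ c then 7 / 8 else 0) := by
    refine Finset.sum_le_sum fun g _ => mul_le_mul_of_nonneg_left ?_ (D.condWeight_nonneg g)
    by_cases ha : ∑ g', D.condWeight g' * (if D.far φ c g < D.far φ c g' then 1 else 0) ≤ (1 / 2 : ℝ)
      <;> by_cases hb : D.far φ c g ≤ 8 * D.condCost φ c <;>
      simp only [ha, hb, and_self, and_true, and_false, if_true, if_false] <;> norm_num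
  refine le_trans ?_ this
  simp only [mul_left_comm _ (7 / 8 : ℝ), mul_sub, mul_add, Finset.sum_sub_distrib,
    Finset.sum_add_distrib, ← Finset.mul_sum, mul_one]
  rw [← Finset.sum_mul, h3]
  linarith

section Main

variable {d n z : ℕ} {D : ProbInput d n z} {H : Type*} [NormedAddCommGroup H]
  [InnerProductSpace ℝ H] {K : EuclideanSpace ℝ (Fin d) → EuclideanSpace ℝ (Fin d) → ℝ}
  {φ : EuclideanSpace ℝ (Fin d) → H} {ε : ℝ} {E : Mem → Prop} {T k : ℕ} {m : Mem} {y : H}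

theorem exists_descentBound (hpos : 0 < D.hitProb) (hε : 0 < ε) (hk : 1 ≤ ε * k)
    (hT : T = 368640 * (k * k)) (hmin : ∀ c, D.condCost φ y ≤ D.condCost φ c) {c : H}
    (hc : ‖c - y‖ ≤ 8 * D.condCost φ y) {η : ℝ} (hη : D.condCost φ y ≤ η * (720 * k))
    (hη' : η * (720 * k) ≤ 90 * D.condCost φ y) :
    ∃ val, D.DescentBound φ η T (fun c => D.condCost φ c ≤ (1 + ε) * D.condCost φ y) val ∧
      7 / 8 ≤ val 0 (fun _ => c) := by
  have hk0 : (0 : ℝ) < k := by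
    rcases Nat.eq_zero_or_pos k with rfl | h'
    · norm_num at hk
    · exact_mod_cast h'
  rcases (D.condCost_nonneg φ y).eq_or_lt with h0 | h0
  -- With optimal cost zero, the two bounds on `η` force step length `0`, and the start is at
  -- distance `0` from `y`.
  · have hη0 : η = 0 := by
      rw [← h0, mul_zero] at hη'
      rw [← h0] at hη
      exact (mul_eq_zero.1 (le_antisymm hη' hη)).resolve_right (by positivity)
    rw [← h0, mul_zero] at hc
    have hk' : 0 < k := by exact_mod_cast hk0
    obtain ⟨val, hval, h⟩ := ProbInput.DescentBound.of_condCost_eq_zero D φ hpos (T := T) (ε := ε)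
      (by rw [hT]; positivity) h0.symm
    exact ⟨val, hη0 ▸ hval, h _ (sub_eq_zero.1 (norm_le_zero_iff.1 hc))⟩
  · obtain ⟨val, hval, h⟩ :=
      ProbInput.DescentBound.of_condCost_pos D φ hpos hε hk hT hmin h0 hη hη'
    exact ⟨val, hval, h _ hc⟩

theorem valTriple_firstPhase
    (hker : ∀ i j k l, (D.oracle K ε).ker i j k l = inner ℝ (D.point φ i j) (D.point φ k l))
    (hpos : 0 < D.hitProb) (y : H) (hm : State D φ T k 0 0 0 m) :
    ValTriple (D.oracle K ε) E firstPhase m (1 / 8) (drawCost d n z T + ((T + 1) * 30 + 60))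
      fun m' e' => ∃ c, State D φ T k 1 c 0 m' ∧
        (e' ≤ 0 ∨ e' ≤ 1 / 4 ∧ ‖c - y‖ ≤ 8 * D.condCost φ y) := by
  classical
  set F := D.condCost φ y with hF
  -- Markov gives `7/8`, and the later phases are worth `1/4`. Any point of such a realization is
  -- within `8F` of `y`; the program takes the one farthest from the zero center.
  have hu : 1 / 8 ≤ ∑ g, D.condWeight g * (if D.far φ y g ≤ 8 * F then 1 / 4 else 0) := by
    have := sum_ite_le_of_mean D.condWeight_nonneg (D.sum_condWeight hpos) (D.far_nonneg φ y)
      (le_refl F)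
    have e : ∀ g, D.condWeight g * (if D.far φ y g ≤ 8 * F then (1 / 4 : ℝ) else 0) =
        1 / 4 * (D.condWeight g * (if D.far φ y g ≤ 8 * F then 1 else 0)) := fun g => by
      split_ifs <;> ring
    simp only [e, ← Finset.mul_sum]
    linarith
  have hdraw := ValTriple.mono_val (valTriple_draw (E := E) D hker hpos _ m hm.hits) hu
  rw [hm.len, hm.cur] at hdraw
  refine ValTriple.weaken (ValTriple.seq hdraw fun m₁ e₁ h₁ => ValTriple.nvar_seq
    (ValTriple.rvar_seq (ValTriple.mono (ValTriple.of_triple (State.triple_moveCenter (φ := φ)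
      (k := k) (slot := 0) (c := 0) (s := 0) ?_ (Nat.zero_le T) ?_)) ?_ le_rfl))) ?_
  · exact ((hm.of_agree h₁.1).of_agree ((Agree.refl 7 m₁).setNat (by norm_num) _ _)).of_agree
      ((Agree.refl 7 _).setReal (by norm_num) _ _)
  · simp
  · rintro m₂ e₂ ⟨⟨h₂, -⟩, rfl⟩
    refine ⟨_, h₂, ?_⟩
    rcases h₁.2.2 with h | ⟨g, i, hi, h16, h17, -, -, he⟩
    · exact Or.inl h
    · split_ifs at he with hg
      · refine Or.inr ⟨he, ?_⟩
        have : towards (1 : ℝ) 0 (D.point φ i (g i)) = D.point φ i (g i) := by simp [towards]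
        simp only [Mem.setReal_real, Function.update_self, RExp.eval, Rat.cast_one,
          Mem.setReal_nat, Mem.setNat_nat, ne_eq, Nat.reduceEqDiff, not_false_eq_true,
          Function.update_of_ne, h16, h17, this]
        rw [norm_sub_rev]
        exact (D.norm_sub_le_far φ y g i hi).trans hg
      · exact Or.inl he
  · rw [drawCost]
    simp

theorem valTriple_scalePhase
    (hker : ∀ i j k l, (D.oracle K ε).ker i j k l = inner ℝ (D.point φ i j) (D.point φ k l))
    (hpos : 0 < D.hitProb) (hk : 0 < k) (hmin : ∀ c, D.condCost φ y ≤ D.condCost φ c) {c : H}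
    (hm : State D φ T k 1 c 0 m) {e : ℝ}
    (he : e ≤ 0 ∨ e ≤ 1 / 4 ∧ ‖c - y‖ ≤ 8 * D.condCost φ y) :
    ValTriple (D.oracle K ε) E scalePhase m e
      (drawCost d n z T + n * (z * ((T + 1) * (d + 40) + d + 150) + 50) + 80)
      fun m' e' => State D φ T k 1 c 0 m' ∧ (e' ≤ 0 ∨ e' ≤ 7 / 8 ∧
        ‖c - y‖ ≤ 8 * D.condCost φ y ∧ D.condCost φ y ≤ m'.real 3 0 * (720 * k) ∧
        m'.real 3 0 * (720 * k) ≤ 90 * D.condCost φ y) := by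
  classical
  set F := D.condCost φ y with hF
  obtain ⟨u, hu, hu'⟩ : ∃ u : (Fin n → Fin z) → ℝ, e ≤ ∑ g, D.condWeight g * u g ∧
      ∀ g, u g ≤ 0 ∨ u g ≤ 7 / 8 ∧ ‖c - y‖ ≤ 8 * F ∧ D.far φ c g ≤ 8 * D.condCost φ c ∧
        ∑ g', D.condWeight g' * (if D.far φ c g < D.far φ c g' then 1 else 0) ≤ (1 / 2 : ℝ) := by
    rcases he with he | ⟨he, hc⟩
    · exact ⟨fun _ => 0, by simpa using he, fun g => Or.inl le_rfl⟩
    · refine ⟨_, he.trans (quarter_le_of_goodScale (φ := φ) hpos c), fun g => ?_⟩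
      split_ifs with h
      · exact Or.inr ⟨le_rfl, hc, h.2, h.1⟩
      · exact Or.inl le_rfl
  have hdraw := ValTriple.mono_val (valTriple_draw (E := E) D hker hpos u m hm.hits) hu
  rw [hm.len, hm.cur] at hdraw
  refine ValTriple.weaken (ValTriple.seq hdraw fun m₁ e₁ h₁ => ValTriple.triple_seq
    (b₁ := n * (z * ((T + 1) * (d + 40) + d + 150) + 50) + 50) (Triple.weaken
    (triple_sumExcess hker m₁ ?_) ?_) fun m₂ h₂ => ValTriple.mono
      (ValTriple.of_triple (Triple.rvar (Q := fun m' => m' = m₂.setReal 3 0 _) rfl)) ?_ le_rfl) ?_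
  · rw [h₁.2.1, (hm.of_agree h₁.1).cur]
  · rw [(hm.of_agree h₁.1).len]
    exact le_rfl
  · rintro m₃ e₃ ⟨rfl, rfl⟩
    have hm₁ := hm.of_agree h₁.1
    have hm₂ := hm₁.of_agree h₂.1
    refine ⟨hm₂.of_eq (fun a _ _ => rfl) fun a ha => by simp [ha.ne], ?_⟩
    rcases h₁.2.2 with h | ⟨g, i, hi, h16, h17, hr, hg, he₁⟩
    · exact Or.inl h
    rcases hu' g with h | ⟨h, hc, hfar, hmed⟩
    · exact Or.inl (he₁.trans h)
    have hk0 : (k : ℝ) ≠ 0 := by exact_mod_cast hk.ne'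
    have h9 : m₂.real 9 0 = D.excessSum φ c (D.far φ c g) := by
      rw [h₂.2.2, hm₁.cur, hr]
      rfl
    have hη : (m₂.setReal 3 0 (((RExp.var 8).add ((RExp.var 9).div (.get 2 .n))).div
        ((RExp.const 720).mul (.cast (.var 4))) |>.eval (D.oracle K ε) m₂)).real 3 0 *
        (720 * k) = D.far φ c g + D.excessSum φ c (D.far φ c g) / D.hitProb := by
      have hn : (D.oracle K ε).n = n := rfl
      simp only [Mem.setReal_real, Function.update_self, RExp.eval, NExp.eval, RExp.eval_var,
        NExp.eval_var, hm₂.ceil, h₂.2.1, hr, h9, hn, hm₂.hits n le_rfl, Rat.cast_ofNat]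
      rw [div_mul_cancel₀ _ (by positivity)]
      rfl
    have hτ := D.far_nonneg φ c g
    have hup := D.excessSum_le_condCost φ hpos c hτ hmed
    have hlo := D.condCost_le_excessSum φ hpos c hτ
    -- The cost is 1-Lipschitz, so `c` costs at most `F + 8F = 9F`. The estimate is at most `8 + 2 =
    -- 10` times the cost of `c`, hence at most `90F`.
    have hlip := D.condCost_le_add φ hpos y c
    have hy := hmin c
    refine Or.inr ⟨he₁.trans h, hc, ?_, ?_⟩
    · rw [hη]
      linarith
    · rw [hη]
      linarith
  · rw [drawCost]
    simp
    omega

theorem valTriple_mainPhase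
    (hker : ∀ i j k l, (D.oracle K ε).ker i j k l = inner ℝ (D.point φ i j) (D.point φ k l))
    (hpos : 0 < D.hitProb) (hε : 0 < ε) (hk : 1 ≤ ε * k) (hT : T = 368640 * (k * k))
    (hmin : ∀ c, D.condCost φ y ≤ D.condCost φ c) (hm : State D φ T k 0 0 0 m) :
    ValTriple (D.oracle K ε) E mainPhase m (1 / 8) (mainCost d n z T) fun m' e' =>
      e' ≤ 0 ∨ e' ≤ 1 ∧ D.condCost φ (listSum (D.point φ) m' 0) ≤ (1 + ε) * D.condCost φ y := by
  have hk0 : 0 < k := by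
    rcases Nat.eq_zero_or_pos k with rfl | h'
    · norm_num at hk
    · exact h'
  refine ValTriple.weaken (ValTriple.seq (valTriple_firstPhase hker hpos y hm)
    fun m₁ e₁ ⟨c, h₁, he₁⟩ => ValTriple.seq (valTriple_scalePhase hker hpos hk0 hmin h₁ he₁)
    fun m₂ e₂ ⟨h₂, he₂⟩ => ?_) (b := drawCost d n z T + ((T + 1) * 30 + 60) +
      (drawCost d n z T + n * (z * ((T + 1) * (d + 40) + d + 150) + 50) + 80 +
      (T * (drawCost d n z T + (T + 1) * 60 + 200) + 20) + 1) + 1) ?_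
  · rcases he₂ with he₂ | ⟨he₂, hc, hη, hη'⟩
    -- After a failed start or scale the descent still has to halt in time; the zero bound is valid
    -- for any step length.
    · exact valTriple_descent hker hpos h₂ (val := fun _ _ => 0) (x := fun _ => c)
        (Q := fun c => D.condCost φ c ≤ (1 + ε) * D.condCost φ y)
        ⟨fun t _ x => ⟨fun _ => 0, by simp, fun _ _ _ _ => le_rfl⟩, fun _ => zero_le_one,
          fun _ h => absurd h (lt_irrefl 0)⟩ rfl he₂
    · obtain ⟨val, hval, h⟩ := exists_descentBound hpos hε hk hT hmin hc hη hη'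
      exact valTriple_descent hker hpos h₂ hval rfl (he₂.trans h)
  · rw [mainCost]
    omega

/-- A bound on the running time of `program`. -/
def programCost (d n z k T : ℕ) : ℕ :=
  n * (z * 40 + 60) + (k * 20 + 20) + mainCost d n z T + 100

theorem achieves_program
    (hker : ∀ i j k l, (D.oracle K ε).ker i j k l = inner ℝ (D.point φ i j) (D.point φ k l))
    (hε : 0 < ε) (hy : ∀ c, expectedCost D φ y ≤ expectedCost D φ c) :
    Achieves (D.oracle K ε)
      (fun m => expectedCost D φ (center D φ m) ≤ (1 + ε) * expectedCost D φ y) [program]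
      ⟨fun _ _ => 0, fun _ _ => 0⟩
      (programCost d n z ⌈1 / ε⌉₊ (368640 * (⌈1 / ε⌉₊ * ⌈1 / ε⌉₊))) (1 / 8) := by
  set k := ⌈1 / ε⌉₊ with hk
  set T := 368640 * (k * k) with hT
  have hkε : 1 ≤ ε * k := by
    have := Nat.le_ceil (1 / ε)
    rw [div_le_iff₀ hε] at this
    rwa [mul_comm]
  suffices h : ValTriple (D.oracle K ε)
      (fun m => expectedCost D φ (center D φ m) ≤ (1 + ε) * expectedCost D φ y) program
      ⟨fun _ _ => 0, fun _ _ => 0⟩ (1 / 8) (programCost d n z k T) fun m' e' =>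
        e' ≤ 0 ∨ e' ≤ 1 ∧ expectedCost D φ (center D φ m') ≤ (1 + ε) * expectedCost D φ y by
    refine (h [] 0 fun m' e' h' => ?_).mono (by omega)
    rcases h' with h' | ⟨h', hE⟩
    · exact Achieves.nil_zero.mono_prob h'
    · exact (Achieves.nil_true hE).mono_prob h'
  refine ValTriple.weaken (ValTriple.triple_seq (triple_computeHits _ rfl) fun m₁ h₁ =>
    ValTriple.ite (b := k * 20 + 20 + mainCost d n z T + 60) (fun h0 => ValTriple.weaken
      (ValTriple.skip ?_) (by omega)) fun h0 => ValTriple.weaken (ValTriple.triple_seq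
      (triple_computeCeil hε _) fun m₂ h₂ => ValTriple.nvar_seq
        (ValTriple.nvar_seq (b := mainCost d n z T) ?_)) ?_) ?_
  all_goals try
    obtain ⟨hn₁, hr0, hr1, hr2⟩ := h₁
    have hS : m₁.real 2 n = D.hitProb := hr2 n le_rfl
    have hon : (D.oracle K ε).n = n := rfl
    simp [hon, hS] at h0
  · refine Or.inr ⟨by norm_num, ?_⟩
    have : D.hitProb = 0 := le_antisymm h0 D.hitProb_nonneg
    simp only [D.expectedCost_eq_mul, this, zero_mul, mul_zero, le_refl]
  · have hmin : ∀ c, D.condCost φ y ≤ D.condCost φ c := fun c => by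
      have := hy c
      rw [D.expectedCost_eq_mul, D.expectedCost_eq_mul] at this
      exact le_of_mul_le_mul_left this h0
    have e4 : m₂.nat 4 0 = k := by
      rw [h₂]
      simp [hk, ProbInput.oracle]
    have e0 : ∀ a < 3, m₂.real a = m₁.real a := fun a _ => by simp [h₂]
    refine ValTriple.mono (valTriple_mainPhase (φ := φ) (k := k) (T := T) (y := y) hker h0 hε hkε hT
      hmin ⟨?_, ?_, ?_, ?_, ?_, ?_, ?_⟩) ?_ le_rfl
    · simp [e4, hT]
    · simp [e4]
    · simp [e4, hT]
    · simp only [Mem.setNat_real, e0 2 (by norm_num)]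
      exact hr2
    · intro w _
      simp only [Mem.setNat_real, e0 0 (by norm_num), e0 1 (by norm_num), hr0, hr1, and_self]
    · simp [listSum, e0, hr1]
    · simp [listSum, e0, hr0]
    · rintro m' e' (h | ⟨h, h'⟩)
      · exact Or.inl h
      · refine Or.inr ⟨h, ?_⟩
        rw [center_eq_listSum, D.expectedCost_eq_mul, D.expectedCost_eq_mul]
        have := mul_le_mul_of_nonneg_left h' h0.le
        linarith
  · simp [hk, ProbInput.oracle]
    omega
  · rw [programCost]
    simp [ProbInput.oracle]
    omega

end Main

/-! ### Polynomial estimates of the running time -/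

theorem drawCost_le {d n z T : ℕ} (hd : 1 ≤ d) (hn : 1 ≤ n) (hz : 1 ≤ z) (hT : 1 ≤ T) :
    drawCost d n z T ≤ 1200 * (d * n * (z + T ^ 2)) := by
  -- After shifting all variables by `1`, the difference of the two sides is a polynomial with
  -- nonnegative coefficients.
  obtain ⟨d, rfl⟩ := Nat.exists_eq_add_of_le' hd
  obtain ⟨n, rfl⟩ := Nat.exists_eq_add_of_le' hn
  obtain ⟨z, rfl⟩ := Nat.exists_eq_add_of_le' hz
  obtain ⟨T, rfl⟩ := Nat.exists_eq_add_of_le' hT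
  rw [drawCost]
  zify
  rw [← sub_nonneg]
  ring_nf
  positivity

theorem programCost_le {d n z k T : ℕ} (hd : 1 ≤ d) (hn : 1 ≤ n) (hz : 1 ≤ z) (hk : k ≤ T)
    (hT : 1 ≤ T) : programCost d n z k T ≤ 10000 * (d * n * (z * T + T ^ 3)) := by
  have h := drawCost_le hd hn hz hT
  have h' : programCost d n z k T ≤ (T + 2) * (1200 * (d * n * (z + T ^ 2))) +
      (n * (z * ((T + 1) * (d + 40) + d + 190) + 110) + (T + 1) * (T * 60 + 30) + 220 * T +
        300) := by
    rw [programCost, mainCost]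
    nlinarith [Nat.mul_le_mul_left (T + 2) h]
  refine h'.trans ?_
  clear h h' hk
  obtain ⟨d, rfl⟩ := Nat.exists_eq_add_of_le' hd
  obtain ⟨n, rfl⟩ := Nat.exists_eq_add_of_le' hn
  obtain ⟨z, rfl⟩ := Nat.exists_eq_add_of_le' hz
  obtain ⟨T, rfl⟩ := Nat.exists_eq_add_of_le' hT
  zify
  rw [← sub_nonneg]
  ring_nf
  positivity

/-- Since `k ≤ 2/ε`, one has `T ≤ 1474560 / ε²` with `1474560 = 4 · 368640`. The terms `zT` and `T³`
are then of order `z/ε²` and `1/ε⁶`. As `1/ε ≥ 9 > e`, the logarithm is at least `1`, and the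
claimed bound leaves room to spare. -/
theorem programCost_le_timeBound {d n z : ℕ} (hd : 1 ≤ d) (hn : 1 ≤ n) (hz : 1 ≤ z) {ε : ℝ}
    (hε : 0 < ε) (hε' : ε < 1 / 9) :
    (programCost d n z ⌈1 / ε⌉₊ (368640 * (⌈1 / ε⌉₊ * ⌈1 / ε⌉₊)) : ℝ) ≤
      10000 * 1474560 ^ 3 * timeBound d n z ε := by
  set k := ⌈1 / ε⌉₊
  set T := 368640 * (k * k) with hT
  have hk : 1 ≤ k := Nat.one_le_ceil_iff.2 (by positivity)
  have hinv : 9 ≤ 1 / ε := by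
    rw [le_div_iff₀ hε]
    linarith
  have hk' : (k : ℝ) ≤ 2 * (1 / ε) := by
    have := Nat.ceil_lt_add_one (a := 1 / ε) (by positivity)
    linarith
  have hlog : 1 ≤ Real.log (1 / ε) := by
    rw [Real.le_log_iff_exp_le (by positivity)]
    linarith [Real.exp_one_lt_d9]
  have hT' : (T : ℝ) ≤ 1474560 * (1 / ε) ^ 2 := by
    rw [hT]
    push_cast
    nlinarith [mul_le_mul hk' hk' (Nat.cast_nonneg k) (by positivity)]
  have hcost := programCost_le (k := k) (T := T) hd hn hz (by nlinarith) (by nlinarith)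
  have hcost' : (programCost d n z k T : ℝ) ≤ 10000 * (d * n * (z * T + (T : ℝ) ^ 3)) := by
    exact_mod_cast hcost
  refine hcost'.trans ?_
  have h₁ : (z : ℝ) * T ≤ 1474560 ^ 3 * (z / ε ^ 3 * Real.log (1 / ε)) := by
    have : (T : ℝ) ≤ 1474560 ^ 3 * ((1 / ε) ^ 3 * Real.log (1 / ε)) := by
      have h₂ : (1 / ε) ^ 2 * 1 ≤ (1 / ε) ^ 3 * Real.log (1 / ε) :=
        mul_le_mul (pow_le_pow_right₀ (by linarith) (by norm_num)) hlog zero_le_one (by positivity)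
      have : 0 ≤ (1 / ε) ^ 2 := by positivity
      linarith
    calc (z : ℝ) * T ≤ z * (1474560 ^ 3 * ((1 / ε) ^ 3 * Real.log (1 / ε))) := by gcongr
      _ = _ := by ring
  have h₂ : (T : ℝ) ^ 3 ≤ 1474560 ^ 3 * (1 / ε ^ 8 * Real.log (1 / ε) ^ 2) := by
    calc (T : ℝ) ^ 3 ≤ (1474560 * (1 / ε) ^ 2) ^ 3 := by gcongr
      _ = 1474560 ^ 3 * ((1 / ε) ^ 6 * 1) := by ring
      _ ≤ 1474560 ^ 3 * ((1 / ε) ^ 8 * Real.log (1 / ε) ^ 2) := by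
        gcongr
        · linarith
        · norm_num
        · exact one_le_pow₀ hlog
      _ = _ := by ring
  calc 10000 * (d * n * (z * T + (T : ℝ) ^ 3))
      ≤ 10000 * (d * n * (1474560 ^ 3 * (z / ε ^ 3 * Real.log (1 / ε)) +
          1474560 ^ 3 * (1 / ε ^ 8 * Real.log (1 / ε) ^ 2))) := by gcongr
    _ = _ := by
      rw [timeBound]
      ring

theorem ProbInput.one_le_of_one_le {d n z : ℕ} (D : ProbInput d n z) (hn : 1 ≤ n) : 1 ≤ z := by
  by_contra! h
  obtain rfl : z = 0 := by omega
  simpa using D.prob_sum ⟨0, hn⟩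

end PSVDD

theorem mainTheorem3 :
    ∃ (C : ℝ) (alg : PSVDD.Cmd), 0 < C ∧
      ∀ (d n z : ℕ), 1 ≤ d → 1 ≤ n →
      ∀ ε : ℝ, 0 < ε → ε < 1 / 9 →
      ∀ (H : Type*) [NormedAddCommGroup H] [InnerProductSpace ℝ H] [CompleteSpace H]
        (K : EuclideanSpace ℝ (Fin d) → EuclideanSpace ℝ (Fin d) → ℝ)
        (φ : EuclideanSpace ℝ (Fin d) → H), PSVDD.IsFeatureMap K φ →
      ∀ D : PSVDD.ProbInput d n z,
        ∃ cstar : H, IsMinOn (PSVDD.expectedCost D φ) Set.univ cstar ∧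
        ∃ t : ℕ,
          (∀ c ∈ (PSVDD.run (D.oracle K ε) alg t).support,
            c.halted ∧ (c.clock : ℝ) ≤ C * PSVDD.timeBound d n z ε) ∧
          1 / 8 ≤ (PSVDD.run (D.oracle K ε) alg t).toOuterMeasure
            {c | PSVDD.expectedCost D φ (PSVDD.center D φ c.mem) ≤
              (1 + ε) * PSVDD.expectedCost D φ cstar} := by
  refine ⟨10000 * 1474560 ^ 3, PSVDD.program, by norm_num, ?_⟩
  intro d n z hd hn ε hε hε' H _ _ _ K φ hK D
  obtain ⟨y, hy⟩ := D.exists_isMinOn_expectedCost φ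
  obtain ⟨hsupp, hprob⟩ := PSVDD.achieves_program (PSVDD.ker_oracle D hK ε) hε
    (fun c => hy (Set.mem_univ c)) 0
  refine ⟨y, hy, _, fun c hc => ⟨(hsupp c hc).1, ?_⟩, ?_⟩
  · refine le_trans ?_
      (PSVDD.programCost_le_timeBound hd hn (D.one_le_of_one_le hn) hε hε')
    exact_mod_cast (hsupp c hc).2.trans (zero_add _).le
  · have h := ENNReal.ofReal_le_of_le_toReal hprob
    rw [ENNReal.ofReal_div_of_pos (by norm_num), ENNReal.ofReal_one, ENNReal.ofReal_ofNat] at h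
    exact h
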